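/- **Lemma (Run Indistinguishability).** Let $k$ be the security parameter, and for every $k$ let a cyclic group $\mathbb G=\langle g\rangle$ of prime order $q$ be chosen (possibly at random) from a family of groups whose elements have injective representations of length polynomial in $k$ and can be multiplied in time polynomial in $k$. Assume that the Decision Diffie–Hellman (DDH) assumption holds for this family: for every probabilistic polynomial-time algorithm $D$, $$\bigl|\Pr[D(k,\mathbb G,q,g,g^{a},g^{b},g^{ab})=1]-\Pr[D(k,\mathbb G,q,g,g^{a},g^{b},g^{c})=1]\bigr|$$ is negligible in $k$, where $a,b,c\in_R\mathbb Z_q$ (here $\in_R$ means uniformly and independently chosen). Let $t=t(k)$ and $n=n(k)$ be integers with $1\le t\le n$ that are computable in time polynomial in $k$, with $n$ bounded by a polynomial in $k$. Consider the following game. 1. The group is chosen, and the oracle picks $\alpha\in_R\mathbb Z_q$ and sends the public key $(q,g,g^{\alpha})$ (with a description of $\mathbb G$ and $k$) and the parameters $t,n$ to the adversary $A$. 2. The oracle picks $b\in_R\{0,1\}$, coefficients $a_1,\dots,a_{t-1}\in_R\mathbb Z_q$ and points $x_1,\dots,x_n\in_R\mathbb Z_q$, sets $f(x)=\alpha+\sum_{j=1}^{t-1}a_jx^j$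 and $\alpha_i=f(x_i)$ for $1\le i\le n$, and sends $x_1,\dots,x_n$ to $A$. 3. As many times as it wishes, and adaptively, $A$ chooses distinct indices $i_1,\dots,i_{t-1}\in\{1,\dots,n\}$ and sends them to the oracle. If $b=0$, the oracle picks a fresh $r\in_R\mathbb Z_q$ and answers with $$g^{r},\ g^{r\alpha},\ g^{r\alpha_{i_1}},\dots,g^{r\alpha_{i_{t-1}}}.$$ If $b=1$, it picks fresh $r,r_1,\dots,r_{t-1}\in_R\mathbb Z_q$ and answers with $$g^{r},\ g^{r\alpha},\ g^{rr_1},\dots,g^{rr_{t-1}}.$$ 4. Finally, $A$ outputs a guess $b'\in\{0,1\}$. Then for every probabilistic polynomial-time adversary $A$ the advantage $\bigl|\Pr[b'=b]-\tfrac12\bigr|$ is negligible in $k$. Here algorithms are uniform programs with random choices; polynomial time means that the number of steps is bounded by a polynomial in $k$ in every execution, for $A$ whatever group elements its oracle answers with. A function of $k$ is negligible if it tends to zero faster than the inverse of every polynomial in $k$. -/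

import Mathlib

/-!
A probabilistic polynomial-time machine model (array programs with logarithmic cost and an oracle
instruction), families of cyclic groups of prime order, the Decision Diffie-Hellman assumption and
the run-indistinguishability game of threshold ElGamal.
-/

namespace RunInd

/-! ### Machine model -/

/-- The memory of a machine: countably many arrays of natural numbers, named by natural numbers;
`m a j` is the entry with index `j` of the array `a`. -/
abbrev Mem : Type := ℕ → ℕ → ℕ

/-- Overwrite one entry of one array. -/
def Mem.write (m : Mem) (a j v : ℕ) : Mem :=
  fun a' j' => if a' = a ∧ j' = j then v else m a' j'

/-- Reset all the entries of one array to zero. -/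
def Mem.clear (m : Mem) (a : ℕ) : Mem :=
  fun a' j' => if a' = a then 0 else m a' j'

/-- Write a list into the first entries of one array, leaving the other entries as they are. -/
def Mem.writeList (m : Mem) (a : ℕ) (l : List ℕ) : Mem :=
  fun a' j' => if a' = a then l.getD j' (m a j') else m a' j'

/-- Arithmetic expressions; `get a e` reads the entry of the array `a` at a computed index.
Subtraction is truncated, and division by zero gives zero. -/
inductive Expr : Type
  | const (v : ℕ)
  | get (a : ℕ) (e : Expr)
  | add (e f : Expr)
  | sub (e f : Expr)
  | mul (e f : Expr)
  | div (e f : Expr)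
  | mod (e f : Expr)

/-- The value of an expression. -/
def Expr.eval (m : Mem) : Expr → ℕ
  | .const v => v
  | .get a e => m a (e.eval m)
  | .add e f => e.eval m + f.eval m
  | .sub e f => e.eval m - f.eval m
  | .mul e f => e.eval m * f.eval m
  | .div e f => e.eval m / f.eval m
  | .mod e f => e.eval m % f.eval m

/-- Logarithmic cost of evaluating an expression: every node of the expression is charged one plus
the bit length of its value. -/
def Expr.cost (m : Mem) : Expr → ℕ
  | .const v => 1 + v.size
  | .get a e => e.cost m + (1 + (m a (e.eval m)).size)
  | .add e f => e.cost m + f.cost m + (1 + (e.eval m + f.eval m).size)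
  | .sub e f => e.cost m + f.cost m + (1 + (e.eval m - f.eval m).size)
  | .mul e f => e.cost m + f.cost m + (1 + (e.eval m * f.eval m).size)
  | .div e f => e.cost m + f.cost m + (1 + (e.eval m / f.eval m).size)
  | .mod e f => e.cost m + f.cost m + (1 + (e.eval m % f.eval m).size)

/-- Probabilistic oracle programs. Loops carry a bound that is evaluated on entry, so that every
program halts; as only machines with a strict polynomial time bound are ever considered, and a
clocked machine is simulated by a bounded loop around its transition, nothing is lost by that. -/
inductive Cmd : Type
  /-- do nothing -/
  | skip
  /-- `a[e] := f` -/
  | assign (a : ℕ) (e f : Expr)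
  /-- `a[e] :=` a uniformly random element of `{0, …, f - 1}` -/
  | rand (a : ℕ) (e f : Expr)
  /-- reset the array `a` to zero (amortised against the earlier writes to `a`) -/
  | clear (a : ℕ)
  /-- submit the contents of the array `a` to the oracle, write its reply to the array `b` -/
  | query (a b : ℕ)
  | seq (c d : Cmd)
  /-- run `c` if the value of `e` is not zero, and `d` otherwise -/
  | ite (e : Expr) (c d : Cmd)
  /-- run `c` as many times as the value of `e` on entry says -/
  | loop (e : Expr) (c : Cmd)

/-- An oracle reads an array and replies with a random list; it draws fresh randomness in every
call. -/
abbrev Oracle : Type := (ℕ → ℕ) → PMF (List ℕ)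

/-- The oracle that replies with the empty list; programs are run with it if they are not meant to
interact with anything. -/
noncomputable def noOracle : Oracle := fun _ => PMF.pure []

/-- The uniform distribution on `{0, …, N - 1}` (the constant `0` if `N = 0`). -/
noncomputable def uniformBelow (N : ℕ) : PMF ℕ :=
  if h : N = 0 then PMF.pure 0
  else PMF.uniformOfFinset (Finset.range N) (Finset.nonempty_range_iff.mpr h)

/-- Run a randomized computation `N` times in a row, adding up the costs, plus one for every
iteration. -/
noncomputable def iterateRun (f : Mem → PMF (Mem × ℕ)) : ℕ → Mem → PMF (Mem × ℕ)
  | 0, m => PMF.pure (m, 0)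
  | N + 1, m => (f m).bind fun y => (iterateRun f N y.1).bind fun z =>
      PMF.pure (z.1, y.2 + z.2 + 1)

/-- Execution of a program with access to an oracle: the joint distribution of the final memory and
of the number of steps (logarithmic cost) taken. -/
noncomputable def Cmd.exec (O : Oracle) : Cmd → Mem → PMF (Mem × ℕ)
  | .skip, m => PMF.pure (m, 1)
  | .assign a e f, m =>
      PMF.pure (m.write a (e.eval m) (f.eval m), e.cost m + f.cost m + 1)
  | .rand a e f, m => (uniformBelow (f.eval m)).bind fun v =>
      PMF.pure (m.write a (e.eval m) v, e.cost m + f.cost m + 1)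
  | .clear a, m => PMF.pure (m.clear a, 1)
  | .query a b, m => (O (m a)).bind fun l => PMF.pure (m.writeList b l, 1)
  | .seq c d, m => (c.exec O m).bind fun y => (d.exec O y.1).bind fun z =>
      PMF.pure (z.1, y.2 + z.2)
  | .ite e c d, m => (if e.eval m ≠ 0 then c.exec O m else d.exec O m).bind fun y =>
      PMF.pure (y.1, e.cost m + y.2 + 1)
  | .loop e c, m => (iterateRun (c.exec O) (e.eval m) m).bind fun y =>
      PMF.pure (y.1, e.cost m + y.2 + 1)

/-- The initial memory: the input stands in the array `0`, everything else is zero. -/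
def inputMem (l : List ℕ) : Mem := fun a j => if a = 0 then l.getD j 0 else 0

/-- The output is the first entry of the array `1`. -/
def output (m : Mem) : ℕ := m 1 0

/-- A decision is read off the output: `true` if it is not zero. -/
def outputBit (m : Mem) : Bool := decide (output m ≠ 0)

/-- `f` is computable in time polynomial in its argument (that is, from a unary argument). -/
def PolyTimeComputable (f : ℕ → ℕ) : Prop :=
  ∃ (c : Cmd) (p : Polynomial ℕ), ∀ k : ℕ,
    ∀ z ∈ (c.exec noOracle (inputMem [k])).support, output z.1 = f k ∧ z.2 ≤ p.eval k

/-- A function of the security parameter is negligible if it decays faster than the inverse of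
every polynomial. -/
def Negligible (f : ℕ → ℝ) : Prop :=
  Asymptotics.SuperpolynomialDecay Filter.atTop (fun k : ℕ => (k : ℝ)) f

/-! ### Groups -/

/-- A family of cyclic groups of prime order with efficient multiplication. `setup k` is the
distribution of the group for the security parameter `k` (a point mass if there is one fixed group
for every `k`). -/
structure GroupFamily where
  /-- names of the groups in the family -/
  Inst : Type
  /-- the group with a given name -/
  G : Inst → Type
  [group : ∀ i, Group (G i)]
  /-- the order of the group -/
  q : Inst → ℕ
  /-- the generator of the group -/
  gen : ∀ i, G i
  prime_q : ∀ i, (q i).Prime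
  card_eq : ∀ i, Nat.card (G i) = q i
  gen_generates : ∀ (i) (y : G i), y ∈ Subgroup.zpowers (gen i)
  /-- the representation of group elements as numbers -/
  enc : ∀ i, G i → ℕ
  enc_injective : ∀ i, Function.Injective (enc i)
  /-- a description of the group that is handed to all the algorithms, such as a modulus -/
  desc : Inst → ℕ
  /-- the choice of the group -/
  setup : ℕ → PMF Inst
  /-- the multiplication algorithm -/
  mulProg : Cmd
  /-- a bound for the size of the representations and the running time of multiplication -/
  bound : Polynomial ℕ
  desc_size : ∀ k, ∀ i ∈ (setup k).support, (desc i).size ≤ bound.eval k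
  enc_size : ∀ k, ∀ i ∈ (setup k).support, ∀ y : G i, (enc i y).size ≤ bound.eval k
  mulProg_spec : ∀ k, ∀ i ∈ (setup k).support, ∀ y y' : G i,
    ∀ z ∈ (mulProg.exec noOracle (inputMem [desc i, enc i y, enc i y'])).support,
      output z.1 = enc i (y * y') ∧ z.2 ≤ bound.eval k

namespace GroupFamily

variable (F : GroupFamily)

instance instGroup (i : F.Inst) : Group (F.G i) := F.group i

instance instFactPrime (i : F.Inst) : Fact (F.q i).Prime := ⟨F.prime_q i⟩

/-- `g ^ a` for an exponent modulo the group order. -/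
def gpow (i : F.Inst) (a : ZMod (F.q i)) : F.G i := F.gen i ^ a.val

/-- A uniformly random residue modulo the group order. -/
noncomputable def unif (i : F.Inst) : PMF (ZMod (F.q i)) := PMF.uniformOfFintype _

/-- A uniformly random vector of `s` residues modulo the group order. -/
noncomputable def unifVec (i : F.Inst) (s : ℕ) : PMF (Fin s → ZMod (F.q i)) :=
  PMF.uniformOfFintype _

/-! ### The Decision Diffie-Hellman assumption -/

/-- The input `k, G, q, g, X, Y, Z` of a Diffie-Hellman distinguisher. -/
def ddhInput (k : ℕ) (i : F.Inst) (X Y Z : F.G i) : Mem :=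
  inputMem [k, F.desc i, F.q i, F.enc i (F.gen i), F.enc i X, F.enc i Y, F.enc i Z]

/-- The decision of a distinguisher on `g ^ a, g ^ b, g ^ (a * b)` for random `a, b`. -/
noncomputable def ddhReal (D : Cmd) (k : ℕ) : PMF Bool :=
  (F.setup k).bind fun i => (F.unif i).bind fun a => (F.unif i).bind fun b =>
    (D.exec noOracle (F.ddhInput k i (F.gpow i a) (F.gpow i b) (F.gpow i (a * b)))).bind fun z =>
      PMF.pure (outputBit z.1)

/-- The decision of a distinguisher on `g ^ a, g ^ b, g ^ c` for random `a, b, c`. -/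
noncomputable def ddhRandom (D : Cmd) (k : ℕ) : PMF Bool :=
  (F.setup k).bind fun i => (F.unif i).bind fun a => (F.unif i).bind fun b =>
    (F.unif i).bind fun c =>
      (D.exec noOracle (F.ddhInput k i (F.gpow i a) (F.gpow i b) (F.gpow i c))).bind fun z =>
        PMF.pure (outputBit z.1)

/-- A distinguisher runs in polynomial time. -/
def DDHPolyTime (D : Cmd) : Prop :=
  ∃ p : Polynomial ℕ, ∀ k, ∀ i ∈ (F.setup k).support, ∀ X Y Z : F.G i,
    ∀ z ∈ (D.exec noOracle (F.ddhInput k i X Y Z)).support, z.2 ≤ p.eval k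

/-- The Decision Diffie-Hellman assumption: every polynomial-time distinguisher has a negligible
advantage. -/
def DDH : Prop :=
  ∀ D : Cmd, F.DDHPolyTime D →
    Negligible fun k => |(F.ddhReal D k true).toReal - (F.ddhRandom D k true).toReal|

/-! ### The game -/

/-- The share at the point `x`, that is, the value there of the polynomial of degree at most `s`
with constant term `α` and further coefficients `c`. -/
def share (i : F.Inst) {s : ℕ} (α : ZMod (F.q i)) (c : Fin s → ZMod (F.q i))
    (x : ZMod (F.q i)) : ZMod (F.q i) :=
  α + ∑ j : Fin s, c j * x ^ ((j : ℕ) + 1)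

/-- A reply of the oracle: two group elements, followed by one for each requested index. -/
abbrev Reply (i : F.Inst) (s : ℕ) : Type := F.G i × F.G i × (Fin s → F.G i)

/-- The representation of a reply as a list of numbers. -/
def encReply (i : F.Inst) {s : ℕ} (y : F.Reply i s) : List ℕ :=
  F.enc i y.1 :: F.enc i y.2.1 :: List.ofFn fun j => F.enc i (y.2.2 j)

open Classical in
/-- Let a program talk to an oracle for `s`-sets of indices below `n`: a request consists of `s`
distinct indices in the first `s` entries of an array. Malformed requests get an empty reply. -/
noncomputable def toOracle (i : F.Inst) (s n : ℕ)
    (R : (Fin s ↪ Fin n) → PMF (F.Reply i s)) : Oracle := fun a =>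
  if h : ∃ I : Fin s ↪ Fin n, ∀ j : Fin s, a j = I j then
    (R h.choose).bind fun y => PMF.pure (F.encReply i y)
  else PMF.pure []

/-- The genuine replies `g ^ r, g ^ (r * α)` and `g ^ (r * α_j)` for each requested index `j`. -/
noncomputable def realReply (i : F.Inst) {s n : ℕ} (α : ZMod (F.q i)) (c : Fin s → ZMod (F.q i))
    (x : Fin n → ZMod (F.q i)) (I : Fin s ↪ Fin n) : PMF (F.Reply i s) :=
  (F.unif i).bind fun r =>
    PMF.pure (F.gpow i r, F.gpow i (r * α), fun j => F.gpow i (r * F.share i α c (x (I j))))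

/-- The replies with the share exponents replaced by fresh random ones. -/
noncomputable def randomReply (i : F.Inst) {s n : ℕ} (α : ZMod (F.q i))
    (_I : Fin s ↪ Fin n) : PMF (F.Reply i s) :=
  (F.unif i).bind fun r => (F.unifVec i s).bind fun ρ =>
    PMF.pure (F.gpow i r, F.gpow i (r * α), fun j => F.gpow i (r * ρ j))

/-- The data `k, G, q, g, h, t, n, x_1, …, x_n` that the adversary receives at the beginning. -/
def gameInput (k : ℕ) (i : F.Inst) (t n : ℕ) (h : F.G i) (x : Fin n → ZMod (F.q i)) : Mem :=
  inputMem (k :: F.desc i :: F.q i :: F.enc i (F.gen i) :: F.enc i h :: t :: n ::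
    List.ofFn fun j => (x j).val)

/-- The adversary's guess in the game with the bit `b`. -/
noncomputable def gameGuess (t n : ℕ) (A : Cmd) (b : Bool) (k : ℕ) : PMF Bool :=
  (F.setup k).bind fun i => (F.unif i).bind fun α =>
    (F.unifVec i (t - 1)).bind fun c => (F.unifVec i n).bind fun x =>
      (A.exec
        (F.toOracle i (t - 1) n (if b then F.randomReply i α else F.realReply i α c x))
        (F.gameInput k i t n (F.gpow i α) x)).bind fun z =>
          PMF.pure (outputBit z.1)

/-- Whether the adversary guesses a random bit `b` correctly. -/
noncomputable def gameWin (t n : ℕ) (A : Cmd) (k : ℕ) : PMF Bool :=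
  (PMF.uniformOfFintype Bool).bind fun b => (F.gameGuess t n A b k).bind fun b' =>
    PMF.pure (decide (b' = b))

/-- An adversary runs in polynomial time, whatever group elements its oracle replies with. -/
def GamePolyTime (t n : ℕ → ℕ) (A : Cmd) : Prop :=
  ∃ p : Polynomial ℕ, ∀ k, ∀ i ∈ (F.setup k).support, ∀ (h : F.G i)
    (x : Fin (n k) → ZMod (F.q i))
    (R : (Fin (t k - 1) ↪ Fin (n k)) → PMF (F.Reply i (t k - 1))),
    ∀ z ∈ (A.exec (F.toOracle i (t k - 1) (n k) R) (F.gameInput k i (t k) (n k) h x)).support,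
      z.2 ≤ p.eval k

end GroupFamily

end RunInd

/-! Write `s = t - 1`. The two games are joined by hybrids `0, …, s`: in hybrid `l` the first `l`
coefficients of the sharing polynomial are drawn afresh for every reply, while the others and the
key `α` stay fixed. Hybrid `0` is the genuine game. In hybrid `s` all coefficients are fresh and a
reply concerns `s` points. If these are distinct and nonzero, a Vandermonde argument makes the map
from coefficients to shares bijective, so the shares are fresh uniform residues, as in the random
game (`hybridReply_last`). Points that are not of this kind occur with probability at most `(n +
n²)/q` (`unifVec_bad`).

Neighbouring hybrids are linked by random self-reducibility of Diffie-Hellman triples. Let `X, Y, Z`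
have exponents `a₀, b₀, c₀`; the unknown `b₀` plays the coefficient with index `l`. For each reply
draw `a, b` and form `g^r = g^a X^b` and `W = Y^a Z^b`. If `c₀ = a₀ b₀`, then `W = g^(r b₀)` with
`r` uniform, and this is hybrid `l` (`kernel_real`). Otherwise `(a, b)` is mapped to the exponents
of `g^r` and `W` by a linear map of determinant `c₀ - a₀ b₀ ≠ 0`, so the exponent of `W` is uniform
and independent of `r`; for `r ≠ 0` it is `r v` with a fresh coefficient `v`, and this is hybrid `l
+ 1` (`kernel_random`). For `r = 0` the reply has to be trivial, so `W` is then replaced by the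
identity. The simulation is therefore exact, and the only loss is that a random triple is a
Diffie-Hellman triple with probability `1/q`. Drawing `l` at random and telescoping costs a factor
`s` (`hybrid_advantage`).

That the mean of `1/q` is negligible is not assumed but follows from the Decision Diffie-Hellman
assumption: a product of two random residues vanishes at least `3/2` times as often as one random
residue, and a program can test whether `Z` is the identity (`collision_negligible`).

The larger part of the work is to write the reduction as a program of polynomial cost. The
adversary's code is copied with its arrays renamed and its oracle calls replaced by a subprogram;
`Cmd.lift_subst` couples the two executions and compares their costs. Since costs are logarithmic,
an adversary that has spent few steps holds only short numbers, which bounds the price of each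
simulated call. The adversary's time bound holds for arbitrary replies, hence also for the simulated
ones. -/

open scoped ENNReal

namespace RunInd

/-! ### Relational lifting of distributions -/

/-- `Lift R μ ν`: there is a coupling of `μ` and `ν` concentrated on the relation `R`. -/
def Lift {α β : Type*} (R : α → β → Prop) (μ : PMF α) (ν : PMF β) : Prop :=
  ∃ κ : PMF (α × β), κ.map Prod.fst = μ ∧ κ.map Prod.snd = ν ∧ ∀ z ∈ κ.support, R z.1 z.2

namespace Lift

variable {α β γ δ : Type*} {R : α → β → Prop} {μ : PMF α} {ν : PMF β}

theorem pure {x : α} {y : β} (h : R x y) : Lift R (PMF.pure x) (PMF.pure y) :=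
  ⟨PMF.pure (x, y), by simp [PMF.pure_map], by simp [PMF.pure_map], by simpa using h⟩

theorem mono {R' : α → β → Prop} (h : Lift R μ ν)
    (hR : ∀ x ∈ μ.support, ∀ y ∈ ν.support, R x y → R' x y) : Lift R' μ ν := by
  obtain ⟨κ, rfl, rfl, h3⟩ := h
  refine ⟨κ, rfl, rfl, fun z hz => hR _ ?_ _ ?_ (h3 z hz)⟩
  · exact (PMF.mem_support_map_iff _ _ _).2 ⟨z, hz, rfl⟩
  · exact (PMF.mem_support_map_iff _ _ _).2 ⟨z, hz, rfl⟩

/-- Couplings compose: draw a pair from the coupling of `μ` and `ν`, then a pair from the coupling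
that belongs to it. -/
theorem bind {R' : γ → δ → Prop} {f : α → PMF γ} {g : β → PMF δ} (h : Lift R μ ν)
    (hf : ∀ x y, R x y → Lift R' (f x) (g y)) : Lift R' (μ.bind f) (ν.bind g) := by
  obtain ⟨κ, rfl, rfl, h3⟩ := h
  have hx : ∀ z : α × β, ∃ κ' : PMF (γ × δ), κ'.map Prod.fst = f z.1 ∧ κ'.map Prod.snd = g z.2 ∧
      (R z.1 z.2 → ∀ w ∈ κ'.support, R' w.1 w.2) := by
    intro z
    by_cases hz : R z.1 z.2
    · obtain ⟨κ', a, b, c⟩ := hf _ _ hz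
      exact ⟨κ', a, b, fun _ => c⟩
    -- Pairs off the relation never occur, but the family `κ'` must be total with the right
    -- marginals; the independent coupling serves there.
    · refine ⟨(f z.1).bind fun x => (g z.2).map fun y => (x, y), ?_, ?_, fun h => absurd h hz⟩
      · simp only [PMF.map_bind, PMF.map_comp, Function.comp_def]
        simp only [PMF.map, Function.comp_def, PMF.bind_const, PMF.bind_pure]
      · simp only [PMF.map_bind, PMF.map_comp, Function.comp_def]
        rw [show (fun y : δ => y) = id from rfl]
        simp only [PMF.map_id, PMF.bind_const]
  choose κ' a b c using hx
  refine ⟨κ.bind κ', ?_, ?_, ?_⟩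
  · simp only [PMF.map_bind, a, PMF.bind_map, Function.comp_def]
  · simp only [PMF.map_bind, b, PMF.bind_map, Function.comp_def]
  · intro w hw
    obtain ⟨z, hz, hw⟩ := (PMF.mem_support_bind_iff _ _ _).1 hw
    exact c z (h3 z hz) w hw

theorem refl (h : ∀ x ∈ μ.support, R' x x) : Lift (R' : α → α → Prop) μ μ := by
  refine ⟨μ.map fun x => (x, x), ?_, ?_, ?_⟩
  · simp only [PMF.map_comp, Function.comp_def]; exact PMF.map_id μ
  · simp only [PMF.map_comp, Function.comp_def]; exact PMF.map_id μ
  · intro z hz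
    obtain ⟨x, hx, rfl⟩ := (PMF.mem_support_map_iff _ _ _).1 hz
    exact h x hx

theorem pure_left {x : α} (h : ∀ y ∈ ν.support, R x y) : Lift R (PMF.pure x) ν := by
  refine ⟨ν.map fun y => (x, y), ?_, ?_, ?_⟩
  · simp only [PMF.map_comp, Function.comp_def]; exact PMF.map_const ν x
  · simp only [PMF.map_comp, Function.comp_def]; exact PMF.map_id ν
  · intro z hz
    obtain ⟨y, hy, rfl⟩ := (PMF.mem_support_map_iff _ _ _).1 hz
    exact h y hy

/-- This is how a coupling yields an equality of output distributions. -/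
theorem map_eq {f : α → γ} {g : β → γ} (h : Lift R μ ν) (hR : ∀ x y, R x y → f x = g y) :
    μ.map f = ν.map g := by
  classical
  obtain ⟨κ, rfl, rfl, h3⟩ := h
  rw [PMF.map_comp, PMF.map_comp]
  ext c
  rw [PMF.map_apply, PMF.map_apply]
  refine tsum_congr fun z => ?_
  by_cases hz : z ∈ κ.support
  · have e := hR _ _ (h3 z hz)
    simp only [Function.comp]
    convert rfl using 2
    simp [e]
  · have : κ z = 0 := by simpa [PMF.mem_support_iff] using hz
    simp [this]

/-- Carries statements about every execution, such as time bounds, from one side of a coupling to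
the other. -/
theorem exists_left (h : Lift R μ ν) {y : β} (hy : y ∈ ν.support) : ∃ x ∈ μ.support, R x y := by
  obtain ⟨κ, rfl, rfl, h3⟩ := h
  obtain ⟨z, hz, rfl⟩ := (PMF.mem_support_map_iff _ _ _).1 hy
  exact ⟨z.1, (PMF.mem_support_map_iff _ _ _).2 ⟨z, hz, rfl⟩, h3 z hz⟩

/-- Only the right side moves on; used when a program does further bookkeeping, such as adding up
costs, after the abstract experiment has ended. -/
theorem bind_pure_left {R' : α → δ → Prop} {g : β → PMF δ} (h : Lift R μ ν)
    (hf : ∀ x y, R x y → ∀ z ∈ (g y).support, R' x z) : Lift R' μ (ν.bind g) := by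
  have := h.bind (R' := R') (f := PMF.pure) (g := g) fun x y hxy => pure_left (hf x y hxy)
  rwa [PMF.bind_pure] at this

theorem bind_left {R' : γ → β → Prop} {f : α → PMF γ} (h : Lift R μ ν)
    (hf : ∀ x y, R x y → Lift R' (f x) (PMF.pure y)) : Lift R' (μ.bind f) ν := by
  have := h.bind (R' := R') (f := f) (g := PMF.pure) hf
  rwa [PMF.bind_pure] at this

theorem map_left {R' : γ → β → Prop} {f : α → γ} (h : Lift (fun x y => R' (f x) y) μ ν) :
    Lift R' (μ.map f) ν :=
  h.bind_left fun _ _ hxy => pure hxy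

end Lift

/-! ### Renaming of arrays and replacement of oracle calls -/

/-- Rename the arrays of an expression. -/
def Expr.rename (ρ : ℕ → ℕ) : Expr → Expr
  | .const v => .const v
  | .get a e => .get (ρ a) (e.rename ρ)
  | .add e f => .add (e.rename ρ) (f.rename ρ)
  | .sub e f => .sub (e.rename ρ) (f.rename ρ)
  | .mul e f => .mul (e.rename ρ) (f.rename ρ)
  | .div e f => .div (e.rename ρ) (f.rename ρ)
  | .mod e f => .mod (e.rename ρ) (f.rename ρ)

/-- Rename the arrays of a program and replace its oracle calls by subprograms. -/
def Cmd.subst (ρ : ℕ → ℕ) (σ : ℕ → ℕ → Cmd) : Cmd → Cmd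
  | .skip => .skip
  | .assign a e f => .assign (ρ a) (e.rename ρ) (f.rename ρ)
  | .rand a e f => .rand (ρ a) (e.rename ρ) (f.rename ρ)
  | .clear a => .clear (ρ a)
  | .query a b => σ a b
  | .seq c d => .seq (c.subst ρ σ) (d.subst ρ σ)
  | .ite e c d => .ite (e.rename ρ) (c.subst ρ σ) (d.subst ρ σ)
  | .loop e c => .loop (e.rename ρ) (c.subst ρ σ)

/-- All the arrays of an expression have names below its width. -/
def Expr.width : Expr → ℕ
  | .const _ => 0
  | .get a e => max (a + 1) e.width
  | .add e f => max e.width f.width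
  | .sub e f => max e.width f.width
  | .mul e f => max e.width f.width
  | .div e f => max e.width f.width
  | .mod e f => max e.width f.width

/-- All the arrays of a program have names below its width. -/
def Cmd.width : Cmd → ℕ
  | .skip => 0
  | .assign a e f => max (a + 1) (max e.width f.width)
  | .rand a e f => max (a + 1) (max e.width f.width)
  | .clear a => a + 1
  | .query a b => max (a + 1) (b + 1)
  | .seq c d => max c.width d.width
  | .ite e c d => max e.width (max c.width d.width)
  | .loop e c => max e.width c.width

/-- The first `B` arrays of `m` are the renamed arrays of `m'`. -/
def View (ρ : ℕ → ℕ) (B : ℕ) (m m' : Mem) : Prop := ∀ a < B, m' (ρ a) = m a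

theorem View.expr {ρ : ℕ → ℕ} {B : ℕ} {m m' : Mem} (h : View ρ B m m') (e : Expr)
    (he : e.width ≤ B) :
    (e.rename ρ).eval m' = e.eval m ∧ (e.rename ρ).cost m' = e.cost m := by
  induction e with
  | const v => exact ⟨rfl, rfl⟩
  | get a e ih =>
    simp only [Expr.width, max_le_iff] at he
    simp [Expr.rename, Expr.eval, Expr.cost, ih he.2, h a (by omega)]
  | add e f ih1 ih2 | sub e f ih1 ih2 | mul e f ih1 ih2 | div e f ih1 ih2 | mod e f ih1 ih2 =>
    simp only [Expr.width, max_le_iff] at he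
    simp [Expr.rename, Expr.eval, Expr.cost, ih1 he.1, ih2 he.2]

theorem View.write {ρ : ℕ → ℕ} (hρ : Function.Injective ρ) {B : ℕ} {m m' : Mem}
    (h : View ρ B m m') (a j v : ℕ) : View ρ B (m.write a j v) (m'.write (ρ a) j v) := by
  intro b hb
  funext l
  simp [Mem.write, hρ.eq_iff, h b hb]

theorem View.clear {ρ : ℕ → ℕ} (hρ : Function.Injective ρ) {B : ℕ} {m m' : Mem}
    (h : View ρ B m m') (a : ℕ) : View ρ B (m.clear a) (m'.clear (ρ a)) := by
  intro b hb
  funext l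
  simp [Mem.clear, hρ.eq_iff, h b hb]

/-- The entries of the first `B` arrays have at most `S` bits. -/
def SizeLe (B : ℕ) (m : Mem) (S : ℕ) : Prop := ∀ a < B, ∀ j, (m a j).size ≤ S

theorem SizeLe.mono {B S S' : ℕ} {m : Mem} (h : SizeLe B m S) (hS : S ≤ S') : SizeLe B m S' :=
  fun a ha j => (h a ha j).trans hS

theorem SizeLe.write {B S : ℕ} {m : Mem} (h : SizeLe B m S) (a j : ℕ) {v : ℕ} (hv : v.size ≤ S) :
    SizeLe B (m.write a j v) S := by
  intro b hb l
  simp only [Mem.write]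
  split_ifs
  exacts [hv, h b hb l]

theorem SizeLe.clear {B S : ℕ} {m : Mem} (h : SizeLe B m S) (a : ℕ) : SizeLe B (m.clear a) S := by
  intro b hb l
  simp only [Mem.clear]
  split_ifs
  exacts [by simp, h b hb l]

theorem SizeLe.writeList {B S : ℕ} {m : Mem} (h : SizeLe B m S) (a : ℕ) {l : List ℕ}
    (hl : ∀ v ∈ l, v.size ≤ S) : SizeLe B (m.writeList a l) S := by
  intro b hb j
  simp only [Mem.writeList]
  split_ifs with hba
  · by_cases hj : j < l.length
    · rw [List.getD_eq_getElem _ _ hj]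
      exact hl _ (List.getElem_mem hj)
    · rw [List.getD_eq_default _ _ (by omega)]
      exact h a (hba ▸ hb) j
  · exact h b hb j

theorem Expr.size_eval_le_cost (e : Expr) (m : Mem) : (e.eval m).size ≤ e.cost m := by
  cases e <;> simp only [Expr.eval, Expr.cost] <;> omega

theorem uniformBelow_support {N v : ℕ} (h : v ∈ (uniformBelow N).support) :
    v ≤ N ∧ (N ≠ 0 → v < N) := by
  unfold uniformBelow at h
  split_ifs at h with hN
  · simp at h
    omega
  · have := (PMF.mem_support_uniformOfFinset_iff _ _).1 h
    rw [Finset.mem_range] at this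
    omega

/-- The subprograms `σ` simulate the oracle `O` in the arrays `ρ` within time `K`, under the
invariant `J`; the replies consist of numbers of at most `N` bits. -/
def Simulates (O : Oracle) (ρ : ℕ → ℕ) (σ : ℕ → ℕ → Cmd) (B N : ℕ) (J : Mem → Prop)
    (K : ℕ → ℕ) : Prop :=
  ∀ a < B, ∀ b < B, ∀ m m' S, N ≤ S → SizeLe B m S → View ρ B m m' → J m' →
    Lift (fun l z => View ρ B (m.writeList b l) z.1 ∧ J z.1 ∧ z.2 ≤ K S ∧ ∀ v ∈ l, v.size ≤ N)
      (O (m a)) ((σ a b).exec noOracle m')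

/-- Relation between the results of a program and of its simulation. -/
def SimRel (ρ : ℕ → ℕ) (B : ℕ) (J : Mem → Prop) (K : ℕ → ℕ) (S : ℕ) (z z' : Mem × ℕ) : Prop :=
  View ρ B z.1 z'.1 ∧ J z'.1 ∧ SizeLe B z.1 (max S z.2) ∧ z'.2 ≤ z.2 * K (max S z.2)

/-- The second program starts with entries of up to `max S y.2` bits. Monotonicity of `K` lets both
time bounds be stated with the total number of steps, and `1 ≤ K` absorbs the `k` steps charged for
the composition itself. -/
theorem SimRel.seq {ρ : ℕ → ℕ} {B : ℕ} {J : Mem → Prop} {K : ℕ → ℕ} (hK : Monotone K)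
    (hK1 : ∀ S, 1 ≤ K S) {S : ℕ} {y y' z z' : Mem × ℕ} (h1 : SimRel ρ B J K S y y')
    (h2 : SimRel ρ B J K (max S y.2) z z') (k : ℕ) :
    SimRel ρ B J K S (z.1, y.2 + z.2 + k) (z'.1, y'.2 + z'.2 + k) := by
  obtain ⟨-, -, -, h1⟩ := h1
  obtain ⟨a, b, c, d⟩ := h2
  have e1 : max S y.2 ≤ max S (y.2 + z.2 + k) := by omega
  have e2 : max (max S y.2) z.2 ≤ max S (y.2 + z.2 + k) := by omega
  refine ⟨a, b, c.mono e2, ?_⟩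
  calc y'.2 + z'.2 + k ≤ y.2 * K (max S (y.2 + z.2 + k)) + z.2 * K (max S (y.2 + z.2 + k))
        + k * K (max S (y.2 + z.2 + k)) := by
        gcongr
        · exact h1.trans (by gcongr; exact hK e1)
        · exact d.trans (by gcongr; exact hK e2)
        · exact Nat.le_mul_of_pos_right _ (hK1 _)
    _ = _ := by ring

theorem SimRel.add {ρ : ℕ → ℕ} {B : ℕ} {J : Mem → Prop} {K : ℕ → ℕ} (hK : Monotone K)
    (hK1 : ∀ S, 1 ≤ K S) {S : ℕ} {y y' : Mem × ℕ} (h1 : SimRel ρ B J K S y y') (k l : ℕ) :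
    SimRel ρ B J K S (y.1, k + y.2 + l) (y'.1, k + y'.2 + l) := by
  obtain ⟨a, b, c, h1⟩ := h1
  have e1 : max S y.2 ≤ max S (k + y.2 + l) := by omega
  refine ⟨a, b, c.mono e1, ?_⟩
  calc k + y'.2 + l ≤ k * K (max S (k + y.2 + l)) + y.2 * K (max S (k + y.2 + l))
        + l * K (max S (k + y.2 + l)) := by
        gcongr
        · exact Nat.le_mul_of_pos_right _ (hK1 _)
        · exact h1.trans (by gcongr; exact hK e1)
        · exact Nat.le_mul_of_pos_right _ (hK1 _)
    _ = _ := by ring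

/-- Induction on the program. A command costs the same after renaming, and an oracle call of cost
one becomes a subprogram of cost at most `K`. Entry sizes stay below `max S` of the steps taken,
because a written value is charged its bit length and replies have at most `N ≤ S` bits. -/
theorem Cmd.lift_subst {O : Oracle} {ρ : ℕ → ℕ} {σ : ℕ → ℕ → Cmd} {B N : ℕ} {J : Mem → Prop}
    {K : ℕ → ℕ} (hρ : Function.Injective ρ) (hσ : Simulates O ρ σ B N J K) (hK : Monotone K)
    (hK1 : ∀ S, 1 ≤ K S)
    (hJw : ∀ m a j v, J m → J (m.write (ρ a) j v)) (hJc : ∀ m a, J m → J (m.clear (ρ a)))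
    (c : Cmd) (hc : c.width ≤ B) (m m' : Mem) (S : ℕ) (hS : N ≤ S) (hm : SizeLe B m S)
    (hv : View ρ B m m') (hJ : J m') :
    Lift (SimRel ρ B J K S) (c.exec O m) ((c.subst ρ σ).exec noOracle m') := by
  induction c generalizing m m' S with
  | skip =>
    refine Lift.pure ⟨hv, hJ, hm.mono (le_max_left _ _), ?_⟩
    simpa using hK1 _
  | assign a e f =>
    simp only [Cmd.width, max_le_iff] at hc
    simp only [Cmd.subst, Cmd.exec, hv.expr e hc.2.1, hv.expr f hc.2.2]
    refine Lift.pure ⟨hv.write hρ _ _ _, hJw _ _ _ _ hJ, ?_, ?_⟩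
    · refine (hm.mono (le_max_left _ _)).write _ _ ?_
      have := f.size_eval_le_cost m
      simp only
      omega
    · exact Nat.le_mul_of_pos_right _ (hK1 _)
  | rand a e f =>
    simp only [Cmd.width, max_le_iff] at hc
    simp only [Cmd.subst, Cmd.exec, hv.expr e hc.2.1, hv.expr f hc.2.2]
    refine Lift.bind (R := fun x y => x = y ∧ x ≤ f.eval m)
      (Lift.refl fun x hx => ⟨rfl, (uniformBelow_support hx).1⟩) ?_
    rintro x _ ⟨rfl, hx⟩
    refine Lift.pure ⟨hv.write hρ _ _ _, hJw _ _ _ _ hJ, ?_, ?_⟩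
    · refine (hm.mono (le_max_left _ _)).write _ _ ?_
      have := f.size_eval_le_cost m
      have := Nat.size_le_size hx
      simp only
      omega
    · exact Nat.le_mul_of_pos_right _ (hK1 _)
  | clear a =>
    refine Lift.pure ⟨hv.clear hρ _, hJc _ _ hJ, (hm.clear a).mono (le_max_left _ _), ?_⟩
    simpa using hK1 _
  | query a b =>
    simp only [Cmd.width, max_le_iff] at hc
    simp only [Cmd.subst, Cmd.exec]
    refine (hσ a (by omega) b (by omega) m m' S hS hm hv hJ).bind_left ?_
    rintro l z ⟨h1, h2, h3, h4⟩
    refine Lift.pure ⟨h1, h2, ?_, ?_⟩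
    · exact (hm.writeList b fun v hv => (h4 v hv).trans hS).mono (le_max_left _ _)
    · simpa using h3.trans (hK (le_max_left _ _))
  | seq c d ihc ihd =>
    simp only [Cmd.width, max_le_iff] at hc
    simp only [Cmd.subst, Cmd.exec]
    refine (ihc hc.1 m m' S hS hm hv hJ).bind fun y y' hy => ?_
    refine (ihd hc.2 y.1 y'.1 _ (hS.trans (le_max_left _ _)) hy.2.2.1 hy.1 hy.2.1).bind
      fun z z' hz => ?_
    exact Lift.pure (hy.seq hK hK1 hz 0)
  | ite e c d ihc ihd =>
    simp only [Cmd.width, max_le_iff] at hc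
    simp only [Cmd.subst, Cmd.exec, hv.expr e hc.1]
    refine Lift.bind (R := SimRel ρ B J K S) ?_ fun y y' hy => Lift.pure (hy.add hK hK1 _ _)
    split_ifs
    · exact ihc hc.2.1 m m' S hS hm hv hJ
    · exact ihd hc.2.2 m m' S hS hm hv hJ
  | loop e c ih =>
    simp only [Cmd.width, max_le_iff] at hc
    simp only [Cmd.subst, Cmd.exec, hv.expr e hc.1]
    refine Lift.bind (R := SimRel ρ B J K S) ?_ fun y y' hy => Lift.pure (hy.add hK hK1 _ _)
    generalize e.eval m = n
    induction n generalizing m m' S with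
    | zero => exact Lift.pure ⟨hv, hJ, hm.mono (le_max_left _ _), by simp⟩
    | succ n ihn =>
      simp only [iterateRun]
      refine (ih hc.2 m m' S hS hm hv hJ).bind fun y y' hy => ?_
      refine (ihn y.1 y'.1 _ (hS.trans (le_max_left _ _)) hy.2.2.1 hy.1 hy.2.1).bind
        fun z z' hz => ?_
      exact Lift.pure (hy.seq hK hK1 hz 1)

theorem sizeLe_inputMem (l : List ℕ) {S : ℕ} (hl : ∀ v ∈ l, v.size ≤ S) (B : ℕ) :
    SizeLe B (inputMem l) S := by
  intro a _ j
  simp only [inputMem]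
  split_ifs
  · by_cases hj : j < l.length
    · rw [List.getD_eq_getElem _ _ hj]
      exact hl _ (List.getElem_mem hj)
    · rw [List.getD_eq_default _ _ (by omega)]
      simp
  · simp

theorem Mem.writeList_nil (m : Mem) (a : ℕ) : m.writeList a [] = m := by
  funext b j
  simp only [Mem.writeList, List.getD_nil]
  split_ifs with h
  · rw [h]
  · rfl

/-- Renamed programs that do not use an oracle do the same as the original ones. -/
theorem Cmd.lift_rename {ρ : ℕ → ℕ} (hρ : Function.Injective ρ) (c : Cmd) {B : ℕ}
    (hc : c.width ≤ B) (l : List ℕ) (m' : Mem)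
    (hv : View ρ B (inputMem l) m') :
    Lift (fun z z' : Mem × ℕ => View ρ B z.1 z'.1 ∧
        (∀ a, a ∉ Set.range ρ → z'.1 a = m' a) ∧ z'.2 ≤ z.2)
      (c.exec noOracle (inputMem l)) ((c.subst ρ fun _ _ => .skip).exec noOracle m') := by
  -- Any bound on the input sizes will do, since the time factor `K` is constantly one here.
  obtain ⟨S, hS⟩ : ∃ S, ∀ v ∈ l, v.size ≤ S :=
    ⟨(l.map Nat.size).sum, fun v hv => List.le_sum_of_mem (List.mem_map_of_mem hv)⟩
  have key := Cmd.lift_subst (O := noOracle) (ρ := ρ) (σ := fun _ _ => .skip) (B := B)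
    (N := 0) (J := fun m => ∀ a, a ∉ Set.range ρ → m a = m' a) (K := fun _ => 1) hρ ?_
    monotone_const (fun _ => le_rfl) ?_ ?_ c hc (inputMem l) m' S (Nat.zero_le _)
    (sizeLe_inputMem l hS _) hv (fun _ _ => rfl)
  · exact key.mono fun z _ z' _ h => ⟨h.1, h.2.1, by simpa using h.2.2.2⟩
  · intro a _ b _ m m' S _ _ hv hJ
    refine Lift.pure ⟨?_, hJ, le_rfl, by simp⟩
    rwa [Mem.writeList_nil]
  · intro m a j v h b hb
    rw [← h b hb]
    have : b ≠ ρ a := fun h => hb ⟨a, h.symm⟩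
    funext l
    simp [Mem.write, this]
  · intro m a h b hb
    rw [← h b hb]
    have : b ≠ ρ a := fun h => hb ⟨a, h.symm⟩
    funext l
    simp [Mem.clear, this]

/-! ### Total correctness with a time bound -/

/-- Every execution of `c` from `m` ends in `Q` after at most `K` steps. -/
def Triple (c : Cmd) (m : Mem) (Q : Mem → Prop) (K : ℕ) : Prop :=
  ∀ z ∈ (c.exec noOracle m).support, Q z.1 ∧ z.2 ≤ K

/-- The number of nodes of an expression. -/
def Expr.nodes : Expr → ℕ
  | .const _ => 1
  | .get _ e => e.nodes + 1
  | .add e f => e.nodes + f.nodes + 1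
  | .sub e f => e.nodes + f.nodes + 1
  | .mul e f => e.nodes + f.nodes + 1
  | .div e f => e.nodes + f.nodes + 1
  | .mod e f => e.nodes + f.nodes + 1

/-- The values at all the nodes of an expression are at most `M`. -/
def Expr.Small (M : ℕ) (m : Mem) : Expr → Prop
  | .const v => v ≤ M
  | .get a e => e.Small M m ∧ m a (e.eval m) ≤ M
  | .add e f => e.Small M m ∧ f.Small M m ∧ e.eval m + f.eval m ≤ M
  | .sub e f => e.Small M m ∧ f.Small M m
  | .mul e f => e.Small M m ∧ f.Small M m ∧ e.eval m * f.eval m ≤ M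
  | .div e f => e.Small M m ∧ f.Small M m
  | .mod e f => e.Small M m ∧ f.Small M m

/-- Differences, quotients and remainders need no bound of their own in `Small`: they do not exceed
their left operand. -/
theorem Expr.Small.eval_le {M : ℕ} {m : Mem} {e : Expr} (h : e.Small M m) : e.eval m ≤ M := by
  induction e with
  | const v => exact h
  | get a e => exact h.2
  | add e f => exact h.2.2
  | sub e f ihe _ => exact (Nat.sub_le _ _).trans (ihe h.1)
  | mul e f => exact h.2.2
  | div e f ihe _ => exact (Nat.div_le_self _ _).trans (ihe h.1)
  | mod e f ihe _ => exact (Nat.mod_le _ _).trans (ihe h.1)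

theorem Expr.Small.cost_le {M S : ℕ} {m : Mem} {e : Expr} (h : e.Small M m)
    (hS : 1 + M.size ≤ S) : e.cost m ≤ e.nodes * S := by
  have key : 1 + (e.eval m).size ≤ S := by
    have := Nat.size_le_size h.eval_le
    omega
  induction e with
  | const v => simpa [Expr.cost, Expr.nodes, Expr.eval] using key
  | get a e ih =>
    have := ih h.1 (by have := Nat.size_le_size h.1.eval_le; omega)
    simp only [Expr.cost, Expr.nodes, Expr.eval] at *
    linarith
  | add e f ih1 ih2 | mul e f ih1 ih2 =>
    have := ih1 h.1 (by have := Nat.size_le_size h.1.eval_le; omega)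
    have := ih2 h.2.1 (by have := Nat.size_le_size h.2.1.eval_le; omega)
    simp only [Expr.cost, Expr.nodes, Expr.eval] at *
    linarith
  | sub e f ih1 ih2 | div e f ih1 ih2 | mod e f ih1 ih2 =>
    have := ih1 h.1 (by have := Nat.size_le_size h.1.eval_le; omega)
    have := ih2 h.2 (by have := Nat.size_le_size h.2.eval_le; omega)
    simp only [Expr.cost, Expr.nodes, Expr.eval] at *
    linarith

namespace Triple

variable {c d : Cmd} {m : Mem} {Q : Mem → Prop} {K K' K'' M S : ℕ}

theorem mono {Q' : Mem → Prop} (h : Triple c m Q K) (hQ : ∀ m', Q m' → Q' m') (hK : K ≤ K') :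
    Triple c m Q' K' := fun z hz => ⟨hQ _ (h z hz).1, (h z hz).2.trans hK⟩

theorem skip (hQ : Q m) : Triple .skip m Q 1 := by
  intro z hz
  simp only [Cmd.exec, PMF.support_pure, Set.mem_singleton_iff] at hz
  subst hz
  exact ⟨hQ, le_rfl⟩

theorem seq {Q' : Mem → Prop} (h1 : Triple c m Q' K) (h2 : ∀ m', Q' m' → Triple d m' Q K')
    (hK : K + K' ≤ K'') : Triple (.seq c d) m Q K'' := by
  intro z hz
  simp only [Cmd.exec, PMF.mem_support_bind_iff, PMF.support_pure, Set.mem_singleton_iff] at hz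
  obtain ⟨y, hy, z', hz', rfl⟩ := hz
  have a := h1 y hy
  have b := h2 _ a.1 z' hz'
  exact ⟨b.1, by simp only; omega⟩

theorem assign {a : ℕ} {e f : Expr} (he : e.Small M m) (hf : f.Small M m)
    (hS : 1 + M.size ≤ S) (hQ : Q (m.write a (e.eval m) (f.eval m))) :
    Triple (.assign a e f) m Q ((e.nodes + f.nodes + 1) * S) := by
  intro z hz
  simp only [Cmd.exec, PMF.support_pure, Set.mem_singleton_iff] at hz
  subst hz
  have := he.cost_le hS
  have := hf.cost_le hS
  refine ⟨hQ, ?_⟩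
  simp only
  nlinarith

theorem assign_seq {a : ℕ} {e f : Expr} (he : e.Small M m) (hf : f.Small M m)
    (hS : 1 + M.size ≤ S) (h : Triple d (m.write a (e.eval m) (f.eval m)) Q K)
    (hK : (e.nodes + f.nodes + 1) * S + K ≤ K') :
    Triple (.seq (.assign a e f) d) m Q K' :=
  (assign he hf hS (Q := fun m' => m' = m.write a (e.eval m) (f.eval m)) rfl).seq
    (fun _ h' => h' ▸ h) hK

theorem clear {a : ℕ} (hQ : Q (m.clear a)) : Triple (.clear a) m Q 1 := by
  intro z hz
  simp only [Cmd.exec, PMF.support_pure, Set.mem_singleton_iff] at hz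
  subst hz
  exact ⟨hQ, le_rfl⟩

theorem ite {e : Expr} (he : e.Small M m) (hS : 1 + M.size ≤ S)
    (h1 : e.eval m ≠ 0 → Triple c m Q K) (h2 : e.eval m = 0 → Triple d m Q K)
    (hK : (e.nodes + 1) * S + K ≤ K') : Triple (.ite e c d) m Q K' := by
  intro z hz
  simp only [Cmd.exec, PMF.mem_support_bind_iff, PMF.support_pure, Set.mem_singleton_iff] at hz
  obtain ⟨y, hy, rfl⟩ := hz
  have hc := he.cost_le hS
  have key : Q y.1 ∧ y.2 ≤ K := by
    split_ifs at hy with h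
    · exact h1 h y hy
    · exact h2 (not_not.1 h) y hy
  refine ⟨key.1, ?_⟩
  simp only
  nlinarith [key.2]

theorem iterate (I : ℕ → Mem → Prop) (N : ℕ)
    (h : ∀ j m', j < N → I j m' → Triple c m' (I (j + 1)) K) :
    ∀ n j m', j + n = N → I j m' → ∀ z ∈ (iterateRun (c.exec noOracle) n m').support,
      I N z.1 ∧ z.2 ≤ n * (K + 1) := by
  intro n
  induction n with
  | zero =>
    intro j m' hj hI z hz
    simp only [iterateRun, PMF.support_pure, Set.mem_singleton_iff] at hz
    subst hz
    obtain rfl : j = N := by omega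
    exact ⟨hI, by simp⟩
  | succ n ih =>
    intro j m' hj hI z hz
    simp only [iterateRun, PMF.mem_support_bind_iff, PMF.support_pure,
      Set.mem_singleton_iff] at hz
    obtain ⟨y, hy, x, hx, rfl⟩ := hz
    have a := h j m' (by omega) hI y hy
    have b := ih (j + 1) y.1 (by omega) a.1 x hx
    refine ⟨b.1, ?_⟩
    simp only
    nlinarith [a.2, b.2]

theorem loop (I : ℕ → Mem → Prop) {e : Expr} (he : e.Small M m) (hS : 1 + M.size ≤ S)
    (hN : e.eval m ≤ S) (h0 : I 0 m)
    (h : ∀ j m', j < e.eval m → I j m' → Triple c m' (I (j + 1)) K)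
    (hQ : ∀ m', I (e.eval m) m' → Q m')
    (hK : S * (K + 1) + (e.nodes + 1) * S ≤ K') : Triple (.loop e c) m Q K' := by
  intro z hz
  simp only [Cmd.exec, PMF.mem_support_bind_iff, PMF.support_pure, Set.mem_singleton_iff] at hz
  obtain ⟨y, hy, rfl⟩ := hz
  have hc := he.cost_le hS
  have := iterate I (e.eval m) h (e.eval m) 0 m (by omega) h0 y hy
  refine ⟨hQ _ this.1, ?_⟩
  have := Nat.mul_le_mul_right (K + 1) hN
  simp only
  nlinarith

end Triple

/-! ### Own variables -/

/-- The variable with number `j`, an entry of the array `0`. -/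
abbrev V (j : ℕ) : Expr := .get 0 (.const j)

/-- Assignment to a variable. -/
abbrev setV (j : ℕ) (e : Expr) : Cmd := .assign 0 (.const j) e

/-- The arrays with number `r` modulo `5`. -/
def reg (r a : ℕ) : ℕ := 5 * a + r

theorem reg_injective (r : ℕ) : Function.Injective (reg r) := fun a b h => by
  simp only [reg] at h
  omega

/-- The memories agree off the arrays with number `2` modulo `5`, the arrays listed in `A` and the
variables listed in `l`. -/
def Same (A l : List ℕ) (m m' : Mem) : Prop :=
  (∀ a, a % 5 ≠ 2 → a ≠ 0 → a ∉ A → m' a = m a) ∧ ∀ j, j ∉ l → m' 0 j = m 0 j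

theorem Same.refl (A l : List ℕ) (m : Mem) : Same A l m m := ⟨fun _ _ _ _ => rfl, fun _ _ => rfl⟩

theorem Same.trans {A A' l l' B k : List ℕ} {m m' m'' : Mem} (h : Same A l m m')
    (h' : Same A' l' m' m'') (hA : A ⊆ B) (hA' : A' ⊆ B) (hl : l ⊆ k) (hl' : l' ⊆ k) :
    Same B k m m'' :=
  ⟨fun a h1 h2 h3 => (h'.1 a h1 h2 fun h => h3 (hA' h)).trans (h.1 a h1 h2 fun h => h3 (hA h)),
    fun j hj => (h'.2 j fun h => hj (hl' h)).trans (h.2 j fun h => hj (hl h))⟩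

theorem Same.mono {A A' l l' : List ℕ} {m m' : Mem} (h : Same A l m m') (hA : A ⊆ A')
    (hl : l ⊆ l') : Same A' l' m m' :=
  ⟨fun a h1 h2 h3 => h.1 a h1 h2 fun h => h3 (hA h), fun j hj => h.2 j fun h => hj (hl h)⟩

theorem same_write (m : Mem) (j v : ℕ) : Same [] [j] m (m.write 0 j v) := by
  refine ⟨fun a _ ha _ => ?_, fun l hl => ?_⟩
  · funext l
    simp [Mem.write, ha]
  · simp only [List.mem_singleton] at hl
    simp [Mem.write, hl]

theorem same_write_array (m : Mem) {a : ℕ} (ha : a ≠ 0) (j v : ℕ) :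
    Same [a] [] m (m.write a j v) := by
  refine ⟨fun b _ _ hb => ?_, fun l _ => ?_⟩
  · simp only [List.mem_singleton] at hb
    funext l
    simp [Mem.write, hb]
  · simp [Mem.write, ha.symm]

@[simp] theorem write_same (m : Mem) (a j v : ℕ) : m.write a j v a j = v := by simp [Mem.write]

theorem write_ne (m : Mem) {a j v a' j' : ℕ} (h : a' = a → j' ≠ j) :
    m.write a j v a' j' = m a' j' := by
  simp only [Mem.write]
  split_ifs with h'
  · exact absurd h'.2 (h h'.1)
  · rfl

theorem write_array_ne (m : Mem) {a j v a' : ℕ} (h : a' ≠ a) : m.write a j v a' = m a' := by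
  funext j'
  exact write_ne m fun h' => absurd h' h

/-- Clear the first `B` arrays with number `r` modulo `5`. -/
def clearAll (r : ℕ) : ℕ → Cmd
  | 0 => .skip
  | B + 1 => .seq (clearAll r B) (.clear (reg r B))

theorem clearAll_triple (r B : ℕ) (m : Mem) :
    Triple (clearAll r B) m (fun m' => (∀ a < B, m' (reg r a) = fun _ => 0) ∧
      ∀ a, (∀ b, a ≠ reg r b) → m' a = m a) (B + 1) := by
  induction B with
  | zero => exact Triple.skip ⟨by simp, fun _ _ => rfl⟩
  | succ B ih =>
    refine ih.seq (K' := 1) (fun m' h => Triple.clear ⟨fun a ha => ?_, fun a ha => ?_⟩) le_rfl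
    · funext j
      simp only [Mem.clear, (reg_injective r).eq_iff]
      split_ifs
      · rfl
      · rw [h.1 a (by omega)]
    · rw [← h.2 a ha]
      funext j
      simp [Mem.clear, ha B]

/-! ### Programs for multiplication and exponentiation in the group -/

namespace GroupFamily

variable (F : GroupFamily)

/-- Values and times that occur for the security parameter `k` are bounded by `M` and `S`. -/
structure Bounds (k M S : ℕ) : Prop where
  le : 100 ≤ M
  size : 1 + M.size ≤ S
  mul : F.mulProg.width + F.bound.eval k + 10 ≤ S
  desc : ∀ i ∈ (F.setup k).support, F.desc i ≤ M
  enc : ∀ i ∈ (F.setup k).support, ∀ y, F.enc i y ≤ M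
  q : ∀ i ∈ (F.setup k).support, F.q i * F.q i + F.q i ≤ M

/-- Multiply the variables `x` and `y` as group elements. -/
def mulC (d x y : ℕ) : Cmd :=
  .seq (clearAll 2 (F.mulProg.width + 2)) <|
  .seq (.assign (reg 2 0) (.const 0) (V 1)) <|
  .seq (.assign (reg 2 0) (.const 1) (V x)) <|
  .seq (.assign (reg 2 0) (.const 2) (V y)) <|
  .seq (F.mulProg.subst (reg 2) fun _ _ => .skip)
    (setV d (.get (reg 2 1) (.const 0)))

/-- Raise the variable `x` as a group element to the power given by the variable `e`. The
identity need not be known: the exponent is increased by the group order. -/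
def powC (d x e : ℕ) : Cmd :=
  .seq (setV 20 (V x)) <|
  .seq (setV 21 (.sub (.add (V e) (V 2)) (.const 1))) <|
  .seq (setV d (V x)) <|
  .loop (V 11) <|
    .seq (.ite (.mod (V 21) (.const 2)) (F.mulC d d 20) .skip) <|
    .seq (F.mulC 20 20 20) (setV 21 (.div (V 21) (.const 2)))

variable {F} {k M S : ℕ} {i : F.Inst}

/-- The operands are copied to freshly cleared arrays because `mulProg_spec` only speaks of runs
from `inputMem`. For the same reason the destination may coincide with an operand. -/
theorem mulC_triple (hB : F.Bounds k M S) (hi : i ∈ (F.setup k).support) {m : Mem} {d x y : ℕ}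
    (Y Y' : F.G i) (h1 : m 0 1 = F.desc i) (hx : m 0 x = F.enc i Y) (hy : m 0 y = F.enc i Y')
    (hd : d ≤ M) (hxM : x ≤ M) (hyM : y ≤ M) :
    Triple (F.mulC d x y) m (fun m' => Same [] [d] m m' ∧ m' 0 d = F.enc i (Y * Y')) (50 * S) := by
  have hM := hB.le
  have hS := hB.size
  have hb := hB.mul
  have e1 := hB.desc i hi
  have e2 := hB.enc i hi
  refine (clearAll_triple 2 (F.mulProg.width + 2) m).seq (K' := 49 * S) (fun m1 hm1 => ?_) (by omega)
  have hr : ∀ r : ℕ, 0 ≠ reg 2 r := fun r => by simp only [reg]; omega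
  have hr' : ∀ r : ℕ, reg 2 r ≠ 0 := fun r => (hr r).symm
  have h0 : m1 0 = m 0 := hm1.2 0 hr
  -- Here and below the values of `K` are generous budgets for the rest of the program; only their
  -- order in `S` matters.
  refine Triple.assign_seq (M := M) (S := S) (K := 40 * S) ?_ ?_ hS ?_ ?_
  · simp only [Expr.Small]; omega
  · simp only [Expr.Small, Expr.eval, h0, h1]; omega
  swap
  · simp only [Expr.nodes]; omega
  refine Triple.assign_seq (M := M) (S := S) (K := 30 * S) ?_ ?_ hS ?_ ?_
  · simp only [Expr.Small]; omega
  · simp only [Expr.Small, Expr.eval, write_array_ne _ (hr _), h0, hx]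
    exact ⟨hxM, e2 _⟩
  swap
  · simp only [Expr.nodes]; omega
  refine Triple.assign_seq (M := M) (S := S) (K := 20 * S) ?_ ?_ hS ?_ ?_
  · simp only [Expr.Small]; omega
  · simp only [Expr.Small, Expr.eval, write_array_ne _ (hr _), h0, hy]
    exact ⟨hyM, e2 _⟩
  swap
  · simp only [Expr.nodes]; omega
  simp only [Expr.eval, write_array_ne _ (hr _), h0, h1, hx, hy]
  set m2 := ((m1.write (reg 2 0) 0 (F.desc i)).write (reg 2 0) 1 (F.enc i Y)).write (reg 2 0) 2
    (F.enc i Y') with hm2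
  have hframe : ∀ a, a % 5 ≠ 2 → m2 a = m a := by
    intro a ha
    have hn : ∀ b, a ≠ reg 2 b := fun b => by simp only [reg]; omega
    rw [hm2, write_array_ne _ (hn _), write_array_ne _ (hn _), write_array_ne _ (hn _),
      hm1.2 a hn]
  -- The `2` added to the width keeps arrays `0` and `1`, the input and the output, in view even if
  -- the program does not mention them.
  have hv : View (reg 2) (F.mulProg.width + 2) (inputMem [F.desc i, F.enc i Y, F.enc i Y']) m2 := by
    intro a ha
    funext j
    simp only [hm2, Mem.write, (reg_injective 2).eq_iff, hm1.1 a ha, inputMem]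
    rcases j with _ | _ | _ | j <;> by_cases h : a = 0 <;> simp [h]
  have key := Cmd.lift_rename (reg_injective 2) F.mulProg (Nat.le_add_right _ 2) _ _ hv
  refine Triple.seq (K := S) (K' := 10 * S) (Q' := fun m3 => (∀ a, a % 5 ≠ 2 → m3 a = m a) ∧
    m3 (reg 2 1) 0 = F.enc i (Y * Y')) ?_ ?_ (by omega)
  · intro z hz
    obtain ⟨x, hx, h1, h2, h3⟩ := key.exists_left hz
    have hsp := F.mulProg_spec k i hi Y Y' x hx
    refine ⟨⟨fun a ha => ?_, ?_⟩, by omega⟩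
    · rw [h2 a, hframe a ha]
      rintro ⟨b, rfl⟩
      simp only [reg] at ha
      omega
    · rw [h1 1 (by omega)]
      exact hsp.1
  · rintro m3 ⟨h2, h3⟩
    refine (Triple.assign (M := M) (S := S) ?_ ?_ hS ?_).mono (fun _ h => h) ?_
    · exact hd
    · simp only [Expr.Small, Expr.eval, h3]
      exact ⟨by omega, e2 _⟩
    · simp only [Expr.eval, h3]
      refine ⟨⟨fun a ha h0 _ => ?_, fun j hj => ?_⟩, by simp⟩
      · rw [write_array_ne _ h0, h2 a ha]
      · rw [write_ne _ (fun _ h => hj (by simp [h])), h2 0 (by omega)]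
    · simp only [Expr.nodes]; omega

/-- Square-and-multiply whose accumulator starts at `Y` instead of the identity, whose
representation is not given. The exponent still to be processed is therefore `N + q - 1`, and `Y ^
(1 + (N + q - 1)) = Y ^ N` because `Y ^ q = 1`. The hypothesis `2 * q ≤ 2 ^ L` ensures that `L`
rounds exhaust the exponent. -/
theorem powC_triple (hB : F.Bounds k M S) (hi : i ∈ (F.setup k).support) {m : Mem} {d x e : ℕ}
    (Y : F.G i) (N : ℕ) (h1 : m 0 1 = F.desc i) (h2 : m 0 2 = F.q i) (hL : m 0 11 ≤ S)
    (hLM : m 0 11 ≤ M) (hqL : 2 * F.q i ≤ 2 ^ m 0 11)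
    (hx : m 0 x = F.enc i Y) (he : m 0 e = N) (hN : N < F.q i) (hd : d ≤ 19) (hd' : 12 ≤ d)
    (hxM : x < 20) (hyM : e < 20) :
    Triple (F.powC d x e) m (fun m' => Same [] [d, 20, 21] m m' ∧ m' 0 d = F.enc i (Y ^ N))
      (200 * (S * S)) := by
  have hM := hB.le
  have hS := hB.size
  have e1 := hB.desc i hi
  have e2 := hB.enc i hi
  have e3 := hB.q i hi
  have hq := (F.prime_q i).two_le
  have hqM : 3 * F.q i ≤ M := by nlinarith
  have hSS : S ≤ S * S := Nat.le_mul_of_pos_left _ (by omega)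
  refine Triple.assign_seq (M := M) (S := S) (K := 180 * (S * S)) ?_ ?_ hS ?_ ?_
  · simp only [Expr.Small]; omega
  · simp only [Expr.Small, Expr.eval, hx]
    exact ⟨by omega, e2 _⟩
  swap
  · simp only [Expr.nodes]; omega
  simp only [Expr.eval, hx]
  set m1 := m.write 0 20 (F.enc i Y) with hm1
  have s1 : Same [] [20] m m1 := same_write _ _ _
  have f1 : m1 0 e = N := by rw [s1.2 e (by simp; omega), he]
  have f2 : m1 0 2 = F.q i := by rw [s1.2 2 (by simp), h2]
  have f3 : m1 0 x = F.enc i Y := by rw [s1.2 x (by simp; omega), hx]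
  have f4 : m1 0 20 = F.enc i Y := by simp [hm1]
  refine Triple.assign_seq (M := M) (S := S) (K := 160 * (S * S)) ?_ ?_ hS ?_ ?_
  · simp only [Expr.Small]; omega
  · simp only [Expr.Small, Expr.eval, f1, f2]
    refine ⟨⟨⟨?_, ?_⟩, ⟨?_, ?_⟩, ?_⟩, ?_⟩ <;> omega
  swap
  · simp only [Expr.nodes]; omega
  simp only [Expr.eval, f1, f2]
  set m2 := m1.write 0 21 (N + F.q i - 1) with hm2
  have s2 : Same [] [20, 21] m m2 := s1.trans (same_write _ _ _) (by simp) (by simp) (by simp) (by simp)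
  have g3 : m2 0 x = F.enc i Y := by rw [s2.2 x (by simp; omega), hx]
  have g4 : m2 0 20 = F.enc i Y := by rw [hm2, write_ne _ (by simp), f4]
  refine Triple.assign_seq (M := M) (S := S) (K := 140 * (S * S)) ?_ ?_ hS ?_ ?_
  · simp only [Expr.Small]; omega
  · simp only [Expr.Small, Expr.eval, g3]
    exact ⟨by omega, e2 _⟩
  swap
  · simp only [Expr.nodes]; omega
  simp only [Expr.eval, g3]
  set m3 := m2.write 0 d (F.enc i Y) with hm3
  have s3 : Same [] [d, 20, 21] m m3 := s2.trans (same_write _ _ _) (by simp) (by simp) (by simp) (by simp)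
  have k4 : m3 0 20 = F.enc i Y := by rw [hm3, write_ne _ (by omega), g4]
  have k5 : m3 0 21 = N + F.q i - 1 := by rw [hm3, write_ne _ (by omega), hm2, write_same]
  have k6 : m3 0 11 = m 0 11 := s3.2 11 (by simp; omega)
  have hv : (V 11).eval m3 = m 0 11 := k6
  -- After `j` rounds variable `20` holds the `j`-fold square, variable `21` the binary digits not
  -- yet used, and `d` the power for the lowest `j` digits, with the extra factor `Y`.
  refine Triple.loop (M := M) (S := S) (K := 130 * S)
    (fun j m' => Same [] [d, 20, 21] m m' ∧ m' 0 20 = F.enc i (Y ^ 2 ^ j) ∧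
      m' 0 21 = (N + F.q i - 1) / 2 ^ j ∧
      m' 0 d = F.enc i (Y ^ (1 + (N + F.q i - 1) % 2 ^ j))) ?_ hS ?_ ?_ ?_ ?_ ?_
  · simp only [Expr.Small, Expr.eval, k6]
    omega
  · rw [hv]; exact hL
  · refine ⟨s3, by simpa using k4, by simpa using k5, ?_⟩
    simp [hm3, Nat.mod_one]
  · rintro j m4 - ⟨s4, b, E, acc⟩
    set E0 := N + F.q i - 1 with hE0
    have hEM : E0 / 2 ^ j ≤ M := (Nat.div_le_self _ _).trans (by omega)
    have d4 : m4 0 1 = F.desc i := by rw [s4.2 1 (by simp; omega), h1]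
    refine Triple.seq (K := 60 * S) (K' := 70 * S) (Q' := fun m' => Same [] [d, 20, 21] m m' ∧
      m' 0 20 = F.enc i (Y ^ 2 ^ j) ∧ m' 0 21 = E0 / 2 ^ j ∧
      m' 0 d = F.enc i (Y ^ (1 + E0 % 2 ^ (j + 1)))) ?_ ?_ (by omega)
    · have hmod : E0 % 2 ^ (j + 1) = E0 % 2 ^ j + 2 ^ j * (E0 / 2 ^ j % 2) := Nat.mod_pow_succ
      refine Triple.ite (M := M) (S := S) (K := 50 * S) ?_ hS ?_ ?_ ?_
      · simp only [Expr.Small, Expr.eval, E]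
        exact ⟨⟨by omega, hEM⟩, by omega⟩
      · simp only [Expr.eval, E]
        intro hodd
        refine (mulC_triple hB hi _ _ d4 acc b (by omega) (by omega) (by omega)).mono ?_ le_rfl
        rintro m5 ⟨s5, h5⟩
        refine ⟨s4.trans s5 (by simp) (by simp) (by simp) (by simp), ?_, ?_, ?_⟩
        · rw [s5.2 20 (by simp; omega), b]
        · rw [s5.2 21 (by simp; omega), E]
        · rw [h5, hmod, ← pow_add, show E0 / 2 ^ j % 2 = 1 by omega]
          congr 2
          ring
      · simp only [Expr.eval, E]
        intro heven
        refine (Triple.skip ?_).mono (fun _ h => h) (by omega)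
        refine ⟨s4, b, E, ?_⟩
        rw [acc, hmod, heven]
        simp
      · simp only [Expr.nodes]; omega
    · rintro m5 ⟨s5, b5, E5, acc5⟩
      have d5 : m5 0 1 = F.desc i := by rw [s5.2 1 (by simp; omega), h1]
      refine (mulC_triple hB hi _ _ d5 b5 b5 (by omega) (by omega) (by omega)).seq
        (K' := 20 * S) ?_ (by omega)
      rintro m6 ⟨s6, h6⟩
      have E6 : m6 0 21 = E0 / 2 ^ j := by rw [s6.2 21 (by simp), E5]
      refine (Triple.assign (M := M) (S := S) ?_ ?_ hS ?_).mono (fun _ h => h) ?_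
      · simp only [Expr.Small]; omega
      · simp only [Expr.Small, Expr.eval, E6]
        exact ⟨⟨by omega, hEM⟩, by omega⟩
      · simp only [Expr.eval, E6]
        have s7 := same_write m6 21 (E0 / 2 ^ j / 2)
        refine ⟨(s5.trans (B := []) (k := [d, 20, 21]) s6 (by simp) (by simp) (by simp) (by simp)).trans s7 (by simp) (by simp) (List.Subset.refl _) (by simp),
          ?_, ?_, ?_⟩
        · rw [s7.2 20 (by simp), h6, ← pow_add, pow_succ, mul_two]
        · rw [write_same, Nat.div_div_eq_div_mul, pow_succ]
        · rw [s7.2 d (by simp; omega), s6.2 d (by simp; omega), acc5]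
      · simp only [Expr.nodes]; omega
  · rw [hv]
    rintro m4 ⟨s4, -, -, acc⟩
    refine ⟨s4, ?_⟩
    rw [acc, Nat.mod_eq_of_lt (by omega), show 1 + (N + F.q i - 1) = N + F.q i by omega, pow_add]
    have : Y ^ F.q i = 1 := by rw [← F.card_eq i]; exact pow_card_eq_one'
    rw [this, mul_one]
  · simp only [Expr.nodes]
    nlinarith

end GroupFamily
/-! ### Programs that sample a given distribution -/

/-- The memory after an execution of `c` from `m` is coupled with `μ` by `Q`, and every execution
takes at most `K` steps. -/
def Sampled {α : Type*} (c : Cmd) (m : Mem) (μ : PMF α) (Q : α → Mem → Prop) (K : ℕ) : Prop :=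
  Lift (fun x z => Q x z.1 ∧ z.2 ≤ K) μ (c.exec noOracle m)

theorem Triple.sampled {α : Type*} {c : Cmd} {m : Mem} {Q : α → Mem → Prop} {K : ℕ} {x : α}
    (h : Triple c m (Q x) K) : Sampled c m (PMF.pure x) Q K :=
  Lift.pure_left fun z hz => h z hz

namespace Sampled

variable {α β : Type*} {c d : Cmd} {m : Mem} {μ : PMF α} {Q : α → Mem → Prop}
  {K K' K'' M S : ℕ}

theorem mono {Q' : α → Mem → Prop} (h : Sampled c m μ Q K) (hQ : ∀ x m', Q x m' → Q' x m')
    (hK : K ≤ K') : Sampled c m μ Q' K' :=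
  Lift.mono h fun _ _ _ _ h => ⟨hQ _ _ h.1, h.2.trans hK⟩

theorem map_left {f : α → β} {Q' : β → Mem → Prop}
    (h : Sampled c m μ (fun x => Q' (f x)) K) : Sampled c m (μ.map f) Q' K :=
  Lift.map_left (R' := fun y (z : Mem × ℕ) => Q' y z.1 ∧ z.2 ≤ K) h

theorem seq {f : α → PMF β} {Q' : β → Mem → Prop} (h : Sampled c m μ Q K)
    (h' : ∀ x m', Q x m' → Sampled d m' (f x) Q' K') (hK : K + K' ≤ K'') :
    Sampled (.seq c d) m (μ.bind f) Q' K'' := by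
  refine Lift.bind h fun x y hxy => ?_
  refine (h' x y.1 hxy.1).bind_pure_left fun w z hz u hu => ?_
  simp only [PMF.support_pure, Set.mem_singleton_iff] at hu
  subst hu
  exact ⟨hz.1, by simp only; omega⟩

theorem seq_left {Q' : Mem → Prop} (h : Triple c m Q' K)
    (h' : ∀ m', Q' m' → Sampled d m' μ Q K') (hK : K + K' ≤ K'') :
    Sampled (.seq c d) m μ Q K'' := by
  have := seq (Q := fun _ => Q') (f := fun _ => μ) (h.sampled (x := ()) (Q := fun _ => Q'))
    (fun _ m' hm => h' m' hm) hK
  rwa [PMF.pure_bind] at this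

theorem seq_right {Q' : α → Mem → Prop} (h : Sampled c m μ Q' K)
    (h' : ∀ x m', Q' x m' → Triple d m' (Q x) K') (hK : K + K' ≤ K'') :
    Sampled (.seq c d) m μ Q K'' := by
  have := seq (f := PMF.pure) h (fun x m' hm => (h' x m' hm).sampled) hK
  rwa [PMF.bind_pure] at this

theorem ite {e : Expr} (he : e.Small M m) (hS : 1 + M.size ≤ S)
    (h1 : e.eval m ≠ 0 → Sampled c m μ Q K) (h2 : e.eval m = 0 → Sampled d m μ Q K)
    (hK : (e.nodes + 1) * S + K ≤ K') : Sampled (.ite e c d) m μ Q K' := by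
  have hc := he.cost_le hS
  have key : Sampled (if e.eval m ≠ 0 then c else d) m μ Q K := by
    split_ifs with h
    · exact h1 h
    · exact h2 (not_not.1 h)
  have : (Cmd.ite e c d).exec noOracle m = ((if e.eval m ≠ 0 then c else d).exec noOracle m).bind
      fun y => PMF.pure (y.1, e.cost m + y.2 + 1) := by
    simp only [Cmd.exec]
    split_ifs <;> rfl
  rw [Sampled, this]
  refine key.bind_pure_left fun x y hy z hz => ?_
  simp only [PMF.support_pure, Set.mem_singleton_iff] at hz
  subst hz
  refine ⟨hy.1, ?_⟩
  simp only
  nlinarith [hy.2]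

theorem assign_seq {a : ℕ} {e f : Expr} (he : e.Small M m) (hf : f.Small M m)
    (hS : 1 + M.size ≤ S) (h : Sampled d (m.write a (e.eval m) (f.eval m)) μ Q K)
    (hK : (e.nodes + f.nodes + 1) * S + K ≤ K') :
    Sampled (.seq (.assign a e f) d) m μ Q K' :=
  seq_left (Triple.assign he hf hS (Q := fun m' => m' = m.write a (e.eval m) (f.eval m)) rfl)
    (fun _ h' => h' ▸ h) hK

theorem rand {a : ℕ} {e f : Expr} (he : e.Small M m) (hf : f.Small M m)
    (hS : 1 + M.size ≤ S) :
    Sampled (.rand a e f) m (uniformBelow (f.eval m))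
      (fun v m' => m' = m.write a (e.eval m) v ∧ v ≤ f.eval m)
      ((e.nodes + f.nodes + 1) * S) := by
  have h1 := he.cost_le hS
  have h2 := hf.cost_le hS
  have : Lift (fun x y => x = y ∧ x ≤ f.eval m) (uniformBelow (f.eval m))
      (uniformBelow (f.eval m)) := Lift.refl fun x hx => ⟨rfl, (uniformBelow_support hx).1⟩
  refine this.bind_pure_left fun x y hxy z hz => ?_
  simp only [PMF.support_pure, Set.mem_singleton_iff] at hz
  subst hz
  obtain ⟨rfl, hx⟩ := hxy
  refine ⟨⟨rfl, hx⟩, ?_⟩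
  simp only
  nlinarith

end Sampled

/-! ### Uniform residues and vectors, and programs that draw them -/

theorem map_equiv_uniform {α β : Type*} [Fintype α] [Nonempty α] [Fintype β] [Nonempty β]
    (e : α ≃ β) : (PMF.uniformOfFintype α).map e = PMF.uniformOfFintype β := by
  ext b
  rw [PMF.map_apply, tsum_eq_single (e.symm b)]
  · simp [Fintype.card_congr e]
  · intro a ha
    rw [if_neg]
    rintro rfl
    simp at ha

theorem uniform_prod {α β : Type*} [Fintype α] [Nonempty α] [Fintype β] [Nonempty β] :
    PMF.uniformOfFintype (α × β) = (PMF.uniformOfFintype α).bind fun a =>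
      (PMF.uniformOfFintype β).map fun b => (a, b) := by
  ext ⟨a, b⟩
  rw [PMF.bind_apply, tsum_eq_single a]
  · rw [PMF.map_apply, tsum_eq_single b]
    · simp only [PMF.uniformOfFintype_apply, Fintype.card_prod, Nat.cast_mul, if_true]
      rw [ENNReal.mul_inv] <;> simp
    · intro b' hb'
      rw [if_neg]
      simpa using hb'.symm
  · intro a' ha'
    rw [PMF.map_apply, ENNReal.tsum_eq_zero.2, mul_zero]
    intro b'
    rw [if_neg]
    simp [ha'.symm]

namespace GroupFamily

variable {F : GroupFamily} {k M S : ℕ} {i : F.Inst}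

theorem uniformBelow_order (i : F.Inst) : uniformBelow (F.q i) = (F.unif i).map ZMod.val := by
  have hq := (F.prime_q i).ne_zero
  ext v
  rw [uniformBelow, dif_neg hq, PMF.uniformOfFinset_apply, PMF.map_apply]
  by_cases hv : v < F.q i
  · rw [if_pos (by simpa using hv), tsum_eq_single (v : ZMod (F.q i))]
    · simp [unif, ZMod.val_natCast, Nat.mod_eq_of_lt hv, ZMod.card]
    · intro b hb
      rw [if_neg]
      rintro rfl
      simp at hb
  · rw [if_neg (by simpa using hv), ENNReal.tsum_eq_zero.2]
    intro b
    rw [if_neg]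
    rintro rfl
    exact hv (ZMod.val_lt b)

theorem unifVec_zero (i : F.Inst) : F.unifVec i 0 = PMF.pure default := by
  ext v
  obtain rfl : v = default := Subsingleton.elim _ _
  rw [PMF.pure_apply_self]
  simp [unifVec]

/-- Splitting off the first entry matches the order in which the loop of `fillC` draws the entries.
-/
theorem unifVec_succ (i : F.Inst) (n : ℕ) : F.unifVec i (n + 1) = (F.unif i).bind fun a =>
    (F.unifVec i n).map fun v => Fin.cons a v := by
  rw [unifVec, ← map_equiv_uniform (Fin.consEquiv fun _ : Fin (n + 1) => ZMod (F.q i)),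
    uniform_prod, PMF.map_bind]
  simp only [PMF.map_comp]
  rfl

/-- Draw a residue modulo the order of the group. -/
theorem rand_sampled (hB : F.Bounds k M S) (hi : i ∈ (F.setup k).support) {m : Mem} {a : ℕ}
    {e : Expr} (he : e.Small M m) (h2 : m 0 2 = F.q i) :
    Sampled (.rand a e (V 2)) m (F.unif i) (fun v m' => m' = m.write a (e.eval m) v.val)
      ((e.nodes + 3) * S) := by
  have hf : (V 2).Small M m := by
    have := hB.le
    have := hB.q i hi
    simp only [Expr.Small, Expr.eval, h2]
    exact ⟨by omega, by nlinarith⟩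
  have c1 := he.cost_le hB.size
  have c2 := hf.cost_le hB.size
  have hE : (Cmd.rand a e (V 2)).exec noOracle m = (F.unif i).bind fun v =>
      PMF.pure (m.write a (e.eval m) v.val, e.cost m + (V 2).cost m + 1) := by
    simp only [Cmd.exec]
    rw [show (V 2).eval m = F.q i from h2, uniformBelow_order, PMF.bind_map]
    rfl
  have : Lift (fun x y => x = y) (F.unif i) (F.unif i) := Lift.refl fun _ _ => rfl
  rw [Sampled, hE]
  refine this.bind_pure_left fun x y hxy z hz => ?_
  simp only [PMF.support_pure, Set.mem_singleton_iff] at hz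
  subst hz hxy
  have := hB.size
  simp only [Expr.nodes] at c2
  exact ⟨rfl, by simp only; linarith⟩

/-- Fill an array with random residues, as many as the variable `N` says. -/
def fillC (a N : ℕ) : Cmd :=
  .seq (setV 13 (.const 0)) <| .loop (V N) <|
    .seq (.rand a (V 13) (V 2)) (setV 13 (.add (V 13) (.const 1)))

theorem fillC_sampled (hB : F.Bounds k M S) (hi : i ∈ (F.setup k).support) {m : Mem} {a N n : ℕ}
    (ha : a ≠ 0) (h2 : m 0 2 = F.q i) (hN : m 0 N = n) (hNM : N < 13)
    (hnS : n ≤ S) (hnM : n + 100 ≤ M) :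
    Sampled (fillC a N) m (F.unifVec i n)
      (fun v m' => Same [a] [13] m m' ∧ ∀ j : Fin n, m' a j = (v j).val) (100 * (S * S)) := by
  have hM := hB.le
  have hS := hB.size
  have hSS : S ≤ S * S := Nat.le_mul_of_pos_left _ (by omega)
  refine Sampled.assign_seq (M := M) (S := S) (K := 90 * (S * S)) ?_ ?_ hS ?_ ?_
  · simp only [Expr.Small]; omega
  · simp only [Expr.Small]; omega
  swap
  · simp only [Expr.nodes]; omega
  simp only [Expr.eval]
  set m1 := m.write 0 13 0 with hm1
  have s1 : Same [] [13] m m1 := same_write _ _ _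
  have hN1 : m1 0 N = n := by rw [s1.2 N (by simp; omega), hN]
  have he : (V N).Small M m1 := by
    simp only [Expr.Small, Expr.eval, hN1]
    omega
  have hev : (V N).eval m1 = n := hN1
  -- Induction on the number `l` of rounds left, with the counter at `j`: a vector of length `l` is
  -- coupled with the entries from `j` on, and the earlier entries are kept.
  have key : ∀ l j m', j + l = n → m' 0 2 = F.q i → m' 0 13 = j →
      Lift (fun (v : Fin l → ZMod (F.q i)) (z : Mem × ℕ) => Same [a] [13] m' z.1 ∧
        (∀ b < j, z.1 a b = m' a b) ∧
        (∀ b : Fin l, z.1 a (j + b) = (v b).val) ∧ z.2 ≤ l * (30 * S))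
      (F.unifVec i l) (iterateRun ((Cmd.seq (.rand a (V 13) (V 2))
        (setV 13 (.add (V 13) (.const 1)))).exec noOracle) l m') := by
    intro l
    induction l with
    | zero =>
      intro j m' _ _ _
      rw [unifVec_zero]
      exact Lift.pure ⟨Same.refl _ _ _, fun _ _ => rfl, fun b => b.elim0, by simp⟩
    | succ l ih =>
      intro j m' hj h2' h13
      have hbody : Sampled (.seq (.rand a (V 13) (V 2)) (setV 13 (.add (V 13) (.const 1)))) m'
          (F.unif i) (fun v m'' => Same [a] [13] m' m'' ∧ m'' 0 13 = j + 1 ∧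
            m'' a j = v.val ∧ ∀ b, b ≠ j → m'' a b = m' a b) (20 * S) := by
        refine (rand_sampled hB hi (a := a) (e := V 13) ?_ h2').seq_right (K' := 10 * S) ?_ ?_
        · simp only [Expr.Small, Expr.eval, h13]
          omega
        · rintro v m'' rfl
          simp only [Expr.eval, h13]
          have e0 : (m'.write a j v.val) 0 13 = j := by rw [write_ne _ (by omega), h13]
          refine (Triple.assign (M := M) (S := S) ?_ ?_ hS ?_).mono (fun _ h => h) ?_
          · simp only [Expr.Small]; omega
          · simp only [Expr.Small, Expr.eval, e0]; omega
          · simp only [Expr.eval, e0]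
            refine ⟨(same_write_array m' ha j v.val).trans (same_write _ _ _) (by simp) (by simp)
              (by simp) (by simp), by simp, ?_, fun b hb => ?_⟩
            · rw [write_array_ne _ ha, write_same]
            · rw [write_array_ne _ ha, write_ne _ (fun _ => hb)]
          · simp only [Expr.nodes]; omega
        · simp only [Expr.nodes]; omega
      simp only [iterateRun]
      rw [unifVec_succ]
      refine Lift.bind hbody ?_
      rintro v ⟨m1, k1⟩ ⟨⟨s1, e1, e2, e3⟩, hk1⟩
      simp only at s1 e1 e2 e3 hk1 ⊢
      refine Lift.bind (ih (j + 1) m1 (by omega) (by rw [s1.2 2 (by simp), h2']) e1) ?_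
      rintro w ⟨m2, k2⟩ ⟨s2, d2, d3, hk2⟩
      simp only at s2 d2 d3 hk2 ⊢
      refine Lift.pure ⟨s1.trans s2 (by simp) (by simp) (by simp) (by simp), ?_, ?_, ?_⟩
      · intro b hb
        exact (d2 b (by omega)).trans (e3 b (by omega))
      · intro b
        refine Fin.cases ?_ (fun b => ?_) b
        · simpa [e2] using d2 j (by omega)
        · have := d3 b
          simp only [Fin.cons_succ, Fin.val_succ, ← this]
          congr 1
          omega
      · simp only
        have : 1 ≤ S := by omega
        linarith
  rw [Sampled]
  simp only [Cmd.exec, hev]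
  refine (key n 0 m1 (by omega) (by rw [s1.2 2 (by simp), h2])
    (by simp [hm1])).bind_pure_left ?_
  rintro v y ⟨t1, t2, t3, t4⟩ z hz
  simp only [PMF.support_pure, Set.mem_singleton_iff] at hz
  subst hz
  refine ⟨⟨s1.trans t1 (by simp) (by simp) (by simp) (by simp), fun j => by simpa using t3 j⟩, ?_⟩
  have := he.cost_le hS
  have h5 := Nat.mul_le_mul_right (30 * S) hnS
  simp only [Expr.nodes] at *
  nlinarith

/-- Copy the indices of a request from the array `a` of the adversary, and check them. -/
def validC (a : ℕ) : Cmd :=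
  .seq (setV 12 (.const 1)) <| .seq (setV 13 (.const 0)) <| .loop (V 7) <|
    .seq (.assign 25 (V 13) (.get (reg 1 a) (V 13))) <|
    .seq (.ite (.sub (V 8) (.get 25 (V 13))) .skip (setV 12 (.const 0))) <|
    .seq (setV 14 (.const 0)) <|
    .seq (.loop (V 13) <|
      .seq (.ite (.add (.sub (.get 25 (V 14)) (.get 25 (V 13)))
          (.sub (.get 25 (V 13)) (.get 25 (V 14)))) .skip (setV 12 (.const 0)))
        (setV 14 (.add (V 14) (.const 1))))
    (setV 13 (.add (V 13) (.const 1)))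

/-- The request has to be checked because malformed ones get the empty reply. Each entry is compared
with `n` and with all earlier entries; `valid_iff` turns the outcome into the existence of an
embedding. The copy in array `25` is read later by `shareC`. -/
theorem validC_triple {T n : ℕ} (hM : T + 100 ≤ M) (hS : 1 + M.size ≤ S) {m : Mem} {a : ℕ}
    (hT : m 0 7 = T) (hn : m 0 8 = n) (hnM : n ≤ M) (hTS : T ≤ S)
    (row : ℕ → ℕ) (hrow : m (reg 1 a) = row) (hrM : ∀ j, 2 * row j ≤ M) :
    Triple (validC a) m (fun m' => Same [25] [12, 13, 14] m m' ∧ (∀ j < T, m' 25 j = row j) ∧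
      m' 0 12 ≤ 1 ∧ (m' 0 12 ≠ 0 ↔ ∀ j < T, row j < n ∧ ∀ l < j, row l ≠ row j)) (500 * (S * S * S)) := by
  have hSS : S ≤ S * S := Nat.le_mul_of_pos_left _ (by omega)
  have hSSS : S * S ≤ S * S * S := Nat.le_mul_of_pos_right _ (by omega)
  have hrM' : ∀ j, row j ≤ M := fun j => by have := hrM j; omega
  refine Triple.assign_seq (M := M) (S := S) (K := 490 * (S * S * S)) ?_ ?_ hS ?_ ?_
  · simp only [Expr.Small]; omega
  · simp only [Expr.Small]; omega
  swap
  · simp only [Expr.nodes]; omega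
  refine Triple.assign_seq (M := M) (S := S) (K := 480 * (S * S * S)) ?_ ?_ hS ?_ ?_
  · simp only [Expr.Small]; omega
  · simp only [Expr.Small]; omega
  swap
  · simp only [Expr.nodes]; omega
  simp only [Expr.eval]
  set m1 := (m.write 0 12 1).write 0 13 0 with hm1
  have s1 : Same [25] [12, 13, 14] m m1 :=
    (same_write _ _ _).trans (same_write _ _ _) (by simp) (by simp) (by simp) (by simp)
  have hv : (V 7).eval m1 = T := (s1.2 7 (by simp)).trans hT
  refine Triple.loop (M := M) (S := S) (K := 200 * (S * S))
    (fun j m' => Same [25] [12, 13, 14] m m' ∧ m' 0 13 = j ∧ (∀ l < j, m' 25 l = row l) ∧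
      m' 0 12 ≤ 1 ∧ (m' 0 12 ≠ 0 ↔ ∀ l < j, row l < n ∧ ∀ l' < l, row l' ≠ row l))
    ?_ hS ?_ ?_ ?_ ?_ ?_
  · simp only [Expr.Small, Expr.eval] at hv ⊢
    omega
  · omega
  · refine ⟨s1, by simp [hm1], by simp, ?_, ?_⟩
    · rw [hm1, write_ne _ (by simp), write_same]
    · rw [hm1, write_ne _ (by simp), write_same]
      simp
  · rintro j m2 hj ⟨s2, h13, h25, h12, hok⟩
    rw [hv] at hj
    have hr : m2 (reg 1 a) = row := by
      rw [s2.1 _ (by simp only [reg]; omega) (by simp only [reg]; omega)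
        (by simp only [reg, List.mem_singleton]; omega), hrow]
    refine Triple.assign_seq (M := M) (S := S) (K := 190 * (S * S)) ?_ ?_ hS ?_ ?_
    · simp only [Expr.Small, Expr.eval]; omega
    · simp only [Expr.Small, Expr.eval, h13, hr]
      exact ⟨⟨by omega, by omega⟩, hrM' j⟩
    swap
    · simp only [Expr.nodes]; omega
    simp only [Expr.eval, h13, hr]
    set m3 := m2.write 25 j (row j) with hm3
    have s3 : Same [25] [12, 13, 14] m m3 :=
      s2.trans (same_write_array _ (by omega) _ _) (by simp) (by simp) (by simp) (by simp)
    have a0 : m3 0 = m2 0 := write_array_ne _ (by omega)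
    have a25 : ∀ l < j + 1, m3 25 l = row l := by
      intro l hl
      by_cases h : l = j
      · rw [hm3, h, write_same]
      · rw [hm3, write_ne _ (fun _ => h), h25 l (by omega)]
    have a8 : m3 0 8 = n := (s3.2 8 (by simp)).trans hn
    refine Triple.seq (K := 20 * S) (K' := 150 * (S * S)) (Q' := fun m' => Same [25] [12, 13, 14] m m' ∧
      m' 0 13 = j ∧ (∀ l < j + 1, m' 25 l = row l) ∧ m' 0 12 ≤ 1 ∧
      (m' 0 12 ≠ 0 ↔ (∀ l < j, row l < n ∧ ∀ l' < l, row l' ≠ row l) ∧ row j < n)) ?_ ?_ (by omega)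
    · refine Triple.ite (M := M) (S := S) (K := 10 * S) ?_ hS ?_ ?_ ?_
      · simp only [Expr.Small, Expr.eval, a0, h13, a25 j (by omega)]
        rw [← a0, a8]
        exact ⟨by omega, ⟨by omega, by omega⟩, hrM' j⟩
      · simp only [Expr.eval, a8, a0, h13, a25 j (by omega)]
        intro h
        refine (Triple.skip ?_).mono (fun _ h => h) (by omega)
        refine ⟨s3, by rw [a0, h13], a25, by rw [a0]; exact h12, ?_⟩
        rw [a0, hok]
        exact ⟨fun h' => ⟨h', by omega⟩, fun h' => h'.1⟩
      · simp only [Expr.eval, a8, a0, h13, a25 j (by omega)]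
        intro h
        refine (Triple.assign (M := M) (S := S) ?_ ?_ hS ?_).mono (fun _ h => h) ?_
        · simp only [Expr.Small]; omega
        · simp only [Expr.Small]; omega
        · simp only [Expr.eval]
          refine ⟨s3.trans (same_write _ _ _) (by simp) (by simp) (by simp) (by simp), ?_,
            fun l hl => ?_, by simp, ?_⟩
          · rw [write_ne _ (by simp), a0, h13]
          · rw [write_array_ne _ (by omega), a25 l hl]
          · simp only [write_same, ne_eq, not_true_eq_false, false_iff]
            rintro ⟨-, h'⟩
            omega
        · simp only [Expr.nodes]; omega
      · simp only [Expr.nodes]; omega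
    · rintro m4 ⟨s4, b13, b25, b12, bok⟩
      refine Triple.assign_seq (M := M) (S := S) (K := 140 * (S * S)) ?_ ?_ hS ?_ ?_
      · simp only [Expr.Small]; omega
      · simp only [Expr.Small]; omega
      swap
      · simp only [Expr.nodes]; omega
      simp only [Expr.eval]
      set m5 := m4.write 0 14 0 with hm5
      have s5 : Same [25] [12, 13, 14] m m5 :=
        s4.trans (same_write _ _ _) (by simp) (by simp) (by simp) (by simp)
      have d13 : m5 0 13 = j := by rw [hm5, write_ne _ (by simp), b13]
      have d12 : m5 0 12 = m4 0 12 := by rw [hm5, write_ne _ (by simp)]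
      have d25 : m5 25 = m4 25 := write_array_ne _ (by omega)
      have hv5 : (V 13).eval m5 = j := d13
      refine Triple.seq (K := 100 * (S * S)) (K' := 10 * S) (Q' := fun m' =>
        Same [25] [12, 13, 14] m m' ∧ m' 0 13 = j ∧ (∀ l < j + 1, m' 25 l = row l) ∧ m' 0 12 ≤ 1 ∧
        (m' 0 12 ≠ 0 ↔ ((∀ l < j, row l < n ∧ ∀ l' < l, row l' ≠ row l) ∧ row j < n) ∧
          ∀ l < j, row l ≠ row j)) ?_ ?_ (by omega)
      · refine Triple.loop (M := M) (S := S) (K := 40 * S)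
          (fun l m' => Same [25] [12, 13, 14] m m' ∧ m' 0 14 = l ∧ m' 0 13 = j ∧
            (∀ l < j + 1, m' 25 l = row l) ∧ m' 0 12 ≤ 1 ∧
            (m' 0 12 ≠ 0 ↔ ((∀ l < j, row l < n ∧ ∀ l' < l, row l' ≠ row l) ∧ row j < n) ∧
            ∀ l' < l, row l' ≠ row j)) ?_ hS ?_ ?_ ?_ ?_ ?_
        · simp only [Expr.Small, Expr.eval, d13]
          omega
        · omega
        · refine ⟨s5, by simp [hm5], d13, fun l hl => by rw [d25, b25 l hl], by rw [d12]; exact b12, ?_⟩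
          rw [d12, bok]
          simp
        · rw [hv5]
          rintro l m6 hl ⟨s6, e14, e13, e25, e12, eok⟩
          refine Triple.seq (K := 30 * S) (K' := 10 * S) (Q' := fun m' =>
            Same [25] [12, 13, 14] m m' ∧ m' 0 14 = l ∧ m' 0 13 = j ∧
            (∀ l < j + 1, m' 25 l = row l) ∧ m' 0 12 ≤ 1 ∧
            (m' 0 12 ≠ 0 ↔ ((∀ l < j, row l < n ∧ ∀ l' < l, row l' ≠ row l) ∧ row j < n) ∧
            ∀ l' < l + 1, row l' ≠ row j)) ?_ ?_ (by omega)
          -- The two truncated differences add up to the distance of the entries, which is zero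
          -- exactly if they agree.
          · have hrl := hrM l
            have hrj := hrM j
            refine Triple.ite (M := M) (S := S) (K := 10 * S) ?_ hS ?_ ?_ ?_
            · simp only [Expr.Small, Expr.eval, e13, e14, e25 l (by omega), e25 j (by omega)]
              omega
            · simp only [Expr.eval, e13, e14, e25 l (by omega), e25 j (by omega)]
              intro h
              refine (Triple.skip ?_).mono (fun _ h => h) (by omega)
              refine ⟨s6, e14, e13, e25, e12, ?_⟩
              rw [eok]
              refine and_congr_right fun _ => ⟨fun h' l' hl' => ?_, fun h' l' hl' => h' l' (by omega)⟩
              rcases Nat.lt_succ_iff_lt_or_eq.1 hl' with h1 | rfl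
              · exact h' l' h1
              · omega
            · simp only [Expr.eval, e13, e14, e25 l (by omega), e25 j (by omega)]
              intro h
              refine (Triple.assign (M := M) (S := S) ?_ ?_ hS ?_).mono (fun _ h => h) ?_
              · simp only [Expr.Small]; omega
              · simp only [Expr.Small]; omega
              · simp only [Expr.eval]
                refine ⟨s6.trans (same_write _ _ _) (by simp) (by simp) (by simp) (by simp), ?_, ?_,
                  fun l hl => ?_, by simp, ?_⟩
                · rw [write_ne _ (by simp), e14]
                · rw [write_ne _ (by simp), e13]
                · rw [write_array_ne _ (by omega), e25 l hl]
                · simp only [write_same, ne_eq, not_true_eq_false, false_iff]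
                  rintro ⟨-, h'⟩
                  exact h' l (by omega) (by omega)
              · simp only [Expr.nodes]; omega
            · simp only [Expr.nodes]; omega
          · rintro m7 ⟨s7, f14, f13, f25, f12, fok⟩
            refine (Triple.assign (M := M) (S := S) ?_ ?_ hS ?_).mono (fun _ h => h) ?_
            · simp only [Expr.Small]; omega
            · simp only [Expr.Small, Expr.eval, f14]; omega
            · simp only [Expr.eval, f14]
              refine ⟨s7.trans (same_write _ _ _) (by simp) (by simp) (by simp) (by simp), by simp, ?_,
                fun l hl => ?_, ?_, ?_⟩
              · rw [write_ne _ (by simp), f13]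
              · rw [write_array_ne _ (by omega), f25 l hl]
              · rw [write_ne _ (by simp)]; exact f12
              · rw [write_ne _ (by simp)]; exact fok
            · simp only [Expr.nodes]; omega
        · rw [hv5]
          rintro m6 ⟨s6, -, e13, e25, e12, eok⟩
          exact ⟨s6, e13, e25, e12, eok⟩
        · simp only [Expr.nodes]
          nlinarith
      · rintro m6 ⟨s6, e13, e25, e12, eok⟩
        refine (Triple.assign (M := M) (S := S) ?_ ?_ hS ?_).mono (fun _ h => h) ?_
        · simp only [Expr.Small]; omega
        · simp only [Expr.Small, Expr.eval, e13]; omega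
        · simp only [Expr.eval, e13]
          refine ⟨s6.trans (same_write _ _ _) (by simp) (by simp) (by simp) (by simp), by simp,
            fun l hl => ?_, ?_, ?_⟩
          · rw [write_array_ne _ (by omega), e25 l hl]
          · rw [write_ne _ (by simp)]; exact e12
          · rw [write_ne _ (by simp), eok]
            constructor
            · rintro ⟨⟨h1, h2⟩, h3⟩ l hl
              rcases Nat.lt_succ_iff_lt_or_eq.1 hl with h | rfl
              · exact h1 l h
              · exact ⟨h2, h3⟩
            · exact fun h => ⟨⟨fun l hl => h l (by omega), (h j (by omega)).1⟩,
                (h j (by omega)).2⟩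
        · simp only [Expr.nodes]; omega
  · rw [hv]
    rintro m2 ⟨s2, -, h25, h12, hok⟩
    exact ⟨s2, h25, h12, hok⟩
  · simp only [Expr.nodes]
    nlinarith

end GroupFamily
namespace GroupFamily

variable {F : GroupFamily} {k M S : ℕ} {i : F.Inst} {s n : ℕ}

/-! ### The simulated oracle -/

/-- The data that determine the simulated oracle: a Diffie-Hellman triple, the secret key, the
number of coefficients that have been randomized already, the coefficients, and the points. -/
structure Params (F : GroupFamily) (i : F.Inst) (s n : ℕ) where
  X : F.G i
  Y : F.G i
  Z : F.G i
  α : ZMod (F.q i)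
  l : ℕ
  c : Fin s → ZMod (F.q i)
  x : Fin n → ZMod (F.q i)

namespace Params

variable (P : F.Params i s n)

/-- The coefficients, the first of which are replaced by random ones. -/
def coeff (u : Fin s → ZMod (F.q i)) : Fin s → ZMod (F.q i) :=
  fun j => if (j : ℕ) < P.l then u j else P.c j

/-- The indicator of the coefficient that stems from the Diffie-Hellman triple. -/
def unitVec : Fin s → ZMod (F.q i) := fun j => if (j : ℕ) = P.l then 1 else 0

/-- The first component of a reply. -/
def base (a b : ZMod (F.q i)) : F.G i := F.gen i ^ a.val * P.X ^ b.val

open Classical in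
/-- The simulated power of the unknown coefficient. -/
noncomputable def special (a b : ZMod (F.q i)) : F.G i :=
  if P.base a b * P.base a b = P.base a b then P.base a b else P.Y ^ a.val * P.Z ^ b.val

/-- The reply for given random choices. -/
noncomputable def answer (I : Fin s ↪ Fin n) (a b : ZMod (F.q i)) (u : Fin s → ZMod (F.q i)) :
    F.Reply i s :=
  (P.base a b, P.base a b ^ P.α.val, fun j =>
    P.base a b ^ (F.share i P.α (P.coeff u) (P.x (I j))).val *
      P.special a b ^ (F.share i 0 P.unitVec (P.x (I j))).val)

/-- The simulated oracle. -/
noncomputable def kernel (I : Fin s ↪ Fin n) : PMF (F.Reply i s) :=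
  (F.unif i).bind fun a => (F.unif i).bind fun b => (F.unifVec i s).bind fun u =>
    PMF.pure (P.answer I a b u)

/-- The memory holds the parameters. -/
structure Env (L : ℕ) (m : Mem) : Prop where
  desc : m 0 1 = F.desc i
  q : m 0 2 = F.q i
  gen : m 0 3 = F.enc i (F.gen i)
  X : m 0 4 = F.enc i P.X
  Y : m 0 5 = F.enc i P.Y
  Z : m 0 6 = F.enc i P.Z
  card : m 0 7 = s
  points : m 0 8 = n
  α : m 0 9 = P.α.val
  l : m 0 10 = P.l
  len : m 0 11 = L
  c : ∀ j : Fin s, m 5 j = (P.c j).val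
  unitVec : ∀ j : Fin s, m 10 j = if (j : ℕ) = P.l then 1 else 0
  x : ∀ j : Fin n, m 15 j = (P.x j).val

/-- Bounds for the parameters. -/
structure Fits (L M S : ℕ) : Prop where
  sM : s + 100 ≤ M
  nM : n + 100 ≤ M
  LM : L ≤ M
  lM : P.l ≤ M
  sS : s ≤ S
  nS : n ≤ S
  LS : L ≤ S
  qL : 2 * F.q i ≤ 2 ^ L

variable {P} {L : ℕ} {m m' : Mem}

/-- The parameters live in the variables below `12` and in the arrays `5`, `10`, `15`; work space is
elsewhere, so no subprogram of the simulation disturbs them. -/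
theorem Env.same (h : P.Env L m) {A l : List ℕ} (hs : Same A l m m')
    (hA : ∀ a ∈ A, 20 ≤ a ∨ a % 5 ≠ 0) (hl : ∀ j ∈ l, 12 ≤ j) : P.Env L m' := by
  have e : ∀ j < 12, m' 0 j = m 0 j := fun j hj => hs.2 j fun h => by have := hl j h; omega
  have f : ∀ a, a < 20 → a ≠ 0 → a % 5 = 0 → m' a = m a := fun a h1 h2 h3 =>
    hs.1 a (by omega) h2 fun h => by have := hA a h; omega
  constructor
  · rw [e _ (by omega), h.desc]
  · rw [e _ (by omega), h.q]
  · rw [e _ (by omega), h.gen]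
  · rw [e _ (by omega), h.X]
  · rw [e _ (by omega), h.Y]
  · rw [e _ (by omega), h.Z]
  · rw [e _ (by omega), h.card]
  · rw [e _ (by omega), h.points]
  · rw [e _ (by omega), h.α]
  · rw [e _ (by omega), h.l]
  · rw [e _ (by omega), h.len]
  · rw [f 5 (by omega) (by omega) (by omega)]; exact h.c
  · rw [f 10 (by omega) (by omega) (by omega)]; exact h.unitVec
  · rw [f 15 (by omega) (by omega) (by omega)]; exact h.x

end Params

/-! ### Subprograms that compute a simulated reply -/

/-- Keep the fixed coefficients from the variable `10` on. -/
def mergeC : Cmd :=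
  .seq (setV 13 (.const 0)) <| .loop (V 7) <|
    .seq (.ite (.sub (V 10) (V 13)) .skip (.assign 20 (V 13) (.get 5 (V 13))))
      (setV 13 (.add (V 13) (.const 1)))

/-- Array `20` starts out with the fresh vector `u`; its entries with index below `P.l` are left
alone and the others are overwritten by the fixed coefficients in place. -/
theorem mergeC_triple (hB : F.Bounds k M S) (hi : i ∈ (F.setup k).support) {P : F.Params i s n}
    {L : ℕ} {m : Mem} (hP : P.Fits L M S) (h : P.Env L m) (u : Fin s → ZMod (F.q i))
    (hu : ∀ j : Fin s, m 20 j = (u j).val) :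
    Triple mergeC m (fun m' => Same [20] [13] m m' ∧ ∀ j : Fin s, m' 20 j = (P.coeff u j).val)
      (100 * (S * S)) := by
  have hM := hP.sM
  have hS := hB.size
  have hlM := hP.lM
  have hsS := hP.sS
  have hSS : S ≤ S * S := Nat.le_mul_of_pos_left _ (by omega)
  refine Triple.assign_seq (M := M) (S := S) (K := 90 * (S * S)) ?_ ?_ hS ?_ ?_
  · simp only [Expr.Small]; omega
  · simp only [Expr.Small]; omega
  swap
  · simp only [Expr.nodes]; omega
  simp only [Expr.eval]
  set m1 := m.write 0 13 0 with hm1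
  have s1 : Same [20] [13] m m1 := (same_write _ _ _).mono (by simp) (by simp)
  have h7 : m1 0 7 = s := by rw [s1.2 7 (by simp), h.card]
  have hv : (V 7).eval m1 = s := h7
  have a20 : m1 20 = m 20 := write_array_ne _ (by omega)
  refine Triple.loop (M := M) (S := S) (K := 50 * S)
    (fun j m' => Same [20] [13] m m' ∧ m' 0 13 = j ∧
      ∀ l : Fin s, m' 20 l = if (l : ℕ) < j then (P.coeff u l).val else (u l).val)
    ?_ hS ?_ ?_ ?_ ?_ ?_
  · simp only [Expr.Small, Expr.eval, h7]
    omega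
  · omega
  · refine ⟨s1, by simp [hm1], fun l => ?_⟩
    simp [a20, hu]
  · rw [hv]
    rintro j m2 hj ⟨s2, h13, h20⟩
    have h2 : P.Env L m2 := h.same s2 (by simp) (by simp)
    refine Triple.seq (K := 30 * S) (K' := 10 * S) (Q' := fun m' => Same [20] [13] m m' ∧
      m' 0 13 = j ∧ ∀ l : Fin s, m' 20 l = if (l : ℕ) < j + 1 then (P.coeff u l).val
        else (u l).val) ?_ ?_ (by omega)
    · refine Triple.ite (M := M) (S := S) (K := 20 * S) ?_ hS ?_ ?_ ?_
      · simp only [Expr.Small, Expr.eval, h13, h2.l]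
        omega
      · simp only [Expr.eval, h13, h2.l]
        intro hlt
        refine (Triple.skip ?_).mono (fun _ h => h) (by omega)
        refine ⟨s2, h13, fun l => ?_⟩
        rw [h20]
        rcases lt_trichotomy (l : ℕ) j with h | h | h
        · rw [if_pos h, if_pos (by omega)]
        · rw [if_neg (by omega), if_pos (by omega), Params.coeff, if_pos (by omega)]
        · rw [if_neg (by omega), if_neg (by omega)]
      · simp only [Expr.eval, h13, h2.l]
        intro hge
        have hc : m2 5 j = (P.c ⟨j, hj⟩).val := h2.c ⟨j, hj⟩
        have hq := hB.q i hi
        have hcq := ZMod.val_lt (P.c ⟨j, hj⟩)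
        refine (Triple.assign (M := M) (S := S) ?_ ?_ hS ?_).mono (fun _ h => h) ?_
        · simp only [Expr.Small, Expr.eval, h13]; omega
        · simp only [Expr.Small, Expr.eval, h13, hc]
          exact ⟨⟨by omega, by omega⟩, by nlinarith⟩
        · simp only [Expr.eval, h13, hc]
          refine ⟨s2.trans (same_write_array _ (by omega) _ _) (by simp) (by simp) (by simp)
            (by simp), ?_, fun l => ?_⟩
          · rw [write_array_ne _ (by omega), h13]
          · rcases lt_trichotomy (l : ℕ) j with h | h | h
            · rw [write_ne _ (by omega), h20, if_pos h, if_pos (by omega)]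
            · rw [h, write_same, if_pos (by omega), Params.coeff, if_neg (by omega)]
              rw [show (⟨j, hj⟩ : Fin s) = l from Fin.ext h.symm]
            · rw [write_ne _ (by omega), h20, if_neg (by omega), if_neg (by omega)]
        · simp only [Expr.nodes]; omega
      · simp only [Expr.nodes]; omega
    · rintro m3 ⟨s3, b13, b20⟩
      refine (Triple.assign (M := M) (S := S) ?_ ?_ hS ?_).mono (fun _ h => h) ?_
      · simp only [Expr.Small]; omega
      · simp only [Expr.Small, Expr.eval, b13]; omega
      · simp only [Expr.eval, b13]
        refine ⟨s3.trans (same_write _ _ _) (by simp) (by simp) (by simp) (by simp), by simp,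
          fun l => ?_⟩
        rw [write_array_ne _ (by omega), b20]
      · simp only [Expr.nodes]; omega
  · rw [hv]
    rintro m2 ⟨s2, -, h20⟩
    refine ⟨s2, fun l => ?_⟩
    rw [h20, if_pos l.2]
  · simp only [Expr.nodes]
    nlinarith

/-- Compute the first component of a reply and the power of the unknown coefficient. -/
def baseC (F : GroupFamily) : Cmd :=
  .seq (F.powC 17 3 15) <| .seq (F.powC 19 4 16) <| .seq (F.mulC 17 17 19) <|
  .seq (F.mulC 19 17 17) <|
  .ite (.add (.sub (V 19) (V 17)) (.sub (V 17) (V 19)))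
    (.seq (F.powC 18 5 15) <| .seq (F.powC 19 6 16) (F.mulC 18 18 19))
    (setV 18 (V 17))

theorem powC_env (hB : F.Bounds k M S) (hi : i ∈ (F.setup k).support) {P : F.Params i s n}
    {L : ℕ} {m : Mem} (hP : P.Fits L M S) (h : P.Env L m) {d x e : ℕ} (Y : F.G i)
    (a : ZMod (F.q i)) (hx : m 0 x = F.enc i Y) (he : m 0 e = a.val) (hd : d ≤ 19) (hd' : 12 ≤ d)
    (hxM : x < 20) (hyM : e < 20) :
    Triple (F.powC d x e) m (fun m' => Same [] [d, 20, 21] m m' ∧ m' 0 d = F.enc i (Y ^ a.val))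
      (200 * (S * S)) :=
  powC_triple hB hi Y _ h.desc h.q (h.len ▸ hP.LS) (h.len ▸ hP.LM) (h.len ▸ hP.qL) hx he (ZMod.val_lt _)
    hd hd' hxM hyM

/-- The representation of the identity is not available for comparison, so `base = 1` is tested as
`base * base = base`. In that case `base` itself supplies the identity needed for `special`. -/
theorem baseC_triple (hB : F.Bounds k M S) (hi : i ∈ (F.setup k).support) {P : F.Params i s n}
    {L : ℕ} {m : Mem} (hP : P.Fits L M S) (h : P.Env L m) (a b : ZMod (F.q i))
    (ha : m 0 15 = a.val) (hb : m 0 16 = b.val) (henc : ∀ y, 2 * F.enc i y ≤ M) :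
    Triple (baseC F) m (fun m' => Same [] [17, 18, 19, 20, 21] m m' ∧
      m' 0 17 = F.enc i (P.base a b) ∧ m' 0 18 = F.enc i (P.special a b)) (2000 * (S * S)) := by
  have hM := hB.le
  have hS := hB.size
  have hSS : S ≤ S * S := Nat.le_mul_of_pos_left _ (by omega)
  refine (powC_env hB hi hP h _ a h.gen ha (by omega) (by omega) (by omega) (by omega)).seq
    (K' := 1800 * (S * S)) ?_ (by omega)
  rintro m1 ⟨s1, r1⟩
  have h1 := h.same s1 (by simp) (by simp)
  refine (powC_env hB hi hP h1 _ b h1.X (by rw [s1.2 16 (by simp), hb]) (by omega) (by omega)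
    (by omega) (by omega)).seq (K' := 1600 * (S * S)) ?_ (by omega)
  rintro m2 ⟨s2, r2⟩
  have h2 := h1.same s2 (by simp) (by simp)
  refine (mulC_triple hB hi _ _ h2.desc (by rw [s2.2 17 (by simp), r1]) r2 (by omega) (by omega)
    (by omega)).seq (K' := 1550 * (S * S)) ?_ (by omega)
  rintro m3 ⟨s3, r3⟩
  have h3 := h2.same s3 (by simp) (by simp)
  refine (mulC_triple hB hi _ _ h3.desc r3 r3 (by omega) (by omega)
    (by omega)).seq (K' := 1500 * (S * S)) ?_ (by omega)
  rintro m4 ⟨s4, r4⟩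
  have h4 := h3.same s4 (by simp) (by simp)
  change m3 0 17 = F.enc i (P.base a b) at r3
  change m4 0 19 = F.enc i (P.base a b * P.base a b) at r4
  have r17 : m4 0 17 = F.enc i (P.base a b) := by rw [s4.2 17 (by simp), r3]
  have t2 : Same [] [17, 18, 19, 20, 21] m m2 := s1.trans s2 (by simp) (by simp) (by simp) (by simp)
  have t3 : Same [] [17, 18, 19, 20, 21] m m3 := t2.trans s3 (by simp) (by simp) (by simp) (by simp)
  have t4 : Same [] [17, 18, 19, 20, 21] m m4 := t3.trans s4 (by simp) (by simp) (by simp) (by simp)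
  have e1 := henc (P.base a b)
  have e2 := henc (P.base a b * P.base a b)
  refine Triple.ite (M := M) (S := S) (K := 1000 * (S * S)) ?_ hS ?_ ?_ ?_
  · simp only [Expr.Small, Expr.eval, r4, r17]
    omega
  · simp only [Expr.eval, r4, r17]
    intro hne
    have hne' : P.base a b * P.base a b ≠ P.base a b := by
      intro h
      rw [h] at hne
      omega
    refine (powC_env hB hi hP h4 _ a h4.Y (by rw [t4.2 15 (by simp), ha]) (by omega) (by omega)
      (by omega) (by omega)).seq (K' := 800 * (S * S)) ?_ (by omega)
    rintro m5 ⟨s5, r5⟩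
    have h5 := h4.same s5 (by simp) (by simp)
    refine (powC_env hB hi hP h5 _ b h5.Z (by rw [s5.2 16 (by simp), t4.2 16 (by simp), hb])
      (by omega) (by omega) (by omega) (by omega)).seq (K' := 600 * (S * S)) ?_ (by omega)
    rintro m6 ⟨s6, r6⟩
    have h6 := h5.same s6 (by simp) (by simp)
    refine (mulC_triple hB hi _ _ h6.desc (by rw [s6.2 18 (by simp), r5]) r6 (by omega) (by omega)
      (by omega)).mono ?_ (by omega)
    rintro m7 ⟨s7, r7⟩
    have t5 : Same [] [17, 18, 19, 20, 21] m m5 :=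
      t4.trans s5 (by simp) (by simp) (by simp) (by simp)
    have t6 : Same [] [17, 18, 19, 20, 21] m m6 :=
      t5.trans s6 (by simp) (by simp) (by simp) (by simp)
    refine ⟨t6.trans s7 (by simp) (by simp) (by simp) (by simp), ?_, ?_⟩
    · rw [s7.2 17 (by simp), s6.2 17 (by simp), s5.2 17 (by simp), r17]
    · rw [r7, Params.special, if_neg hne']
  · simp only [Expr.eval, r4, r17]
    intro he
    have he' : P.base a b * P.base a b = P.base a b := F.enc_injective i (by omega)
    refine (Triple.assign (M := M) (S := S) ?_ ?_ hS ?_).mono (fun _ h => h) ?_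
    · simp only [Expr.Small]; omega
    · simp only [Expr.Small, Expr.eval, r17]; omega
    · simp only [Expr.eval, r17]
      refine ⟨t4.trans (same_write _ _ _) (by simp) (by simp) (by simp) (by simp), ?_, ?_⟩
      · rw [write_ne _ (by simp), r17]
      · rw [write_same, Params.special, if_pos he']
    · simp only [Expr.nodes]; omega
  · simp only [Expr.nodes]; omega

/-- Evaluate the two polynomials at the point whose index is the entry of the array `25` with
index in the variable `13`. -/
def shareC : Cmd :=
  .seq (setV 15 (V 9)) <| .seq (setV 16 (.const 0)) <|
  .seq (setV 12 (.get 15 (.get 25 (V 13)))) <| .seq (setV 14 (.const 0)) <| .loop (V 7) <|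
    .seq (setV 15 (.mod (.add (V 15) (.mul (.get 20 (V 14)) (V 12))) (V 2))) <|
    .seq (setV 16 (.mod (.add (V 16) (.mul (.get 10 (V 14)) (V 12))) (V 2))) <|
    .seq (setV 12 (.mod (.mul (V 12) (.get 15 (.get 25 (V 13)))) (V 2)))
      (setV 14 (.add (V 14) (.const 1)))

theorem val_add_mul (b p : ZMod (F.q i)) (c : ℕ) :
    (b.val + c * p.val) % F.q i = (b + c * p).val := by
  rw [← ZMod.val_natCast]
  simp

theorem share_eq_range (α x : ZMod (F.q i)) (c : Fin s → ZMod (F.q i)) (f : ℕ → ℕ)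
    (hf : ∀ j : Fin s, (f j : ZMod (F.q i)) = c j) :
    α + ∑ l ∈ Finset.range s, (f l : ZMod (F.q i)) * x ^ (l + 1) = F.share i α c x := by
  rw [share, ← Fin.sum_univ_eq_sum_range (fun l => (f l : ZMod (F.q i)) * x ^ (l + 1))]
  simp [hf]

/-- One pass evaluates both polynomials, with the running power of the point in variable `12`. All
residues are reduced at once, so intermediate values stay below `q * q + q`, which is what
`Bounds.q` provides for. -/
theorem shareC_triple (hB : F.Bounds k M S) (hi : i ∈ (F.setup k).support) {P : F.Params i s n}
    {L : ℕ} {m : Mem} (hP : P.Fits L M S) (h : P.Env L m) (u : Fin s → ZMod (F.q i))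
    (h20 : ∀ j : Fin s, m 20 j = (P.coeff u j).val) (I : Fin s ↪ Fin n)
    (hI : ∀ j : Fin s, m 25 j = I j) (j : Fin s) (h13 : m 0 13 = j) :
    Triple shareC m (fun m' => Same [] [12, 14, 15, 16] m m' ∧
      m' 0 15 = (F.share i P.α (P.coeff u) (P.x (I j))).val ∧
      m' 0 16 = (F.share i 0 P.unitVec (P.x (I j))).val) (300 * (S * S)) := by
  have hM := hP.sM
  have hS := hB.size
  have hsS := hP.sS
  have hnM := hP.nM
  have hSS : S ≤ S * S := Nat.le_mul_of_pos_left _ (by omega)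
  have hq2 := (F.prime_q i).two_le
  have hq := hB.q i hi
  have hqM : 3 * F.q i ≤ M := by nlinarith
  have hIj := (I j).2
  have hj := j.2
  set x := P.x (I j) with hx
  have hxq := ZMod.val_lt x
  have hα := ZMod.val_lt P.α
  refine Triple.assign_seq (M := M) (S := S) (K := 290 * (S * S)) ?_ ?_ hS ?_ ?_
  · simp only [Expr.Small]; omega
  · simp only [Expr.Small, Expr.eval, h.α]; omega
  swap
  · simp only [Expr.nodes]; omega
  refine Triple.assign_seq (M := M) (S := S) (K := 280 * (S * S)) ?_ ?_ hS ?_ ?_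
  · simp only [Expr.Small]; omega
  · simp only [Expr.Small]; omega
  swap
  · simp only [Expr.nodes]; omega
  simp only [Expr.eval, h.α]
  set m1 := (m.write 0 15 P.α.val).write 0 16 0 with hm1
  have s1 : Same [] [12, 14, 15, 16] m m1 :=
    (same_write _ _ _).trans (same_write _ _ _) (by simp) (by simp) (by simp) (by simp)
  have hx' : ∀ m', Same [] [12, 14, 15, 16] m m' →
      m' 0 13 = j ∧ m' 25 j = I j ∧ m' 15 (I j) = x.val := by
    intro m' s'
    rw [s'.2 13 (by simp), s'.1 25 (by omega) (by omega) (by simp),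
      s'.1 15 (by omega) (by omega) (by simp)]
    exact ⟨h13, hI j, h.x _⟩
  obtain ⟨x1, x2, x3⟩ := hx' m1 s1
  refine Triple.assign_seq (M := M) (S := S) (K := 270 * (S * S)) ?_ ?_ hS ?_ ?_
  · simp only [Expr.Small]; omega
  · simp only [Expr.Small, Expr.eval, x1, x2, x3]; omega
  swap
  · simp only [Expr.nodes]; omega
  refine Triple.assign_seq (M := M) (S := S) (K := 260 * (S * S)) ?_ ?_ hS ?_ ?_
  · simp only [Expr.Small]; omega
  · simp only [Expr.Small]; omega
  swap
  · simp only [Expr.nodes]; omega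
  simp only [Expr.eval, x1, x2, x3]
  set m2 := (m1.write 0 12 x.val).write 0 14 0 with hm2
  have s2' : Same [] [12, 14] m1 m2 :=
    (same_write _ _ _).trans (same_write _ _ _) (by simp) (by simp) (by simp) (by simp)
  have s2 : Same [] [12, 14, 15, 16] m m2 :=
    s1.trans s2' (by simp) (by simp) (by simp) (by simp)
  have h7 : m2 0 7 = s := by rw [s2.2 7 (by simp), h.card]
  have hv : (V 7).eval m2 = s := h7
  refine Triple.loop (M := M) (S := S) (K := 150 * S)
    (fun l m' => Same [] [12, 14, 15, 16] m m' ∧ m' 0 14 = l ∧ m' 0 12 = (x ^ (l + 1)).val ∧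
      m' 0 15 = (P.α + ∑ l' ∈ Finset.range l, (m 20 l' : ZMod (F.q i)) * x ^ (l' + 1)).val ∧
      m' 0 16 = (0 + ∑ l' ∈ Finset.range l, (m 10 l' : ZMod (F.q i)) * x ^ (l' + 1)).val)
    ?_ hS ?_ ?_ ?_ ?_ ?_
  · simp only [Expr.Small, Expr.eval, h7]
    omega
  · omega
  · refine ⟨s2, by simp [hm2], ?_, ?_, ?_⟩
    · rw [hm2, write_ne _ (by simp), write_same, zero_add, pow_one]
    · rw [s2'.2 15 (by simp), hm1, write_ne _ (by simp), write_same]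
      simp
    · rw [s2'.2 16 (by simp), hm1, write_same]
      simp
  · rw [hv]
    rintro l m3 hl ⟨s3, c14, c12, c15, c16⟩
    set A := P.α + ∑ l' ∈ Finset.range l, (m 20 l' : ZMod (F.q i)) * x ^ (l' + 1) with hA
    set B := 0 + ∑ l' ∈ Finset.range l, (m 10 l' : ZMod (F.q i)) * x ^ (l' + 1) with hB'
    have hAq := ZMod.val_lt A
    have hBq := ZMod.val_lt B
    have hpq := ZMod.val_lt (x ^ (l + 1))
    have h20q : m 20 l ≤ F.q i := by
      rw [h20 ⟨l, hl⟩]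
      exact (ZMod.val_lt _).le
    have h10q : m 10 l ≤ F.q i := by
      rw [h.unitVec ⟨l, hl⟩]
      split_ifs <;> omega
    have b1 : m 20 l * (x ^ (l + 1)).val ≤ F.q i * F.q i := Nat.mul_le_mul h20q hpq.le
    have b2 : m 10 l * (x ^ (l + 1)).val ≤ F.q i * F.q i := Nat.mul_le_mul h10q hpq.le
    have b3 : (x ^ (l + 1)).val * x.val ≤ F.q i * F.q i := Nat.mul_le_mul hpq.le hxq.le
    have c2 : m3 0 2 = F.q i := by rw [s3.2 2 (by simp), h.q]
    have c20 : m3 20 = m 20 := s3.1 20 (by omega) (by omega) (by simp)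
    refine Triple.assign_seq (M := M) (S := S) (K := 130 * S) ?_ ?_ hS ?_ ?_
    · simp only [Expr.Small]; omega
    · simp only [Expr.Small, Expr.eval, c15, c14, c12, c2, c20]
      refine ⟨⟨⟨?_, ?_⟩, ⟨⟨⟨?_, ?_⟩, ?_⟩, ⟨?_, ?_⟩, ?_⟩, ?_⟩, ?_, ?_⟩ <;> omega
    swap
    · simp only [Expr.nodes]; omega
    simp only [Expr.eval, c15, c14, c12, c2, c20]
    rw [val_add_mul]
    set m4 := m3.write 0 15 (A + m 20 l * x ^ (l + 1)).val with hm4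
    have s4' : Same [] [15] m3 m4 := same_write _ _ _
    have s4 : Same [] [12, 14, 15, 16] m m4 :=
      s3.trans s4' (by simp) (by simp) (by simp) (by simp)
    have d14 : m4 0 14 = l := by rw [s4'.2 14 (by simp), c14]
    have d12 : m4 0 12 = (x ^ (l + 1)).val := by rw [s4'.2 12 (by simp), c12]
    have d16 : m4 0 16 = B.val := by rw [s4'.2 16 (by simp), c16]
    have d2 : m4 0 2 = F.q i := by rw [s4.2 2 (by simp), h.q]
    have d10 : m4 10 = m 10 := s4.1 10 (by omega) (by omega) (by simp)
    refine Triple.assign_seq (M := M) (S := S) (K := 100 * S) ?_ ?_ hS ?_ ?_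
    · simp only [Expr.Small]; omega
    · simp only [Expr.Small, Expr.eval, d14, d12, d16, d2, d10]
      refine ⟨⟨⟨?_, ?_⟩, ⟨⟨⟨?_, ?_⟩, ?_⟩, ⟨?_, ?_⟩, ?_⟩, ?_⟩, ?_, ?_⟩ <;> omega
    swap
    · simp only [Expr.nodes]; omega
    simp only [Expr.eval, d14, d12, d16, d2, d10]
    rw [val_add_mul]
    set m5 := m4.write 0 16 (B + m 10 l * x ^ (l + 1)).val with hm5
    have s5' : Same [] [16] m4 m5 := same_write _ _ _
    have s5 : Same [] [12, 14, 15, 16] m m5 :=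
      s4.trans s5' (by simp) (by simp) (by simp) (by simp)
    have e14 : m5 0 14 = l := by rw [s5'.2 14 (by simp), d14]
    have e12 : m5 0 12 = (x ^ (l + 1)).val := by rw [s5'.2 12 (by simp), d12]
    have e2 : m5 0 2 = F.q i := by rw [s5.2 2 (by simp), h.q]
    obtain ⟨y1, y2, y3⟩ := hx' m5 s5
    refine Triple.assign_seq (M := M) (S := S) (K := 50 * S) ?_ ?_ hS ?_ ?_
    · simp only [Expr.Small]; omega
    · simp only [Expr.Small, Expr.eval, e12, e2, y1, y2, y3]
      refine ⟨⟨⟨?_, ?_⟩, ⟨⟨⟨?_, ?_⟩, ?_⟩, ?_⟩, ?_⟩, ?_, ?_⟩ <;> omega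
    swap
    · simp only [Expr.nodes]; omega
    simp only [Expr.eval, e12, e2, y1, y2, y3]
    rw [show (x ^ (l + 1)).val * x.val % F.q i = (x ^ (l + 1 + 1)).val by
      rw [← ZMod.val_natCast, pow_succ x (l + 1)]; simp]
    set m6 := m5.write 0 12 (x ^ (l + 1 + 1)).val with hm6
    have s6' : Same [] [12] m5 m6 := same_write _ _ _
    have s6 : Same [] [12, 14, 15, 16] m m6 :=
      s5.trans s6' (by simp) (by simp) (by simp) (by simp)
    have f14 : m6 0 14 = l := by rw [s6'.2 14 (by simp), e14]
    refine (Triple.assign (M := M) (S := S) ?_ ?_ hS ?_).mono (fun _ h => h) ?_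
    · simp only [Expr.Small]; omega
    · simp only [Expr.Small, Expr.eval, f14]; omega
    · simp only [Expr.eval, f14]
      have s7' := same_write m6 14 (l + 1)
      refine ⟨s6.trans s7' (by simp) (by simp) (by simp) (by simp), by simp, ?_, ?_, ?_⟩
      · rw [s7'.2 12 (by simp), hm6, write_same]
      · rw [s7'.2 15 (by simp), s6'.2 15 (by simp), s5'.2 15 (by simp), hm4, write_same,
          Finset.sum_range_succ, hA, add_assoc]
      · rw [s7'.2 16 (by simp), s6'.2 16 (by simp), hm5, write_same, Finset.sum_range_succ, hB',
          add_assoc]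
    · simp only [Expr.nodes]; omega
  · rw [hv]
    rintro m3 ⟨s3, -, -, c15, c16⟩
    refine ⟨s3, ?_, ?_⟩
    · rw [c15, share_eq_range _ _ (P.coeff u)]
      intro j
      rw [h20, ZMod.natCast_zmod_val]
    · rw [c16, share_eq_range _ _ P.unitVec]
      intro j
      rw [h.unitVec, Params.unitVec]
      split_ifs <;> simp
  · simp only [Expr.nodes]
    nlinarith

/-- Write the reply to the array `b` of the adversary. -/
def outC (F : GroupFamily) (b : ℕ) : Cmd :=
  .seq (.assign (reg 1 b) (.const 0) (V 17)) <| .seq (F.powC 19 17 9) <|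
  .seq (.assign (reg 1 b) (.const 1) (V 19)) <| .seq (setV 13 (.const 0)) <| .loop (V 7) <|
    .seq shareC <| .seq (F.powC 19 17 15) <| .seq (F.powC 12 18 16) <| .seq (F.mulC 19 19 12) <|
    .seq (.assign (reg 1 b) (.add (V 13) (.const 2)) (V 19)) (setV 13 (.add (V 13) (.const 1)))

theorem encReply_length (y : F.Reply i s) : (F.encReply i y).length = s + 2 := by
  simp [encReply]

theorem encReply_getD (y : F.Reply i s) (j : Fin s) (v : ℕ) :
    (F.encReply i y).getD (j + 2) v = F.enc i (y.2.2 j) := by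
  simp [encReply, List.getD_eq_getElem?_getD]

/-- The old entry as default of `getD` is exactly the behaviour of `Mem.writeList`: beyond the
length of the reply the target array keeps its contents. -/
theorem outC_triple (hB : F.Bounds k M S) (hi : i ∈ (F.setup k).support) {P : F.Params i s n}
    {L : ℕ} {m : Mem} (hP : P.Fits L M S) (h : P.Env L m) (u : Fin s → ZMod (F.q i))
    (h20 : ∀ j : Fin s, m 20 j = (P.coeff u j).val) (I : Fin s ↪ Fin n)
    (hI : ∀ j : Fin s, m 25 j = I j) (a b : ZMod (F.q i))
    (h17 : m 0 17 = F.enc i (P.base a b)) (h18 : m 0 18 = F.enc i (P.special a b)) (r : ℕ) :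
    Triple (outC F r) m (fun m' =>
      Same [reg 1 r] [12, 13, 14, 15, 16, 19, 20, 21] m m' ∧
      ∀ p, m' (reg 1 r) p = (F.encReply i (P.answer I a b u)).getD p (m (reg 1 r) p))
      (2000 * (S * S * S)) := by
  have hM := hP.sM
  have hS := hB.size
  have hsS := hP.sS
  have hSS : S ≤ S * S := Nat.le_mul_of_pos_left _ (by omega)
  have hSSS : S * S ≤ S * S * S := Nat.le_mul_of_pos_right _ (by omega)
  have he := hB.enc i hi
  have r0 : reg 1 r ≠ 0 := by simp only [reg]; omega
  have r5 : reg 1 r % 5 = 1 := by simp only [reg]; omega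
  set y := P.answer I a b u with hy
  set l := F.encReply i y with hl
  have l0 : l.getD 0 0 = F.enc i (P.base a b) := by simp [hl, encReply, hy, Params.answer]
  have l1 : l.getD 1 0 = F.enc i (P.base a b ^ P.α.val) := by
    simp [hl, encReply, hy, Params.answer]
  have hA : ∀ a ∈ [reg 1 r], 20 ≤ a ∨ a % 5 ≠ 0 := by
    intro a ha
    rw [List.mem_singleton] at ha
    subst ha
    omega
  refine Triple.assign_seq (M := M) (S := S) (K := 1990 * (S * S * S)) ?_ ?_ hS ?_ ?_
  · simp only [Expr.Small]; omega
  · simp only [Expr.Small, Expr.eval, h17]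
    exact ⟨by omega, he _⟩
  swap
  · simp only [Expr.nodes]; omega
  simp only [Expr.eval, h17]
  set m1 := m.write (reg 1 r) 0 (F.enc i (P.base a b)) with hm1
  have s1 : Same [reg 1 r] [] m m1 := same_write_array _ r0 _ _
  have h1 := h.same s1 hA (by simp)
  refine (powC_env hB hi hP h1 _ P.α (by rw [s1.2 17 (by simp), h17]) h1.α
    (d := 19) (by omega) (by omega) (by omega) (by omega)).seq
    (K' := 1700 * (S * S * S)) ?_ (by omega)
  rintro m2 ⟨s2, d19⟩
  have w2 : m2 (reg 1 r) = m1 (reg 1 r) := s2.1 _ (by omega) r0 (by simp)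
  refine Triple.assign_seq (M := M) (S := S) (K := 1690 * (S * S * S)) ?_ ?_ hS ?_ ?_
  · simp only [Expr.Small]; omega
  · simp only [Expr.Small, Expr.eval, d19]
    exact ⟨by omega, he _⟩
  swap
  · simp only [Expr.nodes]; omega
  refine Triple.assign_seq (M := M) (S := S) (K := 1680 * (S * S * S)) ?_ ?_ hS ?_ ?_
  · simp only [Expr.Small]; omega
  · simp only [Expr.Small]; omega
  swap
  · simp only [Expr.nodes]; omega
  simp only [Expr.eval, d19]
  set m3 := m2.write (reg 1 r) 1 (F.enc i (P.base a b ^ P.α.val)) with hm3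
  set m4 := m3.write 0 13 0 with hm4
  have s3 : Same [reg 1 r] [] m2 m3 := same_write_array _ r0 _ _
  have s4 : Same [] [13] m3 m4 := same_write _ _ _
  have t2 : Same [reg 1 r] [12, 13, 14, 15, 16, 19, 20, 21] m m2 :=
    s1.trans s2 (by simp) (by simp) (by simp) (by simp)
  have t3 : Same [reg 1 r] [12, 13, 14, 15, 16, 19, 20, 21] m m3 :=
    t2.trans s3 (by simp) (by simp) (by simp) (by simp)
  have t4 : Same [reg 1 r] [12, 13, 14, 15, 16, 19, 20, 21] m m4 :=
    t3.trans s4 (by simp) (by simp) (by simp) (by simp)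
  have w4 : ∀ p, m4 (reg 1 r) p = if p < 0 + 2 then l.getD p 0 else m (reg 1 r) p := by
    intro p
    rw [s4.1 _ (by omega) r0 (by simp)]
    rcases p with _ | _ | p
    · rw [if_pos (by omega), l0, hm3, write_ne _ (by simp), w2, hm1, write_same]
    · rw [if_pos (by omega), l1, hm3, write_same]
    · rw [if_neg (by omega), hm3, write_ne _ (by simp), w2, hm1, write_ne _ (by simp)]
  have h7 : m4 0 7 = s := by rw [t4.2 7 (by simp), h.card]
  have hv : (V 7).eval m4 = s := h7
  refine Triple.loop (M := M) (S := S) (K := 1000 * (S * S))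
    (fun j m' => Same [reg 1 r] [12, 13, 14, 15, 16, 19, 20, 21] m m' ∧ m' 0 13 = j ∧
      ∀ p, m' (reg 1 r) p = if p < j + 2 then l.getD p 0 else m (reg 1 r) p)
    ?_ hS ?_ ?_ ?_ ?_ ?_
  · simp only [Expr.Small, Expr.eval, h7]
    omega
  · omega
  · exact ⟨t4, by simp [hm4], w4⟩
  · rw [hv]
    rintro j m5 hj ⟨s5, e13, e⟩
    have h5 := h.same s5 hA (by simp)
    have n20 : (20 : ℕ) ∉ [reg 1 r] := by rw [List.mem_singleton]; omega
    have n25 : (25 : ℕ) ∉ [reg 1 r] := by rw [List.mem_singleton]; omega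
    have e20 : m5 20 = m 20 := s5.1 20 (by omega) (by omega) n20
    have e25 : m5 25 = m 25 := s5.1 25 (by omega) (by omega) n25
    have e17 : m5 0 17 = F.enc i (P.base a b) := by rw [s5.2 17 (by simp), h17]
    have e18 : m5 0 18 = F.enc i (P.special a b) := by rw [s5.2 18 (by simp), h18]
    refine (shareC_triple hB hi hP h5 u (by rw [e20]; exact h20) I (by rw [e25]; exact hI)
      ⟨j, hj⟩ e13).seq (K' := 700 * (S * S)) ?_ (by omega)
    rintro m6 ⟨s6, f15, f16⟩
    have h6 := h5.same s6 (by simp) (by simp)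
    refine (powC_env hB hi hP h6 _ _ (by rw [s6.2 17 (by simp), e17]) f15
      (d := 19) (by omega) (by omega) (by omega) (by omega)).seq (K' := 500 * (S * S)) ?_ (by omega)
    rintro m7 ⟨s7, g19⟩
    have h7 := h6.same s7 (by simp) (by simp)
    refine (powC_env hB hi hP h7 _ _ (by rw [s7.2 18 (by simp), s6.2 18 (by simp), e18])
      (by rw [s7.2 16 (by simp), f16])
      (d := 12) (by omega) (by omega) (by omega) (by omega)).seq (K' := 300 * (S * S)) ?_ (by omega)
    rintro m8 ⟨s8, g12⟩
    have h8 := h7.same s8 (by simp) (by simp)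
    refine (mulC_triple hB hi _ _ h8.desc (by rw [s8.2 19 (by simp), g19]) g12 (by omega)
      (by omega) (by omega)).seq (K' := 200 * (S * S)) ?_ (by omega)
    rintro m9 ⟨s9, g⟩
    have t6 : Same [reg 1 r] [12, 13, 14, 15, 16, 19, 20, 21] m m6 :=
      s5.trans s6 (by simp) (by simp) (by simp) (by simp)
    have u7 : Same [] [12, 13, 14, 15, 16, 19, 20, 21] m5 m7 :=
      s6.trans s7 (by simp) (by simp) (by simp) (by simp)
    have u8 : Same [] [12, 13, 14, 15, 16, 19, 20, 21] m5 m8 :=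
      u7.trans s8 (by simp) (by simp) (by simp) (by simp)
    have u9 : Same [] [12, 13, 14, 15, 16, 19, 20, 21] m5 m9 :=
      u8.trans s9 (by simp) (by simp) (by simp) (by simp)
    have k13 : m9 0 13 = j := by
      rw [s9.2 13 (by simp), s8.2 13 (by simp), s7.2 13 (by simp), s6.2 13 (by simp), e13]
    have kr : m9 (reg 1 r) = m5 (reg 1 r) := u9.1 _ (by omega) r0 (by simp)
    refine Triple.assign_seq (M := M) (S := S) (K := 10 * (S * S)) ?_ ?_ hS ?_ ?_
    · simp only [Expr.Small, Expr.eval, k13]; omega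
    · simp only [Expr.Small, Expr.eval, g]
      exact ⟨by omega, he _⟩
    swap
    · simp only [Expr.nodes]; omega
    simp only [Expr.eval, g, k13]
    set v := F.enc i (P.base a b ^ (F.share i P.α (P.coeff u) (P.x (I ⟨j, hj⟩))).val *
      P.special a b ^ (F.share i 0 P.unitVec (P.x (I ⟨j, hj⟩))).val) with hv'
    have lj : l.getD (j + 2) 0 = v := encReply_getD y ⟨j, hj⟩ 0
    set m10 := m9.write (reg 1 r) (j + 2) v with hm10
    have s10 : Same [reg 1 r] [] m9 m10 := same_write_array _ r0 _ _
    have k13' : m10 0 13 = j := by rw [s10.2 13 (by simp), k13]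
    refine (Triple.assign (M := M) (S := S) ?_ ?_ hS ?_).mono (fun _ h => h) ?_
    · simp only [Expr.Small]; omega
    · simp only [Expr.Small, Expr.eval, k13']; omega
    · simp only [Expr.eval, k13']
      have t9 : Same [reg 1 r] [12, 13, 14, 15, 16, 19, 20, 21] m m9 :=
        s5.trans u9 (by simp) (by simp) (by simp) (by simp)
      have t10 : Same [reg 1 r] [12, 13, 14, 15, 16, 19, 20, 21] m m10 :=
        t9.trans s10 (by simp) (by simp) (by simp) (by simp)
      refine ⟨t10.trans (same_write _ _ _) (by simp) (by simp) (by simp) (by simp), by simp, ?_⟩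
      intro p
      rw [write_array_ne _ r0]
      by_cases hp : p = j + 2
      · rw [hp, hm10, write_same, if_pos (by omega), lj]
      · rw [hm10, write_ne _ (fun _ => hp), kr, e]
        by_cases hp' : p < j + 2
        · rw [if_pos hp', if_pos (by omega)]
        · rw [if_neg hp', if_neg (by omega)]
    · simp only [Expr.nodes]; omega
  · rw [hv]
    rintro m5 ⟨s5, -, e⟩
    refine ⟨s5, fun p => ?_⟩
    have hlen : l.length = s + 2 := encReply_length y
    rw [e]
    split_ifs with hp
    · rw [List.getD_eq_getElem _ _ (by omega), List.getD_eq_getElem _ _ (by omega)]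
    · rw [List.getD_eq_default _ _ (by omega)]
  · simp only [Expr.nodes]
    nlinarith

/-- The subprogram that stands for an oracle call. -/
def simC (F : GroupFamily) (a b : ℕ) : Cmd :=
  .seq (validC a) <| .ite (V 12)
    (.seq (.rand 0 (.const 15) (V 2)) <| .seq (.rand 0 (.const 16) (V 2)) <|
      .seq (fillC 20 7) <| .seq mergeC <| .seq (baseC F) (outC F b))
    .skip

end GroupFamily
-- Correctness and cost of the simulated oracle
namespace GroupFamily

variable {F : GroupFamily} {k M S : ℕ} {i : F.Inst} {s n : ℕ}

theorem valid_iff (f : ℕ → ℕ) :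
    (∀ j < s, f j < n ∧ ∀ l < j, f l ≠ f j) ↔ ∃ I : Fin s ↪ Fin n, ∀ j : Fin s, f j = I j := by
  constructor
  · intro h
    refine ⟨⟨fun j => ⟨f j, (h j j.2).1⟩, fun a b hab => ?_⟩, fun j => rfl⟩
    have hab' : f a = f b := congrArg Fin.val hab
    rcases lt_trichotomy (a : ℕ) b with h1 | h1 | h1
    · exact absurd hab' ((h b b.2).2 a h1)
    · exact Fin.ext h1
    · exact absurd hab'.symm ((h a a.2).2 b h1)
  · rintro ⟨I, hI⟩ j hj
    refine ⟨by rw [hI ⟨j, hj⟩]; exact (I _).2, fun l hl hlj => ?_⟩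
    rw [hI ⟨j, hj⟩, hI ⟨l, hl.trans hj⟩] at hlj
    have := I.injective (Fin.ext hlj)
    rw [Fin.mk.injEq] at this
    omega

/-- Once nested draws are flattened, `kernel` draws `a`, `b`, `u` in the same order as the program;
the remaining commands are covered by `Triple` statements. That replies consist of representations
of group elements is recorded to bound their size. -/
theorem simC_sampled (hB : F.Bounds k M S) (hi : i ∈ (F.setup k).support) {P : F.Params i s n}
    {L : ℕ} (hP : P.Fits L M S) (henc : ∀ y, 2 * F.enc i y ≤ M) {B : ℕ} {m m' : Mem} {a b : ℕ}
    (haB : a < B) (hrow : ∀ j, 2 * m a j ≤ M) (hv : View (reg 1) B m m') (hE : P.Env L m') :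
    Sampled (simC F a b) m' (F.toOracle i s n P.kernel (m a))
      (fun l m'' => (View (reg 1) B (m.writeList b l) m'' ∧ P.Env L m'') ∧
        ∀ v ∈ l, ∃ y, v = F.enc i y) (10000 * (S * S * S)) := by
  have hM := hP.sM
  have hnM := hP.nM
  have hS := hB.size
  have hSS : S ≤ S * S := Nat.le_mul_of_pos_left _ (by omega)
  have hSSS : S * S ≤ S * S * S := Nat.le_mul_of_pos_right _ (by omega)
  have hr : ∀ {A l : List ℕ} {m1 m2 : Mem}, Same A l m1 m2 → (∀ c, reg 1 c ∉ A) →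
      ∀ c, m2 (reg 1 c) = m1 (reg 1 c) := fun h hA c =>
    h.1 _ (by simp only [reg]; omega) (by simp only [reg]; omega) (hA c)
  refine Sampled.seq_left (validC_triple hM hS hE.card hE.points (by omega) hP.sS (m a) (hv a haB)
    hrow) (K' := 9000 * (S * S * S)) ?_ (by omega)
  rintro m1 ⟨s1, h25, h12, hok⟩
  have hE1 := hE.same s1 (by simp) (by simp)
  rw [valid_iff] at hok
  have v1 : ∀ c, m1 (reg 1 c) = m' (reg 1 c) :=
    hr s1 fun c => by simp only [reg, List.mem_singleton]; omega
  refine Sampled.ite (M := M) (S := S) (K := 8000 * (S * S * S)) ?_ hS ?_ ?_ ?_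
  · simp only [Expr.Small, Expr.eval]
    omega
  · intro hne
    have h : ∃ I : Fin s ↪ Fin n, ∀ j : Fin s, m a j = I j := hok.1 hne
    rw [toOracle, dif_pos h]
    simp only [Params.kernel, PMF.bind_bind, PMF.pure_bind]
    have hI := h.choose_spec
    set I := h.choose
    refine (rand_sampled hB hi (a := 0) (e := .const 15) ?_ hE1.q).seq
      (K' := 7000 * (S * S * S)) ?_ ?_
    · simp only [Expr.Small]; omega
    swap
    · simp only [Expr.nodes]; omega
    rintro x m2 rfl
    have s2 := same_write m1 15 x.val
    simp only [Expr.eval]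
    set m2 := m1.write 0 15 x.val with hm2
    have hE2 := hE1.same s2 (by simp) (by simp)
    refine (rand_sampled hB hi (a := 0) (e := .const 16) ?_ hE2.q).seq
      (K' := 6000 * (S * S * S)) ?_ ?_
    · simp only [Expr.Small]; omega
    swap
    · simp only [Expr.nodes]; omega
    rintro y m3 rfl
    have s3 := same_write m2 16 y.val
    simp only [Expr.eval]
    set m3 := m2.write 0 16 y.val with hm3
    have hE3 := hE2.same s3 (by simp) (by simp)
    refine (fillC_sampled hB hi (a := 20) (N := 7) (by omega) hE3.q hE3.card (by omega) hP.sS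
      hM).seq (K' := 5000 * (S * S * S)) ?_ (by omega)
    rintro u m4 ⟨s4, h20⟩
    have hE4 := hE3.same s4 (by simp) (by simp)
    refine Triple.sampled ?_
    refine (mergeC_triple hB hi hP hE4 u h20).seq (K' := 4500 * (S * S * S)) ?_ (by omega)
    rintro m5 ⟨s5, h20⟩
    have hE5 := hE4.same s5 (by simp) (by simp)
    have h15 : m5 0 15 = x.val := by
      rw [s5.2 15 (by simp), s4.2 15 (by simp), s3.2 15 (by simp), hm2, write_same]
    have h16 : m5 0 16 = y.val := by
      rw [s5.2 16 (by simp), s4.2 16 (by simp), hm3, write_same]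
    refine (baseC_triple hB hi hP hE5 x y h15 h16 henc).seq (K' := 2000 * (S * S * S)) ?_ (by omega)
    rintro m6 ⟨s6, h17, h18⟩
    have hE6 := hE5.same s6 (by simp) (by simp)
    have t5 : Same [20] [12, 13, 14, 15, 16, 17, 18, 19, 20, 21] m1 m5 :=
      ((s2.trans (B := [20]) (k := [15, 16]) s3 (by simp) (by simp) (by simp) (by simp)).trans
        (B := [20]) (k := [13, 15, 16]) s4 (by simp) (by simp) (by simp) (by simp)).trans s5
        (by simp) (by simp) (by simp) (by simp)
    have t6 : Same [20] [12, 13, 14, 15, 16, 17, 18, 19, 20, 21] m1 m6 :=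
      t5.trans s6 (by simp) (by simp) (by simp) (by simp)
    refine (outC_triple hB hi hP hE6 u ?_ I ?_ x y h17 h18 b).mono ?_ (by omega)
    · rw [s6.1 20 (by omega) (by omega) (by simp)]
      exact h20
    · intro j
      rw [t6.1 25 (by omega) (by omega) (by simp), h25 j j.2, hI]
    rintro m7 ⟨s7, hw⟩
    have v6 : ∀ c, m6 (reg 1 c) = m1 (reg 1 c) :=
      hr t6 fun c => by simp only [reg, List.mem_singleton]; omega
    refine ⟨⟨fun c hc => ?_, hE6.same s7 ?_ (by simp)⟩, ?_⟩
    · funext p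
      simp only [Mem.writeList]
      split_ifs with hcb
      · subst hcb
        rw [hw, v6, v1, hv c hc]
      · rw [s7.1 _ (by simp only [reg]; omega) (by simp only [reg]; omega)
          (by simpa [(reg_injective 1).eq_iff] using hcb), v6, v1, hv c hc]
    · intro a ha
      rw [List.mem_singleton] at ha
      subst ha
      simp only [reg]
      omega
    · intro v hv
      simp only [encReply, List.mem_cons, List.mem_ofFn] at hv
      rcases hv with rfl | rfl | ⟨j, rfl⟩
      exacts [⟨_, rfl⟩, ⟨_, rfl⟩, ⟨_, rfl⟩]
  · intro he
    have h : ¬ ∃ I : Fin s ↪ Fin n, ∀ j : Fin s, m a j = I j := fun h => hok.2 h he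
    rw [toOracle, dif_neg h]
    refine Triple.sampled ((Triple.skip ?_).mono (fun _ h => h) (by omega))
    refine ⟨⟨fun c hc => ?_, hE1⟩, by simp⟩
    rw [Mem.writeList_nil, v1, hv c hc]
  · simp only [Expr.nodes]; omega

/-- The bounds hold for all sufficiently large numbers. -/
def Large (k : ℕ) (P : F.Params i s n) (L E : ℕ) : Prop :=
  ∀ S, E ≤ S → F.Bounds k (2 ^ (S - 2)) S ∧ P.Fits L (2 ^ (S - 2)) S ∧
    ∀ y, 2 * F.enc i y ≤ 2 ^ (S - 2)

/-- The adversary's entries may reach `2 ^ S`, and their doubles must fit under the common bound.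
The bounds are therefore taken at `S + E + 3`, where they hold because this is at least `E`, and the
cost becomes a cubic polynomial in `S + E`. -/
theorem simulates_kernel (hi : i ∈ (F.setup k).support) {P : F.Params i s n} {L E : ℕ}
    (hE : Large k P L E) (B : ℕ) :
    Simulates (F.toOracle i s n P.kernel) (reg 1) (simC F) B (F.bound.eval k) (P.Env L)
      (fun S => 10000 * ((S + E + 3) * (S + E + 3) * (S + E + 3))) := by
  intro a ha b hb m m' S _ hm hv hJ
  obtain ⟨h1, h2, h3⟩ := hE (S + E + 3) (by omega)
  refine Lift.mono (simC_sampled h1 hi h2 h3 (b := b) ha (fun j => ?_) hv hJ) ?_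
  · have : m a j < 2 ^ S := Nat.size_le.1 (hm a ha j)
    have h4 : 2 ^ (S + E + 3 - 2) = 2 * 2 ^ S * 2 ^ E := by
      rw [show S + E + 3 - 2 = 1 + S + E by omega, pow_add, pow_add, pow_one]
    have := Nat.one_le_two_pow (n := E)
    rw [h4]
    nlinarith
  · rintro l - z - ⟨⟨⟨h1, h2⟩, h3⟩, h4⟩
    refine ⟨h1, h2, h4, fun v hv => ?_⟩
    obtain ⟨y, rfl⟩ := h3 v hv
    exact F.enc_size k i hi y

/-- Simulation of a program that interacts with the simulated oracle. -/
theorem lift_simC (hi : i ∈ (F.setup k).support) {P : F.Params i s n} {L E : ℕ}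
    (hE : Large k P L E) (A : Cmd) {B : ℕ} (hA : A.width ≤ B) {m m' : Mem} (hv : View (reg 1) B m m')
    (hP : P.Env L m') {S : ℕ} (hS : F.bound.eval k ≤ S) (hm : SizeLe B m S) :
    Lift (SimRel (reg 1) B (P.Env L)
        (fun S => 10000 * ((S + E + 3) * (S + E + 3) * (S + E + 3))) S)
      (A.exec (F.toOracle i s n P.kernel) m)
      ((A.subst (reg 1) (simC F)).exec noOracle m') := by
  refine Cmd.lift_subst (reg_injective 1) (simulates_kernel hi hE B) ?_ (fun S => ?_) ?_ ?_ A hA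
    m m' S hS hm hv hP
  · intro x y hxy
    simp only
    gcongr
  · have : 1 ≤ (S + E + 3) * (S + E + 3) * (S + E + 3) := Nat.pos_of_ne_zero (by positivity)
    omega
  -- The adversary's arrays have numbers congruent to `1` modulo `5` and so avoid the parameters.
  · intro m a j v h
    exact h.same (same_write_array m (by simp only [reg]; omega) j v)
      (by simp only [List.mem_singleton, forall_eq, reg]; omega) (by simp)
  · intro m a h
    refine h.same (A := [reg 1 a]) (l := []) ⟨fun b _ _ hb => ?_, fun j _ => ?_⟩
      (by simp only [List.mem_singleton, forall_eq, reg]; omega) (by simp)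
    · rw [List.mem_singleton] at hb
      funext j
      simp [Mem.clear, hb]
    · have : 0 ≠ reg 1 a := by simp only [reg]; omega
      simp [Mem.clear, this]

end GroupFamily
-- The reduction as a program
theorem Triple.assign_cost {m : Mem} {Q : Mem → Prop} {a : ℕ} {e f : Expr}
    (hQ : Q (m.write a (e.eval m) (f.eval m))) :
    Triple (.assign a e f) m Q (e.cost m + f.cost m + 1) := by
  intro z hz
  simp only [Cmd.exec, PMF.support_pure, Set.mem_singleton_iff] at hz
  subst hz
  exact ⟨hQ, le_rfl⟩

/-- Polynomials in the variable `0` can be evaluated in polynomial time. -/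
theorem exists_expr_polynomial (p : Polynomial ℕ) : ∃ (e : Expr) (P : Polynomial ℕ), ∀ m : Mem,
    e.eval m = p.eval (m 0 0) ∧ e.cost m ≤ P.eval (m 0 0) := by
  have hsize : ∀ n : ℕ, n.size ≤ n := fun n => Nat.size_le.2 Nat.lt_two_pow_self
  induction p using Polynomial.induction_on' with
  | add p q hp hq =>
    obtain ⟨e, P, h⟩ := hp
    obtain ⟨f, Q, h'⟩ := hq
    refine ⟨.add e f, P + Q + (1 + (p + q)), fun m => ?_⟩
    have h1 := h m
    have h2 := h' m
    have := hsize ((p + q).eval (m 0 0))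
    simp only [Expr.eval, Expr.cost, Polynomial.eval_add, Polynomial.eval_one, h1.1, h2.1] at *
    exact ⟨trivial, by omega⟩
  | monomial d c =>
    induction d with
    | zero =>
      refine ⟨.const c, Polynomial.C (1 + c), fun m => ?_⟩
      have := hsize c
      simp only [Expr.eval, Expr.cost, Polynomial.monomial_zero_left, Polynomial.eval_C]
      exact ⟨trivial, by omega⟩
    | succ d ih =>
      obtain ⟨e, P, h⟩ := ih
      refine ⟨.mul e (V 0), P + (2 + Polynomial.X + (1 + Polynomial.monomial (d + 1) c)),
        fun m => ?_⟩
      have h1 := h m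
      have := hsize (m 0 0)
      have := hsize ((Polynomial.monomial (d + 1) c).eval (m 0 0))
      have e2 : (2 : Polynomial ℕ).eval (m 0 0) = 2 := Polynomial.eval_ofNat 2 _
      simp only [Expr.eval, Expr.cost, Polynomial.eval_add, Polynomial.eval_one,
        Polynomial.eval_X, h1.1, Polynomial.eval_monomial, e2] at *
      rw [pow_succ, ← mul_assoc] at *
      refine ⟨rfl, ?_⟩
      simp only [Nat.size_zero]
      omega

/-- Run a program on the argument in the variable `0`. -/
def runC (r : ℕ) (c : Cmd) : Cmd :=
  .seq (.assign (reg r 0) (.const 0) (V 0)) (c.subst (reg r) fun _ _ => .skip)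

theorem runC_triple {r : ℕ} (hr : r < 5) {c : Cmd} {m : Mem} {k v K : ℕ}
    (hc : ∀ z ∈ (c.exec noOracle (inputMem [k])).support, output z.1 = v ∧ z.2 ≤ K)
    (hk : m 0 0 = k) (hm : ∀ a, m (reg r a) = fun _ => 0) :
    Triple (runC r c) m (fun m' => (∀ a, a % 5 ≠ r → m' a = m a) ∧ m' (reg r 1) 0 = v)
      (10 + k + K) := by
  refine (Triple.assign_cost (Q := fun m' => m' = m.write (reg r 0) 0 k) ?_).seq (K' := K) ?_ ?_
  · simp only [Expr.eval, hk]
  · rintro m1 rfl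
    intro z hz
    have hv : View (reg r) (c.width + 2) (inputMem [k]) (m.write (reg r 0) 0 k) := by
      intro a _
      funext j
      simp only [Mem.write, (reg_injective r).eq_iff, hm, inputMem]
      rcases j with _ | j <;> by_cases h : a = 0 <;> simp [h]
    obtain ⟨x, hx, h1, h2, h3⟩ :=
      (Cmd.lift_rename (reg_injective r) c (Nat.le_add_right _ 2) _ _ hv).exists_left hz
    have := hc x hx
    refine ⟨⟨fun a ha => ?_, ?_⟩, by omega⟩
    · rw [h2 a, write_array_ne]
      · simp only [reg]; omega
      · rintro ⟨b, rfl⟩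
        simp only [reg] at ha
        omega
    · rw [h1 1 (by omega)]
      exact this.1
  · have : k.size ≤ k := Nat.size_le.2 Nat.lt_two_pow_self
    simp only [Expr.cost, Expr.eval, hk, Nat.size_zero]
    omega

namespace GroupFamily

variable {F : GroupFamily} {k M S : ℕ} {i : F.Inst} {s n : ℕ}

/-- Write the input of the adversary. -/
def inputC : Cmd :=
  .seq (.assign (reg 1 0) (.const 0) (V 0)) <| .seq (.assign (reg 1 0) (.const 1) (V 1)) <|
  .seq (.assign (reg 1 0) (.const 2) (V 2)) <| .seq (.assign (reg 1 0) (.const 3) (V 3)) <|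
  .seq (.assign (reg 1 0) (.const 4) (V 12)) <|
  .seq (.assign (reg 1 0) (.const 5) (.add (V 7) (.const 1))) <|
  .seq (.assign (reg 1 0) (.const 6) (V 8)) <|
  .seq (setV 13 (.const 0)) <| .loop (V 8) <|
    .seq (.assign (reg 1 0) (.add (V 13) (.const 7)) (.get 15 (V 13)))
      (setV 13 (.add (V 13) (.const 1)))

theorem inputC_triple (hB : F.Bounds k M S) (hi : i ∈ (F.setup k).support) {P : F.Params i s n}
    {L : ℕ} {m : Mem} (hP : P.Fits L M S) (h : P.Env L m) (hk : m 0 0 = k) (hkM : k ≤ M)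
    (y : F.G i) (h12 : m 0 12 = F.enc i y) (hm : m (reg 1 0) = fun _ => 0) :
    Triple inputC m (fun m' => Same [reg 1 0] [13] m m' ∧
      m' (reg 1 0) = F.gameInput k i (s + 1) n y P.x 0) (200 * (S * S)) := by
  have hM := hP.sM
  have hS := hB.size
  have hnS := hP.nS
  have hnM := hP.nM
  have hSS : S ≤ S * S := Nat.le_mul_of_pos_left _ (by omega)
  have he := hB.enc i hi
  have hd := hB.desc i hi
  have hq := hB.q i hi
  have hq2 := (F.prime_q i).two_le
  have hqM : F.q i ≤ M := by nlinarith
  have r0 : 0 ≠ reg 1 0 := by simp only [reg]; omega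
  have r0' : reg 1 0 ≠ 0 := r0.symm
  set l := k :: F.desc i :: F.q i :: F.enc i (F.gen i) :: F.enc i y :: (s + 1) :: n ::
    List.ofFn fun j => (P.x j).val with hl
  have hll : l.length = n + 7 := by simp [hl]
  have hlx : ∀ j : Fin n, l.getD (j + 7) 0 = (P.x j).val := fun j => by
    simp [hl, List.getD_eq_getElem?_getD]
  have hgoal : F.gameInput k i (s + 1) n y P.x 0 = fun j => l.getD j 0 := by
    funext j
    simp [gameInput, inputMem, hl]
  have hen := he y
  have heg := he (F.gen i)
  refine Triple.assign_seq (M := M) (S := S) (K := 190 * (S * S)) ?_ ?_ hS ?_ ?_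
  · simp only [Expr.Small]; omega
  · simp only [Expr.Small, Expr.eval, hk]; omega
  swap
  · simp only [Expr.nodes]; omega
  refine Triple.assign_seq (M := M) (S := S) (K := 180 * (S * S)) ?_ ?_ hS ?_ ?_
  · simp only [Expr.Small]; omega
  · simp only [Expr.Small, Expr.eval, write_array_ne _ r0, h.desc]; omega
  swap
  · simp only [Expr.nodes]; omega
  refine Triple.assign_seq (M := M) (S := S) (K := 170 * (S * S)) ?_ ?_ hS ?_ ?_
  · simp only [Expr.Small]; omega
  · simp only [Expr.Small, Expr.eval, write_array_ne _ r0, h.q]; omega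
  swap
  · simp only [Expr.nodes]; omega
  refine Triple.assign_seq (M := M) (S := S) (K := 160 * (S * S)) ?_ ?_ hS ?_ ?_
  · simp only [Expr.Small]; omega
  · simp only [Expr.Small, Expr.eval, write_array_ne _ r0, h.gen]; omega
  swap
  · simp only [Expr.nodes]; omega
  refine Triple.assign_seq (M := M) (S := S) (K := 150 * (S * S)) ?_ ?_ hS ?_ ?_
  · simp only [Expr.Small]; omega
  · simp only [Expr.Small, Expr.eval, write_array_ne _ r0, h12]; omega
  swap
  · simp only [Expr.nodes]; omega
  refine Triple.assign_seq (M := M) (S := S) (K := 140 * (S * S)) ?_ ?_ hS ?_ ?_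
  · simp only [Expr.Small]; omega
  · simp only [Expr.Small, Expr.eval, write_array_ne _ r0, h.card]; omega
  swap
  · simp only [Expr.nodes]; omega
  refine Triple.assign_seq (M := M) (S := S) (K := 130 * (S * S)) ?_ ?_ hS ?_ ?_
  · simp only [Expr.Small]; omega
  · simp only [Expr.Small, Expr.eval, write_array_ne _ r0, h.points]; omega
  swap
  · simp only [Expr.nodes]; omega
  refine Triple.assign_seq (M := M) (S := S) (K := 120 * (S * S)) ?_ ?_ hS ?_ ?_
  · simp only [Expr.Small]; omega
  · simp only [Expr.Small]; omega
  swap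
  · simp only [Expr.nodes]; omega
  simp only [Expr.eval, write_array_ne _ r0, hk, h.desc, h.q, h.gen, h12, h.card, h.points]
  generalize hm1 : (((((((m.write (reg 1 0) 0 k).write (reg 1 0) 1 (F.desc i)).write (reg 1 0) 2
    (F.q i)).write (reg 1 0) 3 (F.enc i (F.gen i))).write (reg 1 0) 4 (F.enc i y)).write
    (reg 1 0) 5 (s + 1)).write (reg 1 0) 6 n) = m1
  have s1 : Same [reg 1 0] [] m m1 := by
    refine ⟨fun a _ _ ha => ?_, fun j _ => ?_⟩
    · rw [List.mem_singleton] at ha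
      simp only [← hm1, write_array_ne _ ha]
    · simp only [← hm1, write_array_ne _ r0]
  have w1 : ∀ p, m1 (reg 1 0) p = if p < 7 then l.getD p 0 else 0 := by
    intro p
    rw [← hm1]
    simp only [Mem.write, hm]
    rcases p with _ | _ | _ | _ | _ | _ | _ | p <;> simp [hl]
  set m2 := m1.write 0 13 0 with hm2
  have s2' : Same [] [13] m1 m2 := same_write _ _ _
  have s2 : Same [reg 1 0] [13] m m2 := s1.trans s2' (by simp) (by simp) (by simp) (by simp)
  have h8 : m2 0 8 = n := by rw [s2.2 8 (by simp), h.points]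
  have hv : (V 8).eval m2 = n := h8
  refine Triple.loop (M := M) (S := S) (K := 50 * S)
    (fun j m' => Same [reg 1 0] [13] m m' ∧ m' 0 13 = j ∧
      ∀ p, m' (reg 1 0) p = if p < j + 7 then l.getD p 0 else 0)
    ?_ hS ?_ ?_ ?_ ?_ ?_
  · simp only [Expr.Small, Expr.eval, h8]
    omega
  · omega
  · refine ⟨s2, by simp [hm2], fun p => ?_⟩
    rw [hm2, write_array_ne _ r0', w1, Nat.zero_add]
  · rw [hv]
    rintro j m3 hj ⟨s3, h13, hw⟩
    have hx : m3 15 j = (P.x ⟨j, hj⟩).val := by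
      rw [s3.1 15 (by omega) (by omega) (by simp [reg])]
      exact h.x ⟨j, hj⟩
    have hxq := ZMod.val_lt (P.x ⟨j, hj⟩)
    refine Triple.assign_seq (M := M) (S := S) (K := 20 * S) ?_ ?_ hS ?_ ?_
    · simp only [Expr.Small, Expr.eval, h13]; omega
    · simp only [Expr.Small, Expr.eval, h13, hx]; omega
    swap
    · simp only [Expr.nodes]; omega
    simp only [Expr.eval, h13, hx]
    set m4 := m3.write (reg 1 0) (j + 7) (P.x ⟨j, hj⟩).val with hm4
    have s4' : Same [reg 1 0] [] m3 m4 := same_write_array _ r0' _ _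
    have s4 : Same [reg 1 0] [13] m m4 := s3.trans s4' (by simp) (by simp) (by simp) (by simp)
    have k13 : m4 0 13 = j := by rw [s4'.2 13 (by simp), h13]
    refine (Triple.assign (M := M) (S := S) ?_ ?_ hS ?_).mono (fun _ h => h) ?_
    · simp only [Expr.Small]; omega
    · simp only [Expr.Small, Expr.eval, k13]; omega
    · simp only [Expr.eval, k13]
      refine ⟨s4.trans (same_write _ _ _) (by simp) (by simp) (by simp) (by simp), by simp,
        fun p => ?_⟩
      rw [write_array_ne _ r0']
      by_cases hp : p = j + 7
      · rw [hp, hm4, write_same, if_pos (by omega)]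
        exact (hlx ⟨j, hj⟩).symm
      · rw [hm4, write_ne _ (fun _ => hp), hw]
        by_cases hp' : p < j + 7
        · rw [if_pos hp', if_pos (by omega)]
        · rw [if_neg hp', if_neg (by omega)]
    · simp only [Expr.nodes]; omega
  · rw [hv, hgoal]
    rintro m3 ⟨s3, -, hw⟩
    refine ⟨s3, funext fun p => ?_⟩
    rw [hw]
    split_ifs with hp
    · rfl
    · rw [List.getD_eq_default _ _ (by omega)]
  · simp only [Expr.nodes]
    nlinarith

/-- The distinguisher that runs the adversary `A`; the programs `ct` and `cn` compute the
threshold and the number of points, and `e` the length of exponentiation loops. -/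
def reduction (F : GroupFamily) (A ct cn : Cmd) (e : Expr) : Cmd :=
  .seq (runC 3 ct) <| .seq (runC 4 cn) <|
  .seq (setV 7 (.sub (.get (reg 3 1) (.const 0)) (.const 1))) <|
  .seq (setV 8 (.get (reg 4 1) (.const 0))) <| .seq (setV 11 e) <|
  .seq (.rand 0 (.const 10) (V 7)) <| .seq (.rand 0 (.const 9) (V 2)) <|
  .seq (fillC 5 7) <| .seq (fillC 15 8) <|
  .seq (.assign 5 (V 10) (.const 0)) <| .seq (.assign 10 (V 10) (.const 1)) <|
  .seq (F.powC 12 3 9) <| .seq inputC <|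
  .seq (A.subst (reg 1) (simC F)) (.assign 1 (.const 0) (.get (reg 1 1) (.const 0)))

/-- The parameters chosen by the reduction. -/
def redParams (X Y Z : F.G i) (l : ℕ) (α : ZMod (F.q i)) (c : Fin s → ZMod (F.q i))
    (x : Fin n → ZMod (F.q i)) : F.Params i s n where
  X := X
  Y := Y
  Z := Z
  α := α
  l := l
  c := fun j => if (j : ℕ) = l then 0 else c j
  x := x

/-- The decision of the reduction. -/
noncomputable def redDist (F : GroupFamily) (A : Cmd) (k : ℕ) (i : F.Inst) (s n : ℕ)
    (X Y Z : F.G i) : PMF Bool :=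
  (uniformBelow s).bind fun l => (F.unif i).bind fun α => (F.unifVec i s).bind fun c =>
    (F.unifVec i n).bind fun x =>
      (A.exec (F.toOracle i s n (redParams X Y Z l α c x).kernel)
        (F.gameInput k i (s + 1) n (F.gpow i α) x)).map fun z => outputBit z.1

-- One number `S` bounds the adversary's time, the lengths of all numbers and the parameters. The
-- time bound `hA` ranges over all reply distributions `R` because the adversary here talks to
-- `kernel`, which in general is neither oracle of the game.
set_option maxHeartbeats 1000000 in
theorem reduction_sampled (hi : i ∈ (F.setup k).support) {A ct cn : Cmd} {e : Expr} {L : ℕ}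
    (hE : ∀ P : F.Params i s n, P.l ≤ s → Large k P L S)
    {pt pn : ℕ} (hS : 2 * k + pt + pn + 50 ≤ S)
    (hct : ∀ z ∈ (ct.exec noOracle (inputMem [k])).support, output z.1 = s + 1 ∧ z.2 ≤ pt)
    (hcn : ∀ z ∈ (cn.exec noOracle (inputMem [k])).support, output z.1 = n ∧ z.2 ≤ pn)
    (he : ∀ m : Mem, m 0 0 = k → e.eval m = L ∧ e.cost m ≤ S)
    (hA : ∀ (h : F.G i) (x : Fin n → ZMod (F.q i)) (R : (Fin s ↪ Fin n) → PMF (F.Reply i s)),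
      ∀ z ∈ (A.exec (F.toOracle i s n R) (F.gameInput k i (s + 1) n h x)).support, z.2 ≤ S)
    (X Y Z : F.G i) :
    Sampled (reduction F A ct cn e) (F.ddhInput k i X Y Z) (redDist F A k i s n X Y Z)
      (fun b m' => outputBit m' = b)
      (S * (10000 * ((S + S + 3) * (S + S + 3) * (S + S + 3))) + 2000 * (S * S)) := by
  set KA := S * (10000 * ((S + S + 3) * (S + S + 3) * (S + S + 3))) with hKA
  have hP0 := hE (redParams X Y Z 0 0 (fun _ => 0) (fun _ => 0)) (Nat.zero_le _) S le_rfl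
  have hB := hP0.1
  have henc := hP0.2.2
  set M := 2 ^ (S - 2) with hMdef
  have hFit : ∀ P : F.Params i s n, P.l ≤ s → P.Fits L M S := fun P hP => (hE P hP S le_rfl).2.1
  have hM := hP0.2.1.sM
  have hnM := hP0.2.1.nM
  have hsS := hP0.2.1.sS
  have hnS := hP0.2.1.nS
  have hSz := hB.size
  have hq := hB.q i hi
  have hqM : F.q i ≤ M := (Nat.le_add_left _ _).trans hq
  have hd := hB.desc i hi
  have hkM : k ≤ M := by
    have : k < 2 ^ k := Nat.lt_two_pow_self
    have : 2 ^ k ≤ M := Nat.pow_le_pow_right (by omega) (by omega)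
    omega
  have hSS : 50 * S ≤ S * S := Nat.mul_le_mul_right S (by omega)
  set m0 := F.ddhInput k i X Y Z with hm0
  have z0 : ∀ a, a ≠ 0 → m0 a = fun _ => 0 := by
    intro a ha
    funext j
    simp [hm0, ddhInput, inputMem, ha]
  refine Sampled.seq_left (runC_triple (r := 3) (by omega) hct (m := m0) rfl
    fun a => z0 _ (by simp only [reg]; omega)) (K' := KA + 1950 * (S * S)) ?_ (by omega)
  rintro m1 ⟨s1, o1⟩
  refine Sampled.seq_left (runC_triple (r := 4) (by omega) hcn (m := m1)
    (by rw [s1 0 (by omega)]; rfl) fun a => ?_) (K' := KA + 1900 * (S * S)) ?_ (by omega)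
  · rw [s1 _ (by simp only [reg]; omega)]
    exact z0 _ (by simp only [reg]; omega)
  rintro m2 ⟨s2, o2⟩
  have o1' : m2 (reg 3 1) 0 = s + 1 := by rw [s2 _ (by simp only [reg]; omega), o1]
  have s12 : ∀ a, a % 5 ≠ 3 → a % 5 ≠ 4 → m2 a = m0 a := fun a h3 h4 => by rw [s2 a h4, s1 a h3]
  refine Sampled.assign_seq (M := M) (S := S) (K := KA + 1890 * (S * S)) ?_ ?_ hSz ?_ ?_
  · simp only [Expr.Small]; omega
  · simp only [Expr.Small, Expr.eval, o1']; omega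
  swap
  · simp only [Expr.nodes]; omega
  simp only [Expr.eval, o1', Nat.add_sub_cancel]
  set m3 := m2.write 0 7 s with hm3
  have s3 : Same [] [7] m2 m3 := same_write _ _ _
  have o3 : m3 (reg 4 1) 0 = n := by
    rw [s3.1 _ (by simp only [reg]; omega) (by simp only [reg]; omega) (by simp), o2]
  refine Sampled.assign_seq (M := M) (S := S) (K := KA + 1880 * (S * S)) ?_ ?_ hSz ?_ ?_
  · simp only [Expr.Small]; omega
  · simp only [Expr.Small, Expr.eval, o3]; omega
  swap
  · simp only [Expr.nodes]; omega
  simp only [Expr.eval, o3]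
  set m4 := m3.write 0 8 n with hm4
  have s4 : Same [] [8] m3 m4 := same_write _ _ _
  have t4 : Same [] [7, 8] m2 m4 := s3.trans s4 (by simp) (by simp) (by simp) (by simp)
  have k4 : m4 0 0 = k := by rw [t4.2 0 (by simp), s12 0 (by omega) (by omega)]; rfl
  refine Sampled.seq_left (Triple.assign_cost (Q := fun m' => m' = m4.write 0 11 L) ?_)
    (K' := KA + 1860 * (S * S)) ?_ ?_
  · simp only [Expr.eval, (he m4 k4).1]
  swap
  · have := (he m4 k4).2
    have : (11 : ℕ).size ≤ 11 := Nat.size_le.2 (by norm_num)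
    simp only [Expr.cost]
    omega
  rintro m5 rfl
  set m5 := m4.write 0 11 L with hm5
  have s5 : Same [] [11] m4 m5 := same_write _ _ _
  have h7 : m5 0 7 = s := by rw [s5.2 7 (by simp), s4.2 7 (by simp), hm3, write_same]
  -- For `s = 0` the draw returns `0`, so only `l ≤ s` is available and not `l < s`; the writes at
  -- index `l` are then harmless.
  have hr : Sampled (.rand 0 (.const 10) (V 7)) m5 (uniformBelow s)
      (fun v m' => m' = m5.write 0 10 v ∧ v ≤ s) (10 * S) := by
    have := Sampled.rand (a := 0) (e := .const 10) (f := V 7) (m := m5) (M := M) (S := S) ?_ ?_ hSz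
    · simp only [Expr.eval, h7] at this
      exact this.mono (fun _ _ h => h) (by simp only [Expr.nodes]; omega)
    · simp only [Expr.Small]; omega
    · simp only [Expr.Small, Expr.eval, h7]; omega
  refine hr.seq (K' := KA + 1850 * (S * S)) ?_ (by omega)
  rintro l m6 ⟨rfl, hl⟩
  have s6 := same_write m5 10 l
  set m6 := m5.write 0 10 l with hm6
  have q6 : m6 0 2 = F.q i := by
    rw [s6.2 2 (by simp), s5.2 2 (by simp), t4.2 2 (by simp), s12 0 (by omega) (by omega)]
    rfl
  refine (rand_sampled hB hi (a := 0) (e := .const 9) ?_ q6).seq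
    (K' := KA + 1840 * (S * S)) ?_ ?_
  · simp only [Expr.Small]; omega
  swap
  · simp only [Expr.nodes]; omega
  rintro α m7 rfl
  simp only [Expr.eval]
  have s7 := same_write m6 9 α.val
  set m7 := m6.write 0 9 α.val with hm7
  have f7 : m7 0 7 = s ∧ m7 0 8 = n ∧ m7 0 9 = α.val ∧ m7 0 10 = l ∧ m7 0 11 = L := by
    refine ⟨?_, ?_, ?_, ?_, ?_⟩
    · rw [s7.2 7 (by simp), s6.2 7 (by simp), h7]
    · rw [s7.2 8 (by simp), s6.2 8 (by simp), s5.2 8 (by simp), hm4, write_same]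
    · rw [hm7, write_same]
    · rw [s7.2 10 (by simp), hm6, write_same]
    · rw [s7.2 11 (by simp), s6.2 11 (by simp), hm5, write_same]
  have t5 : Same [] [7, 8, 11] m2 m5 := t4.trans s5 (by simp) (by simp) (by simp) (by simp)
  have t6 : Same [] [7, 8, 10, 11] m2 m6 := t5.trans s6 (by simp) (by simp) (by simp) (by simp)
  have t7 : Same [] [7, 8, 9, 10, 11] m2 m7 := t6.trans s7 (by simp) (by simp) (by simp) (by simp)
  have q7 : m7 0 2 = F.q i := by rw [s7.2 2 (by simp), q6]
  refine (fillC_sampled hB hi (a := 5) (N := 7) (by omega) q7 f7.1 (by omega) hsS hM).seq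
    (K' := KA + 1700 * (S * S)) ?_ (by omega)
  rintro c m8 ⟨s8, c8⟩
  refine (fillC_sampled hB hi (a := 15) (N := 8) (by omega) (by rw [s8.2 2 (by simp), q7])
    (by rw [s8.2 8 (by simp), f7.2.1]) (by omega) hnS hnM).seq
    (K' := KA + 1600 * (S * S)) ?_ (by omega)
  rintro x m9 ⟨s9, x9⟩
  have c9 : ∀ j : Fin s, m9 5 j = (c j).val := fun j => by
    rw [s9.1 5 (by omega) (by omega) (by simp), c8]
  have t9 : Same [5, 15] [13] m7 m9 := s8.trans s9 (by simp) (by simp) (by simp) (by simp)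
  have l9 : m9 0 10 = l := by rw [t9.2 10 (by simp), f7.2.2.2.1]
  refine Sampled.assign_seq (M := M) (S := S) (K := KA + 1590 * (S * S)) ?_ ?_ hSz ?_ ?_
  · simp only [Expr.Small, Expr.eval, l9]; omega
  · simp only [Expr.Small]; omega
  swap
  · simp only [Expr.nodes]; omega
  simp only [Expr.eval, l9]
  set m10 := m9.write 5 l 0 with hm10
  have s10 : Same [5] [] m9 m10 := same_write_array _ (by omega) _ _
  have l10 : m10 0 10 = l := by rw [s10.2 10 (by simp), l9]
  refine Sampled.assign_seq (M := M) (S := S) (K := KA + 1580 * (S * S)) ?_ ?_ hSz ?_ ?_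
  · simp only [Expr.Small, Expr.eval, l10]; omega
  · simp only [Expr.Small]; omega
  swap
  · simp only [Expr.nodes]; omega
  simp only [Expr.eval, l10]
  set m11 := m10.write 10 l 1 with hm11
  have s11 : Same [10] [] m10 m11 := same_write_array _ (by omega) _ _
  have t10 : Same [5, 15] [13] m7 m10 := t9.trans s10 (by simp) (by simp) (by simp) (by simp)
  have t11 : Same [5, 10, 15] [13] m7 m11 := t10.trans s11 (by simp) (by simp) (by simp) (by simp)
  have u10 : Same [5, 15] [7, 8, 9, 10, 11, 13] m2 m10 :=
    t7.trans t10 (by simp) (by simp) (by simp) (by simp)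
  have u11 : Same [5, 10, 15] [7, 8, 9, 10, 11, 13] m2 m11 :=
    t7.trans t11 (by simp) (by simp) (by simp) (by simp)
  set P := redParams X Y Z l α c x with hP
  have hPl : P.l ≤ s := hl
  have hFP := hFit P hPl
  have e0 : ∀ j, j < 7 → m11 0 j = m0 0 j := fun j hj => by
    rw [u11.2 j (by simp; omega), s12 0 (by omega) (by omega)]
  have hEnv : P.Env L m11 := by
    constructor
    · rw [e0 _ (by omega)]; rfl
    · rw [e0 _ (by omega)]; rfl
    · rw [e0 _ (by omega)]; rfl
    · rw [e0 _ (by omega)]; rfl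
    · rw [e0 _ (by omega)]; rfl
    · rw [e0 _ (by omega)]; rfl
    · rw [t11.2 _ (by simp), f7.1]
    · rw [t11.2 _ (by simp), f7.2.1]
    · rw [t11.2 _ (by simp), f7.2.2.1]; rfl
    · rw [t11.2 _ (by simp), f7.2.2.2.1]; rfl
    · rw [t11.2 _ (by simp), f7.2.2.2.2]
    -- The coefficient with index `l` is set to zero, since its contribution comes from `special`.
    · intro j
      rw [s11.1 5 (by omega) (by omega) (by simp), hm10]
      simp only [hP, redParams]
      by_cases hj : (j : ℕ) = l
      · rw [if_pos hj, hj, write_same, ZMod.val_zero]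
      · rw [if_neg hj, write_ne _ (fun _ => hj), c9]
    · intro j
      change _ = if (j : ℕ) = l then 1 else 0
      by_cases hj : (j : ℕ) = l
      · rw [if_pos hj, hj, hm11, write_same]
      · rw [if_neg hj, hm11, write_ne _ (fun _ => hj), u10.1 10 (by omega) (by omega) (by simp),
          s12 10 (by omega) (by omega), z0 10 (by omega)]
    · intro j
      rw [s11.1 15 (by omega) (by omega) (by simp), s10.1 15 (by omega) (by omega) (by simp), x9]
      rfl
  refine Sampled.seq_left (powC_env hB hi hFP hEnv _ α hEnv.gen hEnv.α (d := 12) (by omega)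
    (by omega) (by omega) (by omega)) (K' := KA + 1300 * (S * S)) ?_ (by omega)
  rintro m12 ⟨s12', h12⟩
  have hEnv12 := hEnv.same s12' (by simp) (by simp)
  have t12 : Same [5, 10, 15] [7, 8, 9, 10, 11, 12, 13, 20, 21] m2 m12 :=
    u11.trans s12' (by simp) (by simp) (by simp) (by simp)
  have z12 : ∀ a, m12 (reg 1 a) = fun _ => 0 := fun a => by
    rw [t12.1 _ (by simp only [reg]; omega) (by simp only [reg]; omega) (by simp [reg]; omega),
      s12 _ (by simp only [reg]; omega) (by simp only [reg]; omega),
      z0 _ (by simp only [reg]; omega)]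
  refine Sampled.seq_left (inputC_triple hB hi hFP hEnv12 ?_ hkM (F.gpow i α) h12 (z12 0))
    (K' := KA + 1000 * (S * S)) ?_ (by omega)
  · rw [s12'.2 0 (by simp), e0 0 (by omega)]; rfl
  rintro m13 ⟨s13, hin⟩
  have hEnv13 := hEnv12.same s13
    (by simp only [List.mem_singleton, forall_eq, reg]; omega) (by simp)
  have hview : View (reg 1) (A.width + 2) (F.gameInput k i (s + 1) n (F.gpow i α) x) m13 := by
    intro a _
    by_cases ha : a = 0
    · rw [ha, hin]
      rfl
    · rw [s13.1 _ (by simp only [reg]; omega) (by simp only [reg]; omega)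
        (by simpa [(reg_injective 1).eq_iff] using ha), z12]
      funext j
      simp [gameInput, inputMem, ha]
  have hMsize : ∀ v ≤ M, v.size ≤ S := fun v hv => by
    have := Nat.size_le_size hv
    omega
  have hsz : SizeLe (A.width + 2) (F.gameInput k i (s + 1) n (F.gpow i α) x) S := by
    refine sizeLe_inputMem _ ?_ _
    intro v hv
    simp only [List.mem_cons, List.mem_ofFn] at hv
    rcases hv with rfl | rfl | rfl | rfl | rfl | rfl | rfl | ⟨j, rfl⟩
    · exact hMsize _ hkM
    · exact hMsize _ hd
    · exact hMsize _ hqM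
    · exact hMsize _ (hB.enc i hi _)
    · exact hMsize _ (hB.enc i hi _)
    · exact hMsize _ (by omega)
    · exact hMsize _ (by omega)
    · exact hMsize _ ((ZMod.val_lt _).le.trans hqM)
  have hbS : F.bound.eval k ≤ S := by
    have := hB.mul
    omega
  refine Sampled.map_left (Q' := fun b m' => outputBit m' = b) ?_
  have hsim : Sampled (A.subst (reg 1) (simC F)) m13
      (A.exec (F.toOracle i s n P.kernel) (F.gameInput k i (s + 1) n (F.gpow i α) x))
      (fun z m' => View (reg 1) (A.width + 2) z.1 m' ∧ (z.1 1 0).size ≤ S) KA := by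
    refine Lift.mono (lift_simC hi (hE P hPl) A (Nat.le_add_right _ 2) hview hEnv13 hbS hsz) ?_
    rintro z hz z' - ⟨h1, -, h3, h4⟩
    -- As the adversary takes at most `S` steps, the bound `max S z.2` on its entries collapses to
    -- `S`.
    have hzS := hA _ _ _ z hz
    rw [max_eq_left hzS] at h3 h4
    refine ⟨⟨h1, h3 1 (by omega) 0⟩, h4.trans ?_⟩
    rw [hKA]
    gcongr
  refine hsim.seq_right (K' := 1000 * (S * S)) ?_ le_rfl
  rintro z m14 ⟨h1, h2⟩
  have h14 : m14 (reg 1 1) 0 = z.1 1 0 := by rw [h1 1 (by omega)]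
  refine (Triple.assign_cost ?_).mono (fun _ h => h) ?_
  · simp only [Expr.eval, h14, outputBit, output, write_same]
    rfl
  · simp only [Expr.cost, Expr.eval, h14, Nat.size_zero]
    omega

end GroupFamily
-- Changes of variables and arithmetic in the exponent
theorem uniform_bind_equiv {α β γ : Type*} [Fintype α] [Nonempty α] [Fintype β] [Nonempty β]
    (e : α ≃ β) (f : β → PMF γ) :
    ((PMF.uniformOfFintype α).bind fun a => f (e a)) = (PMF.uniformOfFintype β).bind f := by
  rw [← map_equiv_uniform e, PMF.bind_map]
  rfl

theorem uniform_prod_bind {α β γ : Type*} [Fintype α] [Nonempty α] [Fintype β] [Nonempty β]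
    (f : α × β → PMF γ) : (PMF.uniformOfFintype (α × β)).bind f =
      (PMF.uniformOfFintype α).bind fun a => (PMF.uniformOfFintype β).bind fun b => f (a, b) := by
  rw [uniform_prod, PMF.bind_bind]
  simp only [PMF.bind_map]
  rfl

theorem bind_congr_support {α β : Type*} (μ : PMF α) {f g : α → PMF β}
    (h : ∀ a ∈ μ.support, f a = g a) : μ.bind f = μ.bind g := by
  ext b
  rw [PMF.bind_apply, PMF.bind_apply]
  refine tsum_congr fun a => ?_
  by_cases ha : a ∈ μ.support
  · rw [h a ha]
  · rw [PMF.mem_support_iff, not_not] at ha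
    simp [ha]

namespace GroupFamily

variable {F : GroupFamily} {k : ℕ} {i : F.Inst} {s n : ℕ}

theorem gen_pow_order (i : F.Inst) (y : F.G i) : y ^ F.q i = 1 := by
  rw [← F.card_eq i]
  exact pow_card_eq_one'

theorem gpow_natCast (m : ℕ) : F.gpow i (m : ZMod (F.q i)) = F.gen i ^ m := by
  rw [gpow, ZMod.val_natCast]
  conv_rhs => rw [← Nat.div_add_mod m (F.q i), pow_add, pow_mul, gen_pow_order, one_pow, one_mul]

theorem gpow_add (a b : ZMod (F.q i)) : F.gpow i (a + b) = F.gpow i a * F.gpow i b := by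
  have : a + b = ((a.val + b.val : ℕ) : ZMod (F.q i)) := by simp
  rw [this, gpow_natCast, pow_add]
  rfl

theorem gpow_mul (a b : ZMod (F.q i)) : F.gpow i (a * b) = F.gpow i a ^ b.val := by
  have : a * b = ((a.val * b.val : ℕ) : ZMod (F.q i)) := by simp
  rw [this, gpow_natCast, pow_mul]
  rfl

@[simp] theorem gpow_zero : F.gpow i 0 = 1 := by simp [gpow]

theorem gpow_eq_one_iff (a : ZMod (F.q i)) : F.gpow i a = 1 ↔ a = 0 := by
  refine ⟨fun h => ?_, fun h => by rw [h, gpow_zero]⟩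
  have ho : orderOf (F.gen i) = F.q i := by
    rw [← F.card_eq i]
    exact orderOf_eq_card_of_forall_mem_zpowers (F.gen_generates i)
  have h1 := orderOf_dvd_of_pow_eq_one h
  rw [ho] at h1
  have := Nat.eq_zero_of_dvd_of_lt h1 (ZMod.val_lt a)
  rwa [ZMod.val_eq_zero] at this

theorem unif_bind_equiv {γ : Type*} (e : ZMod (F.q i) ≃ ZMod (F.q i))
    (f : ZMod (F.q i) → PMF γ) : ((F.unif i).bind fun a => f (e a)) = (F.unif i).bind f :=
  uniform_bind_equiv e f

/-- Overwriting one entry of a random vector by a random residue gives a random vector. -/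
theorem unifVec_update {γ : Type*} (l : Fin s) (f : (Fin s → ZMod (F.q i)) → PMF γ) :
    ((F.unif i).bind fun b => (F.unifVec i s).bind fun c => f (Function.update c l b)) =
      (F.unifVec i s).bind f := by
  -- A random vector is its entry `l` together with an independent vector of the other entries, and
  -- overwriting discards exactly the former.
  set e := Equiv.funSplitAt l (ZMod (F.q i)) with he
  have h1 : ∀ g : (Fin s → ZMod (F.q i)) → PMF γ, (F.unifVec i s).bind g =
      (F.unif i).bind fun b => (PMF.uniformOfFintype ({j // j ≠ l} → ZMod (F.q i))).bind fun w =>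
        g (e.symm (b, w)) := by
    intro g
    rw [unifVec, ← uniform_bind_equiv e.symm g, uniform_prod_bind]
    rfl
  have h2 : ∀ b b' w, Function.update (e.symm (b', w)) l b = e.symm (b, w) := by
    intro b b' w
    funext j
    by_cases hj : j = l
    · subst hj
      simp [he, Equiv.funSplitAt, Equiv.piSplitAt]
    · simp [he, Equiv.funSplitAt, Equiv.piSplitAt, hj]
  rw [h1 f]
  congr 1
  funext b
  rw [h1]
  simp only [h2, PMF.bind_const]

/-! ### The hybrid games -/

/-- Take the first `l` entries from `u` and the others from `c`. -/
def merge (l : ℕ) {R : Type} (u c : Fin s → R) : Fin s → R := fun j =>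
  if (j : ℕ) < l then u j else c j

/-- The replies in which the first `l` coefficients are chosen afresh. -/
noncomputable def hybridReply (l : ℕ) (α : ZMod (F.q i)) (c : Fin s → ZMod (F.q i))
    (x : Fin n → ZMod (F.q i)) (I : Fin s ↪ Fin n) : PMF (F.Reply i s) :=
  (F.unif i).bind fun r => (F.unifVec i s).bind fun u =>
    PMF.pure (F.gpow i r, F.gpow i (r * α),
      fun j => F.gpow i (r * F.share i α (merge l u c) (x (I j))))

/-- The adversary's guess in a hybrid game. -/
noncomputable def hybrid (F : GroupFamily) (A : Cmd) (k : ℕ) (i : F.Inst) (s n l : ℕ) : PMF Bool :=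
  (F.unif i).bind fun α => (F.unifVec i s).bind fun c => (F.unifVec i n).bind fun x =>
    (A.exec (F.toOracle i s n (hybridReply l α c x))
      (F.gameInput k i (s + 1) n (F.gpow i α) x)).map fun z => outputBit z.1

/-- Shares are linear in the coefficients. This lets the reduction add the part with the unknown
coefficient in the exponent. -/
theorem share_add (α b x : ZMod (F.q i)) (c d : Fin s → ZMod (F.q i)) :
    F.share i α c x + b * F.share i 0 d x = F.share i α (fun j => c j + b * d j) x := by
  simp only [share, zero_add, Finset.mul_sum, add_assoc, ← Finset.sum_add_distrib]
  congr 2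
  funext j
  ring

theorem redParams_coeff_add (X Y Z : F.G i) {l : ℕ} (hl : l < s) (α : ZMod (F.q i))
    (c u : Fin s → ZMod (F.q i)) (x : Fin n → ZMod (F.q i)) (b : ZMod (F.q i)) :
    (fun j => (redParams X Y Z l α c x).coeff u j + b * (redParams X Y Z l α c x).unitVec j) =
      merge l u (Function.update c ⟨l, hl⟩ b) := by
  funext j
  simp only [Params.coeff, Params.unitVec, redParams, merge]
  rcases lt_trichotomy (j : ℕ) l with h | h | h
  · simp [h, h.ne]
  · have : j = ⟨l, hl⟩ := Fin.ext h
    subst this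
    simp
  · have : j ≠ ⟨l, hl⟩ := fun hj => by simp [hj] at h
    simp [h.not_gt, h.ne', this]

/-- The step from hybrid `l` to `l + 1`: it is irrelevant whether the value at index `l` is regarded
as the last fresh coefficient or the first fixed one, only whether it is redrawn. -/
theorem merge_update {l : ℕ} (hl : l < s) (c u : Fin s → ZMod (F.q i)) (b : ZMod (F.q i)) :
    merge l u (Function.update c ⟨l, hl⟩ b) = merge (l + 1) (Function.update u ⟨l, hl⟩ b) c := by
  funext j
  simp only [merge]
  rcases lt_trichotomy (j : ℕ) l with h | h | h
  · have : j ≠ ⟨l, hl⟩ := fun hj => by simp [hj] at h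
    simp [h, this, h.trans (Nat.lt_succ_self l)]
  · have : j = ⟨l, hl⟩ := Fin.ext h
    subst this
    simp
  · have : j ≠ ⟨l, hl⟩ := fun hj => by simp [hj] at h
    rw [if_neg (by omega), if_neg (by omega), Function.update_of_ne this]

/-- A simulated reply in terms of discrete logarithms: the base has exponent `r = a + a₀ * b`, and
`special` has exponent `b₀ * a + c₀ * b`, or zero if `r = 0`. -/
theorem answer_eq (a₀ b₀ c₀ : ZMod (F.q i)) (l : ℕ) (α : ZMod (F.q i))
    (c : Fin s → ZMod (F.q i)) (x : Fin n → ZMod (F.q i)) (I : Fin s ↪ Fin n)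
    (a b : ZMod (F.q i)) (u : Fin s → ZMod (F.q i)) (P : F.Params i s n)
    (hP : P = redParams (F.gpow i a₀) (F.gpow i b₀) (F.gpow i c₀) l α c x) :
    P.answer I a b u = (F.gpow i (a + a₀ * b), F.gpow i ((a + a₀ * b) * α), fun j =>
      F.gpow i ((a + a₀ * b) * F.share i α (P.coeff u) (x (I j)) +
        (if a + a₀ * b = 0 then 0 else b₀ * a + c₀ * b) * F.share i 0 P.unitVec (x (I j)))) := by
  have hb : P.base a b = F.gpow i (a + a₀ * b) := by
    rw [Params.base, hP, gpow_add, gpow_mul]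
    rfl
  have hs : P.special a b = F.gpow i (if a + a₀ * b = 0 then 0 else b₀ * a + c₀ * b) := by
    rw [Params.special, hb]
    by_cases h : a + a₀ * b = 0
    · simp [h]
    · rw [if_neg, if_neg h, hP, gpow_add, gpow_mul, gpow_mul]
      · rfl
      · intro h'
        rw [mul_eq_left, gpow_eq_one_iff] at h'
        exact h h'
  simp only [Params.answer, hb, hs, gpow_add, gpow_mul]
  rw [hP]
  rfl

/-- On a Diffie-Hellman triple the reduction plays one hybrid game. -/
theorem kernel_real (a₀ b₀ : ZMod (F.q i)) {l : ℕ} (hl : l < s) (α : ZMod (F.q i))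
    (c : Fin s → ZMod (F.q i)) (x : Fin n → ZMod (F.q i)) :
    (redParams (F.gpow i a₀) (F.gpow i b₀) (F.gpow i (a₀ * b₀)) l α c x).kernel =
      hybridReply l α (Function.update c ⟨l, hl⟩ b₀) x := by
  funext I
  set P := redParams (F.gpow i a₀) (F.gpow i b₀) (F.gpow i (a₀ * b₀)) l α c x with hP
  have h : ∀ a b u, P.answer I a b u = (F.gpow i (a + a₀ * b), F.gpow i ((a + a₀ * b) * α), fun j =>
      F.gpow i ((a + a₀ * b) *
        F.share i α (merge l u (Function.update c ⟨l, hl⟩ b₀)) (x (I j)))) := by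
    intro a b u
    rw [answer_eq a₀ b₀ _ l α c x I a b u P hP]
    -- On a Diffie-Hellman triple the exponent is `r * b₀`, which vanishes with `r`, so the case
    -- distinction disappears.
    have : (if a + a₀ * b = 0 then 0 else b₀ * a + a₀ * b₀ * b) = (a + a₀ * b) * b₀ := by
      split_ifs with h
      · rw [h, zero_mul]
      · ring
    simp only [this]
    simp only [mul_assoc, ← mul_add, share_add]
    rw [hP, redParams_coeff_add _ _ _ hl]
  simp only [Params.kernel, hybridReply, h]
  -- For fixed `b` the shift `a ↦ a + a₀ * b` is a bijection, so `r` is uniform and `b` drops out.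
  rw [PMF.bind_comm]
  have : ∀ b, ((F.unif i).bind fun a => (F.unifVec i s).bind fun u =>
      PMF.pure (F.gpow i (a + a₀ * b), F.gpow i ((a + a₀ * b) * α), fun j =>
      F.gpow i ((a + a₀ * b) *
        F.share i α (merge l u (Function.update c ⟨l, hl⟩ b₀)) (x (I j))))) = _ :=
    fun b => unif_bind_equiv (Equiv.addRight (a₀ * b)) fun r => (F.unifVec i s).bind fun u =>
      PMF.pure ((F.gpow i r, F.gpow i (r * α), fun j =>
      F.gpow i (r * F.share i α (merge l u (Function.update c ⟨l, hl⟩ b₀)) (x (I j)))) :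
        F.Reply i s)
  simp only [this, PMF.bind_const]

/-- On other triples the reduction plays the next hybrid game. -/
theorem kernel_random {a₀ b₀ c₀ : ZMod (F.q i)} (h₀ : c₀ ≠ a₀ * b₀) {l : ℕ} (hl : l < s)
    (α : ZMod (F.q i)) (c : Fin s → ZMod (F.q i)) (x : Fin n → ZMod (F.q i)) :
    (redParams (F.gpow i a₀) (F.gpow i b₀) (F.gpow i c₀) l α c x).kernel =
      hybridReply (l + 1) α c x := by
  funext I
  set P := redParams (F.gpow i a₀) (F.gpow i b₀) (F.gpow i c₀) l α c x with hP
  have hδ : c₀ - a₀ * b₀ ≠ 0 := sub_ne_zero.2 h₀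
  let g : ZMod (F.q i) → ZMod (F.q i) → (Fin s → ZMod (F.q i)) → F.Reply i s := fun r y u =>
    (F.gpow i r, F.gpow i (r * α), fun j => F.gpow i (r * F.share i α (P.coeff u) (x (I j)) +
      (if r = 0 then 0 else y) * F.share i 0 P.unitVec (x (I j))))
  have h1 : ∀ a b u, P.answer I a b u = g (a + a₀ * b) (b₀ * a + c₀ * b) u := fun a b u =>
    answer_eq a₀ b₀ c₀ l α c x I a b u P hP
  -- Cramer's rule: the map from `(a, b)` to the exponents has determinant `c₀ - a₀ * b₀`, so these
  -- exponents are independent and uniform.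
  let e : ZMod (F.q i) × ZMod (F.q i) ≃ ZMod (F.q i) × ZMod (F.q i) :=
    { toFun := fun z => (z.1 + a₀ * z.2, b₀ * z.1 + c₀ * z.2)
      invFun := fun z => ((c₀ * z.1 - a₀ * z.2) / (c₀ - a₀ * b₀),
        (z.2 - b₀ * z.1) / (c₀ - a₀ * b₀))
      left_inv := fun z => Prod.ext (by simp only; rw [div_eq_iff hδ]; ring)
        (by simp only; rw [div_eq_iff hδ]; ring)
      right_inv := fun z => Prod.ext
        (by simp only; rw [← mul_div_assoc, ← add_div, div_eq_iff hδ]; ring)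
        (by simp only; rw [← mul_div_assoc, ← mul_div_assoc, ← add_div, div_eq_iff hδ]; ring) }
  have h2 : P.kernel I = (F.unif i).bind fun r => (F.unif i).bind fun y =>
      (F.unifVec i s).bind fun u => PMF.pure (g r y u) := by
    simp only [Params.kernel, h1]
    have := uniform_bind_equiv e fun z => (F.unifVec i s).bind fun u => PMF.pure (g z.1 z.2 u)
    rw [uniform_prod_bind, uniform_prod_bind] at this
    exact this
  -- For `r ≠ 0` a uniform `y` may be written as `r * v`; for `r = 0` the reply does not depend on
  -- `y`.
  have h3 : ∀ r, ((F.unif i).bind fun y => (F.unifVec i s).bind fun u => PMF.pure (g r y u)) =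
      (F.unif i).bind fun v => (F.unifVec i s).bind fun u => PMF.pure (g r (r * v) u) := by
    intro r
    by_cases hr : r = 0
    · subst hr
      simp [g]
    · exact (unif_bind_equiv (Equiv.mulLeft₀ r hr) fun y => (F.unifVec i s).bind fun u =>
        PMF.pure (g r y u)).symm
  have h4 : ∀ r v u, g r (r * v) u = (F.gpow i r, F.gpow i (r * α), fun j => F.gpow i (r *
      F.share i α (merge (l + 1) (Function.update u ⟨l, hl⟩ v) c) (x (I j)))) := by
    intro r v u
    have : (if r = 0 then 0 else r * v) = r * v := by
      split_ifs with h
      · rw [h, zero_mul]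
      · rfl
    simp only [g, this, mul_assoc, ← mul_add, share_add]
    rw [hP, redParams_coeff_add _ _ _ hl, merge_update]
  rw [h2]
  simp only [h3, h4, hybridReply]
  congr 1
  funext r
  -- The fresh `v` at index `l` together with the remaining entries of `u` is again one uniform
  -- vector.
  exact unifVec_update ⟨l, hl⟩ fun u => PMF.pure ((F.gpow i r, F.gpow i (r * α), fun j => F.gpow i (r *
      F.share i α (merge (l + 1) u c) (x (I j)))) : F.Reply i s)

/-- Holds for every single triple off the Diffie-Hellman relation, so no averaging over `a₀, b₀, c₀`
is needed. -/
theorem redDist_random {a₀ b₀ c₀ : ZMod (F.q i)} (h₀ : c₀ ≠ a₀ * b₀) (A : Cmd) (hs : s ≠ 0) :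
    redDist F A k i s n (F.gpow i a₀) (F.gpow i b₀) (F.gpow i c₀) =
      (uniformBelow s).bind fun l => hybrid F A k i s n (l + 1) := by
  rw [redDist]
  refine bind_congr_support _ fun l hl => ?_
  have hl := (uniformBelow_support hl).2 hs
  rw [hybrid]
  refine congrArg _ (funext fun α => congrArg _ (funext fun c => congrArg _ (funext fun x => ?_)))
  rw [kernel_random h₀ hl]

/-- Here `b₀` has to be averaged over: it is the fixed coefficient with index `l` throughout the
game, and a random `b₀` turns the overwritten vector into a uniform one. The exponent `a₀` may be
arbitrary. -/
theorem redDist_real (a₀ : ZMod (F.q i)) (A : Cmd) (hs : s ≠ 0) :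
    ((F.unif i).bind fun b₀ => redDist F A k i s n (F.gpow i a₀) (F.gpow i b₀)
        (F.gpow i (a₀ * b₀))) = (uniformBelow s).bind fun l => hybrid F A k i s n l := by
  simp only [redDist]
  rw [PMF.bind_comm]
  refine bind_congr_support _ fun l hl => ?_
  have hl := (uniformBelow_support hl).2 hs
  rw [PMF.bind_comm, hybrid]
  refine congrArg _ (funext fun α => ?_)
  rw [← unifVec_update ⟨l, hl⟩]
  refine congrArg _ (funext fun b => congrArg _ (funext fun c => congrArg _ (funext fun x => ?_)))
  rw [kernel_real _ _ hl]

theorem hybridReply_zero (α : ZMod (F.q i)) (c : Fin s → ZMod (F.q i))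
    (x : Fin n → ZMod (F.q i)) : hybridReply 0 α c x = F.realReply i α c x := by
  funext I
  have : ∀ u, merge 0 u c = c := fun u => by funext j; simp [merge]
  simp only [hybridReply, realReply, this, PMF.bind_const]

/-- If two coefficient vectors give the same shares, dividing the differences by the nonzero points
leaves a polynomial of degree below `s` with `s` distinct zeros. Hence the map from coefficients to
shares is injective, so bijective on a finite set, and fresh coefficients mean fresh uniform shares.
-/
theorem hybridReply_last (α : ZMod (F.q i)) (c : Fin s → ZMod (F.q i))
    {x : Fin n → ZMod (F.q i)} (hx : Function.Injective x) (hx0 : ∀ j, x j ≠ 0) :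
    hybridReply s α c x = F.randomReply i α := by
  funext I
  have hm : ∀ u, merge s u c = u := fun u => by funext j; simp [merge]
  have hinj : Function.Injective fun (u : Fin s → ZMod (F.q i)) j => F.share i α u (x (I j)) := by
    intro u v huv
    have h0 : ∀ j : Fin s, ∑ l : Fin s, (u l - v l) * x (I j) ^ (l : ℕ) = 0 := by
      intro j
      have h1 := congrFun huv j
      simp only [share, add_right_inj] at h1
      have : x (I j) * ∑ l : Fin s, (u l - v l) * x (I j) ^ (l : ℕ) = 0 := by
        rw [← sub_eq_zero, ← Finset.sum_sub_distrib] at h1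
        rw [← h1, Finset.mul_sum]
        refine Finset.sum_congr rfl fun l _ => ?_
        ring
      exact (mul_eq_zero.1 this).resolve_left (hx0 _)
    have := Matrix.eq_zero_of_forall_index_sum_mul_pow_eq_zero
      (f := fun j => x (I j)) (v := fun l => u l - v l) (hx.comp I.injective) h0
    funext l
    exact sub_eq_zero.1 (congrFun this l)
  have hbij := Finite.injective_iff_bijective.1 hinj
  simp only [hybridReply, randomReply, hm]
  congr 1
  funext r
  exact uniform_bind_equiv (Equiv.ofBijective _ hbij) fun ρ =>
    PMF.pure ((F.gpow i r, F.gpow i (r * α), fun j => F.gpow i (r * ρ j)) : F.Reply i s)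

end GroupFamily
-- Error bounds and the hybrid argument
theorem bind_apply_le {α β : Type*} (μ : PMF α) {f g : α → PMF β} {b : β} {ε : α → ℝ≥0∞}
    (h : ∀ a ∈ μ.support, f a b ≤ g a b + ε a) :
    μ.bind f b ≤ μ.bind g b + ∑' a, μ a * ε a := by
  rw [PMF.bind_apply, PMF.bind_apply, ← ENNReal.tsum_add]
  refine ENNReal.tsum_le_tsum fun a => ?_
  rw [← mul_add]
  by_cases ha : a ∈ μ.support
  · gcongr
    exact h a ha
  · rw [PMF.mem_support_iff, not_not] at ha
    simp [ha]

theorem tsum_mul_const {α : Type*} (μ : PMF α) (c : ℝ≥0∞) : ∑' a, μ a * c = c := by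
  rw [ENNReal.tsum_mul_right, PMF.tsum_coe, one_mul]

/-- The probabilities of `b` under `μ` and `ν` differ by at most `ε`. -/
def Near {β : Type*} (μ ν : PMF β) (b : β) (ε : ℝ≥0∞) : Prop := μ b ≤ ν b + ε ∧ ν b ≤ μ b + ε

theorem Near.refl {β : Type*} (μ : PMF β) (b : β) (ε : ℝ≥0∞) : Near μ μ b ε :=
  ⟨le_self_add, le_self_add⟩

theorem near_one {β : Type*} (μ ν : PMF β) (b : β) : Near μ ν b 1 :=
  ⟨(μ.coe_le_one b).trans le_add_self, (ν.coe_le_one b).trans le_add_self⟩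

theorem Near.mono {β : Type*} {μ ν : PMF β} {b : β} {ε ε' : ℝ≥0∞} (h : Near μ ν b ε)
    (hε : ε ≤ ε') : Near μ ν b ε' :=
  ⟨h.1.trans (by gcongr), h.2.trans (by gcongr)⟩

theorem Near.bind {α β : Type*} {μ : PMF α} {f g : α → PMF β} {b : β} {ε : α → ℝ≥0∞}
    (h : ∀ a ∈ μ.support, Near (f a) (g a) b (ε a)) :
    Near (μ.bind f) (μ.bind g) b (∑' a, μ a * ε a) :=
  ⟨bind_apply_le μ fun a ha => (h a ha).1, bind_apply_le μ fun a ha => (h a ha).2⟩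

theorem Near.bind_const {α β : Type*} {μ : PMF α} {f g : α → PMF β} {b : β} {ε : ℝ≥0∞}
    (h : ∀ a ∈ μ.support, Near (f a) (g a) b ε) : Near (μ.bind f) (μ.bind g) b ε := by
  have := Near.bind h
  rwa [tsum_mul_const] at this

theorem Near.toReal {β : Type*} {μ ν : PMF β} {b : β} {ε : ℝ≥0∞} (h : Near μ ν b ε)
    (hε : ε ≠ ∞) : |(μ b).toReal - (ν b).toReal| ≤ ε.toReal := by
  have h1 := ENNReal.toReal_mono (ENNReal.add_ne_top.2 ⟨ν.apply_ne_top b, hε⟩) h.1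
  have h2 := ENNReal.toReal_mono (ENNReal.add_ne_top.2 ⟨μ.apply_ne_top b, hε⟩) h.2
  rw [ENNReal.toReal_add (ν.apply_ne_top b) hε] at h1
  rw [ENNReal.toReal_add (μ.apply_ne_top b) hε] at h2
  rw [abs_le]
  constructor <;> linarith

/-- Turns the random choice of `l` by the reduction into a sum over the hybrids, which can be
telescoped. -/
theorem uniformBelow_bind_toReal {β : Type*} (s : ℕ) (hs : s ≠ 0) (f : ℕ → PMF β) (b : β) :
    s * ((uniformBelow s).bind f b).toReal = ∑ l ∈ Finset.range s, (f l b).toReal := by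
  rw [PMF.bind_apply, tsum_eq_sum (s := Finset.range s), ENNReal.toReal_sum, Finset.mul_sum]
  · refine Finset.sum_congr rfl fun l hl => ?_
    rw [uniformBelow, dif_neg hs, PMF.uniformOfFinset_apply_of_mem _ hl, Finset.card_range,
      ENNReal.toReal_mul, ENNReal.toReal_inv, ENNReal.toReal_natCast, ← mul_assoc,
      mul_inv_cancel₀ (by exact_mod_cast hs), one_mul]
  · exact fun l _ => ENNReal.mul_ne_top (PMF.apply_ne_top _ _) (PMF.apply_ne_top _ _)
  · intro l hl
    rw [uniformBelow, dif_neg hs, PMF.uniformOfFinset_apply_of_notMem _ hl, zero_mul]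

namespace GroupFamily

variable {F : GroupFamily} {k M S : ℕ} {i : F.Inst} {s n : ℕ}

open Classical in
theorem tsum_unif (v : ZMod (F.q i)) (c : ℝ≥0∞) :
    ∑' a, F.unif i a * (if a = v then c else 0) = (F.q i : ℝ≥0∞)⁻¹ * c := by
  rw [tsum_eq_single v]
  · simp [unif, ZMod.card]
  · intro a ha
    simp [ha]

-- The sum is the probability of `true` in a Boolean experiment. Redrawing the entry `j` leaves the
-- experiment unchanged and makes it depend on a single residue.
open Classical in
theorem unifVec_eq_zero (j : Fin n) :
    ∑' x, F.unifVec i n x * (if x j = 0 then 1 else 0) = (F.q i : ℝ≥0∞)⁻¹ := by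
  have h : ∀ x : Fin n → ZMod (F.q i), (if x j = 0 then (1 : ℝ≥0∞) else 0) =
      PMF.pure (decide (x j = 0)) true := fun x => by
    by_cases hx : x j = 0 <;> simp [hx, PMF.pure_apply]
  simp only [h]
  rw [← PMF.bind_apply, ← unifVec_update j]
  simp only [Function.update_self, PMF.bind_const]
  rw [PMF.bind_apply, ← mul_one (F.q i : ℝ≥0∞)⁻¹, ← tsum_unif 0 1]
  refine tsum_congr fun a => ?_
  by_cases ha : a = 0 <;> simp [ha, PMF.pure_apply]

open Classical in
theorem unifVec_eq {j l : Fin n} (hjl : j ≠ l) :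
    ∑' x, F.unifVec i n x * (if x j = x l then 1 else 0) = (F.q i : ℝ≥0∞)⁻¹ := by
  have h : ∀ x : Fin n → ZMod (F.q i), (if x j = x l then (1 : ℝ≥0∞) else 0) =
      PMF.pure (decide (x j = x l)) true := fun x => by
    by_cases hx : x j = x l <;> simp [hx, PMF.pure_apply]
  simp only [h]
  -- Redraw the entry `j` while `x l` is kept: a fresh residue hits a given value with probability
  -- `1/q`.
  rw [← PMF.bind_apply, ← unifVec_update j, PMF.bind_comm]
  simp only [Function.update_self, Function.update_of_ne hjl.symm]
  have : ∀ c : Fin n → ZMod (F.q i), ((F.unif i).bind fun a =>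
      PMF.pure (decide (a = c l))) true = (F.q i : ℝ≥0∞)⁻¹ := by
    intro c
    rw [PMF.bind_apply, ← mul_one (F.q i : ℝ≥0∞)⁻¹, ← tsum_unif (c l) 1]
    refine tsum_congr fun a => ?_
    by_cases ha : a = c l <;> simp [ha, PMF.pure_apply]
  rw [PMF.bind_apply]
  simp only [this, tsum_mul_const]

open Classical in
/-- Random points are rarely equal or zero. -/
theorem unifVec_bad (i : F.Inst) (n : ℕ) : ∑' x, F.unifVec i n x *
    (if Function.Injective x ∧ ∀ j, x j ≠ 0 then 0 else 1) ≤
      (n + n * n : ℕ) * (F.q i : ℝ≥0∞)⁻¹ := by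
  -- Union bound over the `n` points that may vanish and, generously, all `n * n` ordered pairs that
  -- may coincide.
  have h : ∀ x : Fin n → ZMod (F.q i),
      (if Function.Injective x ∧ ∀ j, x j ≠ 0 then (0 : ℝ≥0∞) else 1) ≤
      ∑ j : Fin n, (if x j = 0 then 1 else 0) +
      ∑ z : Fin n × Fin n, if z.1 ≠ z.2 then (if x z.1 = x z.2 then 1 else 0) else 0 := by
    intro x
    split_ifs with hx
    · exact zero_le
    · rw [not_and_or] at hx
      rcases hx with hx | hx
      · simp only [Function.Injective, not_forall] at hx
        obtain ⟨a, b, hab, hne⟩ := hx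
        refine le_add_left ?_
        refine le_trans ?_ (Finset.single_le_sum (fun _ _ => zero_le) (Finset.mem_univ (a, b)))
        simp [hab, hne]
      · simp only [not_forall, not_not] at hx
        obtain ⟨a, ha⟩ := hx
        refine le_add_right ?_
        refine le_trans ?_ (Finset.single_le_sum (fun _ _ => zero_le) (Finset.mem_univ a))
        simp [ha]
  calc _ ≤ ∑' x, F.unifVec i n x * (∑ j : Fin n, (if x j = 0 then 1 else 0) +
        ∑ z : Fin n × Fin n, if z.1 ≠ z.2 then (if x z.1 = x z.2 then 1 else 0) else 0) :=
        ENNReal.tsum_le_tsum fun x => by gcongr; exact h x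
    _ = ∑ j : Fin n, ∑' x, F.unifVec i n x * (if x j = 0 then 1 else 0) +
        ∑ z : Fin n × Fin n, ∑' x, F.unifVec i n x *
          (if z.1 ≠ z.2 then (if x z.1 = x z.2 then 1 else 0) else 0) := by
        simp only [mul_add, Finset.mul_sum]
        rw [ENNReal.tsum_add, Summable.tsum_finsetSum fun _ _ => ENNReal.summable,
          Summable.tsum_finsetSum fun _ _ => ENNReal.summable]
    _ ≤ ∑ _j : Fin n, (F.q i : ℝ≥0∞)⁻¹ + ∑ _z : Fin n × Fin n, (F.q i : ℝ≥0∞)⁻¹ := by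
        gcongr with j _ z _
        · exact (unifVec_eq_zero j).le
        · split_ifs with hz
          · exact (unifVec_eq hz).le
          · simp
    _ = _ := by simp [add_mul]

/-- The probability that two random residues agree. -/
noncomputable def collision (F : GroupFamily) (k : ℕ) : ℝ≥0∞ :=
  ∑' i, F.setup k i * (F.q i : ℝ≥0∞)⁻¹

theorem collision_le_one (F : GroupFamily) (k : ℕ) : collision F k ≤ 1 := by
  rw [← tsum_mul_const (F.setup k) 1]
  refine ENNReal.tsum_le_tsum fun i => ?_
  gcongr
  rw [ENNReal.inv_le_one]
  exact_mod_cast (F.prime_q i).one_le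

theorem collision_ne_top (F : GroupFamily) (k : ℕ) : collision F k ≠ ∞ :=
  ((collision_le_one F k).trans_lt ENNReal.one_lt_top).ne

/-- The hybrid game after the choice of the group. -/
noncomputable def hybridGame (F : GroupFamily) (A : Cmd) (k s n l : ℕ) : PMF Bool :=
  (F.setup k).bind fun i => hybrid F A k i s n l

theorem gameGuess_false (A : Cmd) (k s n : ℕ) :
    F.gameGuess (s + 1) n A false k = hybridGame F A k s n 0 := by
  rw [hybridGame, gameGuess]
  refine congrArg _ (funext fun i => ?_)
  rw [hybrid]
  refine congrArg _ (funext fun α => congrArg _ (funext fun c => congrArg _ (funext fun x => ?_)))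
  rw [hybridReply_zero]
  rfl

/-- Hybrid `s` and the random game agree exactly for distinct nonzero points; for the other points
the trivial bound one is used. -/
theorem gameGuess_true (A : Cmd) (k s n : ℕ) :
    Near (hybridGame F A k s n s) (F.gameGuess (s + 1) n A true k) true
      ((n + n * n : ℕ) * collision F k) := by
  classical
  have : (n + n * n : ℕ) * collision F k =
      ∑' i, F.setup k i * ((n + n * n : ℕ) * (F.q i : ℝ≥0∞)⁻¹) := by
    rw [collision, ← ENNReal.tsum_mul_left]
    refine tsum_congr fun i => ?_
    ring
  rw [this, hybridGame, gameGuess]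
  refine Near.bind fun i _ => ?_
  rw [hybrid]
  refine Near.bind_const fun α _ => Near.bind_const fun c _ => ?_
  refine Near.mono (Near.bind (ε := fun x => if Function.Injective x ∧ ∀ j, x j ≠ 0 then 0 else 1)
    fun x _ => ?_) (unifVec_bad i n)
  by_cases hx : Function.Injective x ∧ ∀ j, x j ≠ 0
  · rw [if_pos hx, hybridReply_last α c hx.1 hx.2]
    exact Near.refl _ _ _
  · rw [if_neg hx]
    exact near_one _ _ _

/-- The decision of the reduction on a random triple is close to the next hybrid game. -/
theorem near_random (A : Cmd) (k : ℕ) {s : ℕ} (hs : s ≠ 0) (n : ℕ) :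
    Near ((F.setup k).bind fun i => (F.unif i).bind fun a => (F.unif i).bind fun b =>
        (F.unif i).bind fun c => redDist F A k i s n (F.gpow i a) (F.gpow i b) (F.gpow i c))
      ((uniformBelow s).bind fun l => hybridGame F A k s n (l + 1)) true (collision F k) := by
  classical
  -- Idle draws of a triple are inserted, so that both sides begin with the same random choices and
  -- can be compared triple by triple.
  have : ((uniformBelow s).bind fun l => hybridGame F A k s n (l + 1)) =
      (F.setup k).bind fun i => (F.unif i).bind fun _ => (F.unif i).bind fun _ =>
        (F.unif i).bind fun _ => (uniformBelow s).bind fun l => hybrid F A k i s n (l + 1) := by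
    simp only [hybridGame, PMF.bind_const]
    rw [PMF.bind_comm]
  rw [this, collision]
  refine Near.bind fun i _ => Near.bind_const fun a _ => Near.bind_const fun b _ => ?_
  rw [← mul_one (F.q i : ℝ≥0∞)⁻¹, ← tsum_unif (a * b) 1]
  refine Near.bind fun c _ => ?_
  split_ifs with hc
  · exact near_one _ _ _
  · rw [redDist_random hc A hs]
    exact Near.refl _ _ _

theorem eq_real (A : Cmd) (k : ℕ) {s : ℕ} (hs : s ≠ 0) (n : ℕ) :
    ((F.setup k).bind fun i => (F.unif i).bind fun a => (F.unif i).bind fun b =>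
        redDist F A k i s n (F.gpow i a) (F.gpow i b) (F.gpow i (a * b))) =
      (uniformBelow s).bind fun l => hybridGame F A k s n l := by
  simp only [redDist_real _ A hs, PMF.bind_const, hybridGame]
  rw [PMF.bind_comm]

/-- The hybrid argument: the advantage of the adversary in terms of that of the reduction. -/
theorem hybrid_advantage (A D : Cmd) (k s n : ℕ)
    (hD : ∀ i ∈ (F.setup k).support, ∀ X Y Z,
      ((D.exec noOracle (F.ddhInput k i X Y Z)).bind fun z => PMF.pure (outputBit z.1)) =
        redDist F A k i s n X Y Z) :
    |(hybridGame F A k s n 0 true).toReal - (hybridGame F A k s n s true).toReal| ≤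
      s * (|(F.ddhReal D k true).toReal - (F.ddhRandom D k true).toReal| +
        (collision F k).toReal) := by
  rcases eq_or_ne s 0 with rfl | hs
  · simp
  have h1 : F.ddhReal D k = (uniformBelow s).bind fun l => hybridGame F A k s n l := by
    rw [← eq_real A k hs n, ddhReal]
    refine bind_congr_support _ fun i hi => ?_
    refine congrArg _ (funext fun a => congrArg _ (funext fun b => ?_))
    exact hD i hi _ _ _
  have h2 : F.ddhRandom D k = (F.setup k).bind fun i => (F.unif i).bind fun a =>
      (F.unif i).bind fun b => (F.unif i).bind fun c =>
        redDist F A k i s n (F.gpow i a) (F.gpow i b) (F.gpow i c) := by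
    rw [ddhRandom]
    refine bind_congr_support _ fun i hi => ?_
    refine congrArg _ (funext fun a => congrArg _ (funext fun b => congrArg _ (funext fun c => ?_)))
    exact hD i hi _ _ _
  have h3 := (near_random A k hs n).toReal (collision_ne_top F k)
  rw [← h2] at h3
  have h4 := uniformBelow_bind_toReal s hs (fun l => hybridGame F A k s n l) true
  have h5 := uniformBelow_bind_toReal s hs (fun l => hybridGame F A k s n (l + 1)) true
  -- Telescoping: `s` times the difference of the averages over the hybrids `l` and `l + 1` is the
  -- difference of the two extreme hybrids.
  have h6 := Finset.sum_range_sub' (fun l => (hybridGame F A k s n l true).toReal) s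
  rw [Finset.sum_sub_distrib, ← h4, ← h5, ← h1, ← mul_sub] at h6
  rw [← h6, abs_mul, Nat.abs_cast]
  gcongr
  refine (abs_sub_le _ (F.ddhRandom D k true).toReal _).trans ?_
  gcongr

/-! ### The group order under the Diffie-Hellman assumption, and explicit bounds -/

/-- The distinguisher that checks whether the third element is the identity. -/
def testC (F : GroupFamily) : Cmd :=
  .seq (F.mulC 12 6 6) <|
    .ite (.add (.sub (V 12) (V 6)) (.sub (V 6) (V 12))) .skip (.assign 1 (.const 0) (.const 1))

-- Again the identity is recognised by `Z * Z = Z`. The output array starts at zero, so doing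
-- nothing means the answer `false`.
open Classical in
theorem testC_triple (hB : F.Bounds k M S) (henc : ∀ y, 2 * F.enc i y ≤ M)
    (hi : i ∈ (F.setup k).support) (X Y Z : F.G i) :
    Triple (testC F) (F.ddhInput k i X Y Z) (fun m' => outputBit m' = decide (Z = 1))
      (100 * S) := by
  have hM := hB.le
  have hS := hB.size
  refine (mulC_triple hB hi Z Z rfl rfl rfl (by omega) (by omega) (by omega)).seq (K' := 50 * S)
    ?_ (by omega)
  rintro m ⟨s1, h12⟩
  have h6 : m 0 6 = F.enc i Z := by rw [s1.2 6 (by simp)]; rfl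
  have h1 : m 1 0 = 0 := by rw [s1.1 1 (by omega) (by omega) (by simp)]; rfl
  have e1 := henc Z
  have e2 := henc (Z * Z)
  refine Triple.ite (M := M) (S := S) (K := 10 * S) ?_ hS ?_ ?_ ?_
  · simp only [Expr.Small, Expr.eval, h12, h6]
    omega
  · simp only [Expr.eval, h12, h6]
    intro h
    refine (Triple.skip ?_).mono (fun _ h => h) (by omega)
    have : Z ≠ 1 := by
      rintro rfl
      simp at h
    simp [outputBit, output, h1, this]
  · simp only [Expr.eval, h12, h6]
    intro h
    have h' : Z * Z = Z := F.enc_injective i (by omega)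
    have : Z = 1 := by simpa using h'
    refine (Triple.assign (M := M) (S := S) ?_ ?_ hS ?_).mono (fun _ h => h) ?_
    · simp only [Expr.Small]; omega
    · simp only [Expr.Small]; omega
    · simp [Expr.eval, outputBit, output, this]
    · simp only [Expr.nodes]; omega
  · simp only [Expr.nodes]; omega

/-- The elements have distinct representations of at most `F.bound.eval k` bits, so there are at
most that power of two of them. -/
theorem order_le (hi : i ∈ (F.setup k).support) : F.q i ≤ 2 ^ F.bound.eval k := by
  have h : ∀ y : F.G i, F.enc i y < 2 ^ F.bound.eval k := fun y =>
    Nat.size_le.1 (F.enc_size k i hi y)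
  rw [← F.card_eq i, ← Nat.card_fin (2 ^ F.bound.eval k)]
  refine Nat.card_le_card_of_injective (fun y => (⟨F.enc i y, h y⟩ : Fin _)) fun a b hab => ?_
  exact F.enc_injective i (congrArg Fin.val hab)

/-- The exponent `S - 2` is the largest for which `1 + M.size ≤ S`, since a power of two has one bit
more than its exponent. -/
theorem bounds_of_le (F : GroupFamily) {k S : ℕ}
    (hS : 3 * F.bound.eval k + F.mulProg.width + 50 ≤ S) :
    F.Bounds k (2 ^ (S - 2)) S ∧ ∀ i ∈ (F.setup k).support, ∀ y, 2 * F.enc i y ≤ 2 ^ (S - 2) := by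
  set b := F.bound.eval k with hb
  have h2 : 2 ^ (b + 1) ≤ 2 ^ (S - 2) := Nat.pow_le_pow_right (by omega) (by omega)
  have h3 : 2 ^ b * 2 ^ b + 2 ^ b ≤ 2 ^ (S - 2) := by
    have h1 : 1 ≤ 2 ^ b := Nat.one_le_two_pow
    have h5 : 2 ^ (2 * b + 1) ≤ 2 ^ (S - 2) := Nat.pow_le_pow_right (by omega) (by omega)
    have : 2 ^ (2 * b + 1) = 2 * (2 ^ b * 2 ^ b) := by
      rw [pow_succ, two_mul, pow_add]
      ring
    nlinarith
  have he : ∀ i ∈ (F.setup k).support, ∀ y, 2 * F.enc i y ≤ 2 ^ (S - 2) := by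
    intro i hi y
    have : F.enc i y < 2 ^ b := Nat.size_le.1 (F.enc_size k i hi y)
    rw [pow_succ] at h2
    omega
  refine ⟨⟨?_, ?_, by omega, ?_, ?_, ?_⟩, he⟩
  · exact (by norm_num : 100 ≤ 2 ^ 7).trans (Nat.pow_le_pow_right (by omega) (by omega))
  · rw [Nat.size_pow]
    omega
  · intro i hi
    have : F.desc i < 2 ^ b := Nat.size_le.1 (F.desc_size k i hi)
    rw [pow_succ] at h2
    omega
  · intro i hi y
    have := he i hi y
    omega
  · intro i hi
    have h : F.q i ≤ 2 ^ b := order_le hi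
    have := Nat.mul_le_mul h h
    omega

theorem large_of_le (hi : i ∈ (F.setup k).support) {E : ℕ}
    (hE : 3 * F.bound.eval k + F.mulProg.width + s + n + 50 ≤ E) (P : F.Params i s n)
    (hP : P.l ≤ s) : Large k P (F.bound.eval k + 2) E := by
  intro S hS
  obtain ⟨h1, h2⟩ := bounds_of_le F (k := k) (S := S) (by omega)
  refine ⟨h1, ?_, h2 i hi⟩
  have hlin : ∀ v, v + 12 ≤ S → v + 100 ≤ 2 ^ (S - 2) := by
    intro v hv
    have e1 : v < 2 ^ v := Nat.lt_two_pow_self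
    have e2 : 2 ^ (v + 8) ≤ 2 ^ (S - 2) := Nat.pow_le_pow_right (by omega) (by omega)
    rw [pow_add] at e2
    omega
  have hq := order_le hi
  refine ⟨hlin _ (by omega), hlin _ (by omega), ?_, ?_, by omega, by omega, by omega, ?_⟩
  · have := hlin (F.bound.eval k + 2) (by omega)
    omega
  · have := hlin P.l (by omega)
    omega
  · rw [pow_add]
    omega

end GroupFamily
-- The polynomial-time reduction and the conclusion
theorem Triple.bind_eq {β : Type*} {c : Cmd} {m : Mem} {Q : Mem → Prop} {K : ℕ}
    (h : Triple c m Q K) (f : Mem → β) {b : β} (hf : ∀ m', Q m' → f m' = b) :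
    ((c.exec noOracle m).bind fun z => PMF.pure (f z.1)) = PMF.pure b := by
  rw [bind_congr_support (g := fun _ => PMF.pure b) _ fun z hz => by rw [hf _ (h z hz).1],
    PMF.bind_const]

theorem Sampled.bind_eq {β : Type} {c : Cmd} {m : Mem} {μ : PMF β} {f : Mem → β} {K : ℕ}
    (h : Sampled c m μ (fun b m' => f m' = b) K) :
    ((c.exec noOracle m).bind fun z => PMF.pure (f z.1)) = μ := by
  have := Lift.map_eq (f := id) (g := fun z : Mem × ℕ => f z.1) h fun x y hxy => hxy.1.symm
  rw [PMF.map_id] at this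
  exact this.symm

theorem Sampled.cost_le {α : Type*} {c : Cmd} {m : Mem} {μ : PMF α} {Q : α → Mem → Prop} {K : ℕ}
    (h : Sampled c m μ Q K) : ∀ z ∈ (c.exec noOracle m).support, z.2 ≤ K := by
  intro z hz
  obtain ⟨x, _, hx⟩ := Lift.exists_left h hz
  exact hx.2

/-- A negligible function remains negligible after multiplication by a polynomial. -/
theorem Negligible.natPolynomial_mul {f : ℕ → ℝ} (hf : Negligible f) (p : Polynomial ℕ) :
    Negligible fun k => ((p.eval k : ℕ) : ℝ) * f k := by
  have := Asymptotics.SuperpolynomialDecay.polynomial_mul hf (p.map (Nat.castRingHom ℝ))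
  refine this.congr fun k => ?_
  have h : ((p.eval k : ℕ) : ℝ) = (p.map (Nat.castRingHom ℝ)).eval (k : ℝ) := by
    simp [Polynomial.eval_map]
  rw [h]

theorem Negligible.of_le {f g : ℕ → ℝ} (hf : Negligible f) (h0 : ∀ k, 0 ≤ g k)
    (h : ∀ k, g k ≤ f k) : Negligible g :=
  hf.trans_abs_le fun k => by
    rw [abs_of_nonneg (h0 k)]
    exact (h k).trans (le_abs_self _)

namespace GroupFamily

variable {F : GroupFamily}

theorem testC_exec {k : ℕ} {i : F.Inst} (hi : i ∈ (F.setup k).support) (X Y Z : F.G i) :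
    Triple (testC F) (F.ddhInput k i X Y Z) (fun m' => outputBit m' = true ↔ Z = 1)
      (100 * (3 * F.bound.eval k + F.mulProg.width + 50)) := by
  classical
  obtain ⟨h1, h2⟩ := bounds_of_le F (k := k) le_rfl
  exact (testC_triple h1 (h2 i hi) hi X Y Z).mono (fun m' h => by rw [h, decide_eq_true_iff]) le_rfl

open Classical in
theorem testC_eq {k : ℕ} {i : F.Inst} (hi : i ∈ (F.setup k).support) (X Y : F.G i)
    (c : ZMod (F.q i)) :
    (((testC F).exec noOracle (F.ddhInput k i X Y (F.gpow i c))).bind fun z =>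
      PMF.pure (outputBit z.1)) true = if c = 0 then 1 else 0 := by
  rw [(testC_exec hi X Y (F.gpow i c)).bind_eq outputBit (b := decide (c = 0))]
  · by_cases hc : c = 0 <;> simp [hc, PMF.pure_apply]
  · intro m' h
    rw [gpow_eq_one_iff] at h
    rw [Bool.eq_iff_iff, h, decide_eq_true_iff]

theorem testC_random (F : GroupFamily) (k : ℕ) :
    F.ddhRandom (testC F) k true = collision F k := by
  classical
  rw [ddhRandom, PMF.bind_apply, collision]
  refine tsum_congr fun i => ?_
  by_cases hi : i ∈ (F.setup k).support
  · have h : ∀ a b, ((F.unif i).bind fun c =>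
        ((testC F).exec noOracle (F.ddhInput k i (F.gpow i a) (F.gpow i b) (F.gpow i c))).bind
          fun z => PMF.pure (outputBit z.1)) true = (F.q i : ℝ≥0∞)⁻¹ := by
      intro a b
      rw [PMF.bind_apply, tsum_congr fun c => by rw [testC_eq hi], tsum_unif, mul_one]
    rw [PMF.bind_apply, tsum_congr fun a => by
      rw [PMF.bind_apply, tsum_congr fun b => by rw [h a b], tsum_mul_const], tsum_mul_const]
  · rw [PMF.mem_support_iff, not_not] at hi
    rw [hi, zero_mul, zero_mul]

/-- A product of random residues is zero more often than a random residue. -/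
theorem testC_real (F : GroupFamily) (k : ℕ) :
    collision F k + collision F k * 2⁻¹ ≤ F.ddhReal (testC F) k true := by
  classical
  rw [ddhReal, PMF.bind_apply, collision, ← ENNReal.tsum_mul_right, ← ENNReal.tsum_add]
  refine ENNReal.tsum_le_tsum fun i => ?_
  by_cases hi : i ∈ (F.setup k).support
  · rw [mul_assoc, ← mul_add]
    gcongr
    -- For `a = 0` the product always vanishes, and `1 ≥ 1/q + 1/2` since `q ≥ 2`; for other `a` it
    -- vanishes with probability `1/q`. Averaging over `a` gives `1/q + 1/(2q)`.
    have h : ∀ a, (F.q i : ℝ≥0∞)⁻¹ + (if a = 0 then 2⁻¹ else 0) ≤ ((F.unif i).bind fun b =>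
        ((testC F).exec noOracle
          (F.ddhInput k i (F.gpow i a) (F.gpow i b) (F.gpow i (a * b)))).bind
            fun z => PMF.pure (outputBit z.1)) true := by
      intro a
      rw [PMF.bind_apply, tsum_congr fun b => by rw [testC_eq hi]]
      by_cases ha : a = 0
      · simp only [ha, zero_mul, if_true, mul_one, PMF.tsum_coe]
        rw [← ENNReal.inv_two_add_inv_two]
        gcongr
        exact_mod_cast (F.prime_q i).two_le
      · simp only [ha, mul_eq_zero, false_or, if_false, add_zero]
        rw [tsum_unif, mul_one]
    rw [PMF.bind_apply]
    refine le_trans (le_of_eq ?_) (ENNReal.tsum_le_tsum fun a => mul_le_mul_right (h a) _)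
    simp only [mul_add]
    rw [ENNReal.tsum_add, tsum_mul_const, tsum_unif]
  · rw [PMF.mem_support_iff, not_not] at hi
    rw [hi, zero_mul, zero_mul, zero_mul, add_zero]

/-- Under the Decision Diffie-Hellman assumption the group order is large. -/
theorem collision_negligible (h : F.DDH) : Negligible fun k => (collision F k).toReal := by
  have hD : F.DDHPolyTime (testC F) := by
    refine ⟨100 * (3 * F.bound + Polynomial.C F.mulProg.width + 50), fun k i hi X Y Z z hz => ?_⟩
    have := (testC_exec hi X Y Z z hz).2
    simpa using this
  -- The test distinguishes with advantage at least half the collision probability, hence the factor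
  -- two.
  have h2 := (h _ hD).const_mul 2
  refine Negligible.of_le h2 (fun k => ENNReal.toReal_nonneg) fun k => ?_
  have h3 := ENNReal.toReal_mono (PMF.apply_ne_top _ _) (testC_real F k)
  rw [ENNReal.toReal_add (collision_ne_top F k)
    (ENNReal.mul_ne_top (collision_ne_top F k) (by simp)), ENNReal.toReal_mul] at h3
  have h4 : (2⁻¹ : ℝ≥0∞).toReal = 1 / 2 := by simp
  rw [h4] at h3
  have h5 := le_abs_self ((F.ddhReal (testC F) k true).toReal -
    (F.ddhRandom (testC F) k true).toReal)
  rw [testC_random] at h5 ⊢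
  linarith

/-- There is an efficient distinguisher that plays a random hybrid game. -/
theorem exists_reduction (F : GroupFamily) (t n : ℕ → ℕ) (ht : ∀ k, 1 ≤ t k)
    (htn : ∀ k, t k ≤ n k) (htc : PolyTimeComputable t) (hnc : PolyTimeComputable n)
    (hn : ∃ p : Polynomial ℕ, ∀ k, n k ≤ p.eval k) (A : Cmd) (hA : F.GamePolyTime t n A) :
    ∃ D : Cmd, F.DDHPolyTime D ∧ ∀ k, ∀ i ∈ (F.setup k).support, ∀ X Y Z,
      ((D.exec noOracle (F.ddhInput k i X Y Z)).bind fun z => PMF.pure (outputBit z.1)) =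
        redDist F A k i (t k - 1) (n k) X Y Z := by
  obtain ⟨ct, pt, hct⟩ := htc
  obtain ⟨cn, pn, hcn⟩ := hnc
  obtain ⟨pA, hA⟩ := hA
  obtain ⟨pb, hpb⟩ := hn
  obtain ⟨e, Pe, he⟩ := exists_expr_polynomial (F.bound + 2)
  -- A single polynomial that dominates all sizes and running times; it plays the role of `S` in
  -- `reduction_sampled`.
  let PS : Polynomial ℕ := 3 * F.bound + Polynomial.C F.mulProg.width + 2 * pb +
    2 * Polynomial.X + pt + pn + pA + Pe + 100
  have hPS : ∀ k, PS.eval k = 3 * F.bound.eval k + F.mulProg.width + 2 * pb.eval k +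
      2 * k + pt.eval k + pn.eval k + pA.eval k + Pe.eval k + 100 := fun k => by simp [PS]
  have key : ∀ k, ∀ i ∈ (F.setup k).support, ∀ X Y Z,
      Sampled (reduction F A ct cn e) (F.ddhInput k i X Y Z) (redDist F A k i (t k - 1) (n k) X Y Z)
        (fun b m' => outputBit m' = b)
        (PS.eval k * (10000 * ((PS.eval k + PS.eval k + 3) * (PS.eval k + PS.eval k + 3) *
          (PS.eval k + PS.eval k + 3))) + 2000 * (PS.eval k * PS.eval k)) := by
    intro k i hi X Y Z
    have e1 := hPS k
    have e2 := ht k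
    have e3 := htn k
    have e4 := hpb k
    have e5 : t k - 1 + 1 = t k := by omega
    refine reduction_sampled (L := F.bound.eval k + 2) (pt := pt.eval k) (pn := pn.eval k) hi
      (fun P hP => large_of_le hi (by omega) P hP) (by omega) ?_ (hcn k) ?_ ?_ X Y Z
    · rw [e5]
      exact hct k
    · rintro m hm
      have := he m
      rw [hm] at this
      refine ⟨by simpa using this.1, by omega⟩
    · intro h x R z hz
      rw [e5] at hz
      have := hA k i hi h x R z hz
      omega
  refine ⟨reduction F A ct cn e, ⟨PS * (10000 * ((PS + PS + 3) * (PS + PS + 3) * (PS + PS + 3))) +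
    2000 * (PS * PS), fun k i hi X Y Z z hz => ?_⟩, fun k i hi X Y Z => (key k i hi X Y Z).bind_eq⟩
  have := (key k i hi X Y Z).cost_le z hz
  simpa using this

/-- The guess is right with probability `(1 - p₀ + p₁) / 2`, where `p₀` and `p₁` are the
probabilities of the guess `true` in the two games. -/
theorem gameWin_eq (F : GroupFamily) (t n : ℕ) (A : Cmd) (k : ℕ) :
    |(F.gameWin t n A k true).toReal - 1 / 2| =
      |(F.gameGuess t n A false k true).toReal - (F.gameGuess t n A true k true).toReal| / 2 := by
  have h1 : ∀ μ : PMF Bool, (μ false).toReal = 1 - (μ true).toReal := by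
    intro μ
    have := μ.tsum_coe
    rw [tsum_bool] at this
    have h := congrArg ENNReal.toReal this
    rw [ENNReal.toReal_add (μ.apply_ne_top _) (μ.apply_ne_top _), ENNReal.toReal_one] at h
    linarith
  have h2 : ∀ (μ : PMF Bool) (b : Bool),
      (μ.bind fun b' => PMF.pure (decide (b' = b))) true = μ b := by
    intro μ b
    rw [PMF.bind_apply, tsum_bool]
    cases b <;> simp [PMF.pure_apply]
  have h3 : (F.gameWin t n A k true).toReal = ((F.gameGuess t n A false k false).toReal +
      (F.gameGuess t n A true k true).toReal) / 2 := by
    rw [gameWin, PMF.bind_apply, tsum_bool, h2, h2, ENNReal.toReal_add, ENNReal.toReal_mul,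
      ENNReal.toReal_mul]
    · simp
      ring
    · exact ENNReal.mul_ne_top (PMF.apply_ne_top _ _) (PMF.apply_ne_top _ _)
    · exact ENNReal.mul_ne_top (PMF.apply_ne_top _ _) (PMF.apply_ne_top _ _)
  rw [h3, h1, ← abs_neg, ← abs_of_pos (two_pos (α := ℝ)), ← abs_div]
  congr 1
  ring

end GroupFamily
end RunInd

theorem mainTheorem6 (F : RunInd.GroupFamily) (hDDH : F.DDH) (t n : ℕ → ℕ)
    (ht : ∀ k, 1 ≤ t k) (htn : ∀ k, t k ≤ n k)
    (htc : RunInd.PolyTimeComputable t) (hnc : RunInd.PolyTimeComputable n)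
    (hn : ∃ p : Polynomial ℕ, ∀ k, n k ≤ p.eval k)
    (A : RunInd.Cmd) (hA : F.GamePolyTime t n A) :
    RunInd.Negligible fun k => |(F.gameWin (t k) (n k) A k true).toReal - 1 / 2| := by
  obtain ⟨D, hD, hred⟩ := RunInd.GroupFamily.exists_reduction F t n ht htn htc hnc hn A hA
  obtain ⟨p, hp⟩ := hn
  have hcoll := RunInd.GroupFamily.collision_negligible hDDH
  -- The first summand pays for the steps between hybrids, of which there are `s ≤ p k`; the second
  -- pays for coinciding or vanishing points, of weight `n + n * n`.
  refine RunInd.Negligible.of_le ((RunInd.Negligible.natPolynomial_mul ((hDDH D hD).add hcoll) p).add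
    (RunInd.Negligible.natPolynomial_mul hcoll (p + p * p))) (fun k => abs_nonneg _) fun k => ?_
  obtain ⟨s, hs⟩ : ∃ s, t k = s + 1 := ⟨t k - 1, by have := ht k; omega⟩
  have h1 := RunInd.GroupFamily.hybrid_advantage A D k s (n k) fun i hi X Y Z => by
    rw [hred k i hi, hs]
    rfl
  have h2 := (RunInd.GroupFamily.gameGuess_true (F := F) A k s (n k)).toReal
    (ENNReal.mul_ne_top (ENNReal.natCast_ne_top _) (RunInd.GroupFamily.collision_ne_top F k))
  rw [ENNReal.toReal_mul, ENNReal.toReal_natCast] at h2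
  have h3 := abs_sub_le (F.gameGuess (s + 1) (n k) A false k true).toReal
    (RunInd.GroupFamily.hybridGame F A k s (n k) s true).toReal
    (F.gameGuess (s + 1) (n k) A true k true).toReal
  rw [RunInd.GroupFamily.gameGuess_false] at h3
  rw [RunInd.GroupFamily.gameWin_eq, hs, RunInd.GroupFamily.gameGuess_false]
  have hsp : (s : ℝ) ≤ (p.eval k : ℕ) := by
    have := hp k
    have := htn k
    exact_mod_cast (by omega : s ≤ p.eval k)
  have hnp : ((n k + n k * n k : ℕ) : ℝ) ≤ ((p + p * p).eval k : ℕ) := by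
    have h := hp k
    have := Nat.mul_le_mul h h
    rw [Polynomial.eval_add, Polynomial.eval_mul]
    exact_mod_cast add_le_add h this
  have hc : 0 ≤ (RunInd.GroupFamily.collision F k).toReal := ENNReal.toReal_nonneg
  have h4 := mul_le_mul_of_nonneg_right hsp (add_nonneg (abs_nonneg
    ((F.ddhReal D k true).toReal - (F.ddhRandom D k true).toReal)) hc)
  have h5 := mul_le_mul_of_nonneg_right hnp hc
  refine (half_le_self (abs_nonneg _)).trans ?_
  refine h3.trans (add_le_add (h1.trans h4) (h2.trans h5))
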